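/- Let $n,l$ be dimensions, $m>1$, $1\le m_1<m$, $t_f>0$. Consider the game with state $z={\rm col}(x,y)\in\mathbb R^{n+m}$, $$\dot x=A_1(t)x+A_2(t)y+C_1(t)v,\qquad \dot y=A_3(t)x+A_4(t)y+u+C_2(t)v,\qquad z(0)=z_0={\rm col}(x_0,y_0),$$ $u\in\mathbb R^m$, $v\in\mathbb R^l$, $t\in[0,t_f]$, and cost $$J(u,v)=x^T(t_f)F_1x(t_f)+\int_0^{t_f}\big[x^TD_1(t)x+y^TD_2(t)y+\varepsilon^2u^Tu-v^TG(t)v\big]dt,\qquad \varepsilon>0,$$ minimized by $u$ and maximized by $v$. Here $F_1$, $D_1(t)$ are symmetric positive semi-definite, $G(t)$ is symmetric positive definite, and $D_2(t)={\rm diag}(\lambda_1(t),\dots,\lambda_m(t))$ with $\lambda_p(t)>0$ for $p\le m_1$ and $\lambda_r(t)\equiv0$ for $r>m_1$ on $[0,t_f]$; all coefficients are continuous on $[0,t_f]$. Put $A=\begin{bmatrix}A_1&A_2\\A_3&A_4\end{bmatrix}$, $B=\begin{bmatrix}0\\I_m\end{bmatrix}$, $C=\begin{bmatrix}C_1\\C_2\end{bmatrix}$,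 $F=\begin{bmatrix}F_1&0\\0&0\end{bmatrix}$, $D=\begin{bmatrix}D_1&0\\0&D_2\end{bmatrix}$, $S_u(\varepsilon)=\varepsilon^{-2}BB^T$, $S_v=CG^{-1}C^T$; let $A_2=[\bar A_2,\bar A_3]$ with $\bar A_2$ of $m_1$ columns, $\Lambda={\rm diag}(\lambda_1,\dots,\lambda_{m_1})$ and $S_{v,1}=C_1G^{-1}C_1^T$. Feedbacks $u(z,t)$, $v(z,t)$ are measurable in $t$ and locally Lipschitz in $z$ uniformly in $t\in[0,t_f]$. $UV$ is the set of pairs of feedbacks for which the dynamics has, for every $z_0$, a unique absolutely continuous solution on $[0,t_f]$, along which $u$ and $v$ are square integrable; ${\mathcal E}_v(u)=\{v:(u,v)\in UV\}$ and ${\mathcal E}_u(v)=\{u:(u,v)\in UV\}$. The guaranteed results are $J_u(u;z_0)=\sup_{v\in{\mathcal E}_v(u)}J(u,v)$ and $J_v(v;z_0)=\inf_{u\in{\mathcal E}_u(v)}J(u,v)$ (when these sets are non-empty). A pair $(u^*,v^*)$ is a saddle point if $J_u(u^*;z_0)=J_v(v^*;z_0)$ for all $z_0$; the common number is the value of the game.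 Assume: (A2) $\bar A_3(t)\equiv0$ on $[0,t_f]$; (A3) $A_i$ $(i=1,\dots,4)$, $C_j$, $D_j$ $(j=1,2)$ and $G$ are continuously differentiable on $[0,t_f]$; (A4) the problem $$\dot K_1^o=-K_1^oA_1-A_1^TK_1^o+K_1^o\big[\bar A_2\Lambda^{-1}\bar A_2^T-S_{v,1}\big]K_1^o-D_1,\qquad K_1^o(t_f)=F_1,$$ has a solution on the entire interval $[0,t_f]$. Then there exist $\varepsilon_0>0$ and $M$, depending only on the game data $t_f,A_i,C_j,F_1,D_j,G$, such that for every $\varepsilon\in(0,\varepsilon_0]$: (i) (A1) the problem $$\dot K=-KA-A^TK+K\big[S_u(\varepsilon)-S_v\big]K-D,\qquad K(t_f)=F,$$ has a symmetric solution $K(t)=K(t,\varepsilon)$ on the entire interval $[0,t_f]$, and this solution is unique; (ii) on $[0,t_f]$ $$K(t,\varepsilon)=\begin{bmatrix}K_1&\varepsilon K_2&\varepsilon K_3\\ \varepsilon K_2^T&\varepsilon K_4&\varepsilon^2K_5\\ \varepsilon K_3^T&\varepsilon^2K_5^T&\varepsilon^2K_6\end{bmatrix}(t,\varepsilon)$$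 with diagonal blocks of sizes $n$, $m_1$, $m-m_1$, with $K_1,K_4,K_6$ symmetric, and with the entries of all $K_\alpha(t,\varepsilon)$ bounded in absolute value by $M$; (iii) the feedbacks $u^*_\varepsilon(z,t)=-\varepsilon^{-2}B^TK(t,\varepsilon)z$ and $v^*_\varepsilon(z,t)=G^{-1}(t)C^T(t)K(t,\varepsilon)z$ form an admissible pair and a saddle point of the game; for every $z_0$ the value is $J^*_\varepsilon=J(u^*_\varepsilon,v^*_\varepsilon)=z_0^TK(0,\varepsilon)z_0$, and $$J(u^*_\varepsilon,v)\le J^*_\varepsilon\le J(u,v^*_\varepsilon)\qquad\text{for all } u\in{\mathcal E}_u(v^*_\varepsilon),\ v\in{\mathcal E}_v(u^*_\varepsilon).$$ -/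

import Mathlib

open Set MeasureTheory
open scoped Matrix NNReal Topology

noncomputable section

/-- Entrywise (equivalently, normwise) continuous differentiability of a matrix-valued function
on a set of times. -/
def MatC1On {ι κ : Type*} (M : ℝ → Matrix ι κ ℝ) (s : Set ℝ) : Prop :=
  ∀ i j, ContDiffOn ℝ 1 (fun t => M t i j) s

/-- Entrywise continuity of a matrix-valued function on a set of times. -/
def MatContOn {ι κ : Type*} (M : ℝ → Matrix ι κ ℝ) (s : Set ℝ) : Prop :=
  ∀ i j, ContinuousOn (fun t => M t i j) s

/-- `M' ` is the derivative at `t` of the matrix-valued function `M` relative to `s`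
(one-sided at the end points of a closed interval). -/
def MatHasDerivWithinAt {ι κ : Type*} (M : ℝ → Matrix ι κ ℝ) (M' : Matrix ι κ ℝ)
    (s : Set ℝ) (t : ℝ) : Prop :=
  ∀ i j, HasDerivWithinAt (fun r => M r i j) (M' i j) s t

/-- The data of the game. The slow state `x` lies in `ℝⁿ`, the fast state `y` and the minimizer's
control `u` in `ℝᵐ` with `m = m₁ + m₂`, the maximizer's control `v` in `ℝˡ`. The coordinates of
`ℝᵐ` are indexed by `Fin m₁ ⊕ Fin m₂`: the first `m₁` ones, then the remaining `m₂ = m - m₁` ones.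
`lam t` is the diagonal of the state cost `D₂(t)`. Functions of time matter on `[0, tf]` only. -/
structure CheapGame (n m₁ m₂ l : ℕ) where
  tf : ℝ
  A₁ : ℝ → Matrix (Fin n) (Fin n) ℝ
  A₂ : ℝ → Matrix (Fin n) (Fin m₁ ⊕ Fin m₂) ℝ
  A₃ : ℝ → Matrix (Fin m₁ ⊕ Fin m₂) (Fin n) ℝ
  A₄ : ℝ → Matrix (Fin m₁ ⊕ Fin m₂) (Fin m₁ ⊕ Fin m₂) ℝ
  C₁ : ℝ → Matrix (Fin n) (Fin l) ℝ
  C₂ : ℝ → Matrix (Fin m₁ ⊕ Fin m₂) (Fin l) ℝ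
  F₁ : Matrix (Fin n) (Fin n) ℝ
  D₁ : ℝ → Matrix (Fin n) (Fin n) ℝ
  lam : ℝ → Fin m₁ ⊕ Fin m₂ → ℝ
  G : ℝ → Matrix (Fin l) (Fin l) ℝ

namespace CheapGame

variable {n m₁ m₂ l : ℕ}

/-- The index type of the full state `z = col(x, y)`. -/
abbrev Idx (n m₁ m₂ : ℕ) : Type := Fin n ⊕ (Fin m₁ ⊕ Fin m₂)

/-- The full state space. Only the topology, the measurable structure and the Lipschitz and
square-integrability classes of these spaces are used, none of which depends on the norm. -/
abbrev State (n m₁ m₂ : ℕ) : Type := Idx n m₁ m₂ → ℝ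

/-- The minimizer's control space. -/
abbrev UCtrl (m₁ m₂ : ℕ) : Type := Fin m₁ ⊕ Fin m₂ → ℝ

/-- The maximizer's control space. -/
abbrev VCtrl (l : ℕ) : Type := Fin l → ℝ

/-- State cost of the fast variable. -/
def D₂ (g : CheapGame n m₁ m₂ l) (t : ℝ) : Matrix (Fin m₁ ⊕ Fin m₂) (Fin m₁ ⊕ Fin m₂) ℝ :=
  Matrix.diagonal (g.lam t)

/-- The standing assumptions on the game. -/
structure Standing (g : CheapGame n m₁ m₂ l) : Prop where
  tf_pos : 0 < g.tf
  cont_A₁ : MatContOn g.A₁ (Icc 0 g.tf)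
  cont_A₂ : MatContOn g.A₂ (Icc 0 g.tf)
  cont_A₃ : MatContOn g.A₃ (Icc 0 g.tf)
  cont_A₄ : MatContOn g.A₄ (Icc 0 g.tf)
  cont_C₁ : MatContOn g.C₁ (Icc 0 g.tf)
  cont_C₂ : MatContOn g.C₂ (Icc 0 g.tf)
  cont_D₁ : MatContOn g.D₁ (Icc 0 g.tf)
  cont_D₂ : MatContOn g.D₂ (Icc 0 g.tf)
  cont_G : MatContOn g.G (Icc 0 g.tf)
  F₁_psd : g.F₁.PosSemidef
  D₁_psd : ∀ t ∈ Icc 0 g.tf, (g.D₁ t).PosSemidef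
  G_pd : ∀ t ∈ Icc 0 g.tf, (g.G t).PosDef
  lam_pos : ∀ t ∈ Icc 0 g.tf, ∀ p : Fin m₁, 0 < g.lam t (Sum.inl p)
  lam_zero : ∀ t ∈ Icc 0 g.tf, ∀ r : Fin m₂, g.lam t (Sum.inr r) = 0

/-! ### The game: feedback strategies, trajectories, payoff, saddle points -/

/-- Right-hand side of the dynamics at time `t`, state `z = col(x, y)` and control values `a`, `b`
of the minimizer and the maximizer. -/
def rhs (g : CheapGame n m₁ m₂ l) (t : ℝ) (z : State n m₁ m₂) (a : UCtrl m₁ m₂) (b : VCtrl l) :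
    State n m₁ m₂ :=
  Sum.elim
    (g.A₁ t *ᵥ (z ∘ Sum.inl) + g.A₂ t *ᵥ (z ∘ Sum.inr) + g.C₁ t *ᵥ b)
    (g.A₃ t *ᵥ (z ∘ Sum.inl) + g.A₄ t *ᵥ (z ∘ Sum.inr) + a + g.C₂ t *ᵥ b)

/-- State-feedback strategies with values in `ℝ^κ`: (Lebesgue) measurable in `t ∈ [0, tf]` for each
fixed state, and locally Lipschitz in the state uniformly in `t ∈ [0, tf]`. -/
def IsFeedback (g : CheapGame n m₁ m₂ l) {κ : Type} [Fintype κ]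
    (w : State n m₁ m₂ → ℝ → (κ → ℝ)) : Prop :=
  (∀ z, AEMeasurable (w z) (volume.restrict (Icc 0 g.tf))) ∧
  (∀ z, ∃ L : ℝ≥0, ∃ W ∈ 𝓝 z, ∀ t ∈ Icc 0 g.tf, LipschitzOnWith L (fun z' => w z' t) W)

/-- `z` is an absolutely continuous solution on `[0, tf]`, with `z(0) = z₀`, of the dynamics under
the feedbacks `u`, `v`. -/
def IsTrajectory (g : CheapGame n m₁ m₂ l) (u : State n m₁ m₂ → ℝ → UCtrl m₁ m₂)
    (v : State n m₁ m₂ → ℝ → VCtrl l) (z₀ : State n m₁ m₂) (z : ℝ → State n m₁ m₂) : Prop :=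
  z 0 = z₀ ∧ AbsolutelyContinuousOnInterval z 0 g.tf ∧
  ∀ᵐ t ∂(volume.restrict (Icc 0 g.tf)), HasDerivAt z (g.rhs t (z t) (u (z t) t) (v (z t) t)) t

/-- The set `UV` of admissible pairs of feedbacks. -/
def UV (g : CheapGame n m₁ m₂ l) :
    Set ((State n m₁ m₂ → ℝ → UCtrl m₁ m₂) × (State n m₁ m₂ → ℝ → VCtrl l)) :=
  {w | g.IsFeedback w.1 ∧ g.IsFeedback w.2 ∧
    ∀ z₀, ∃ z, g.IsTrajectory w.1 w.2 z₀ z ∧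
      (∀ z', g.IsTrajectory w.1 w.2 z₀ z' → EqOn z' z (Icc 0 g.tf)) ∧
      MemLp (fun t => w.1 (z t) t) 2 (volume.restrict (Icc 0 g.tf)) ∧
      MemLp (fun t => w.2 (z t) t) 2 (volume.restrict (Icc 0 g.tf))}

/-- Maximizer's feedbacks that are admissible against `u`. -/
def Ev (g : CheapGame n m₁ m₂ l) (u : State n m₁ m₂ → ℝ → UCtrl m₁ m₂) :
    Set (State n m₁ m₂ → ℝ → VCtrl l) :=
  {v | (u, v) ∈ g.UV}

/-- Minimizer's feedbacks that are admissible against `v`. -/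
def Eu (g : CheapGame n m₁ m₂ l) (v : State n m₁ m₂ → ℝ → VCtrl l) :
    Set (State n m₁ m₂ → ℝ → UCtrl m₁ m₂) :=
  {u | (u, v) ∈ g.UV}

/-- Minimizer's feedbacks against which the maximizer has an admissible reply. -/
def Hu (g : CheapGame n m₁ m₂ l) : Set (State n m₁ m₂ → ℝ → UCtrl m₁ m₂) :=
  {u | g.IsFeedback u ∧ (g.Ev u).Nonempty}

/-- Maximizer's feedbacks against which the minimizer has an admissible reply. -/
def Hv (g : CheapGame n m₁ m₂ l) : Set (State n m₁ m₂ → ℝ → VCtrl l) :=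
  {v | g.IsFeedback v ∧ (g.Eu v).Nonempty}

/-- The cost along a state function `z` when the feedbacks `u`, `v` are used. -/
def costAlong (g : CheapGame n m₁ m₂ l) (ε : ℝ) (u : State n m₁ m₂ → ℝ → UCtrl m₁ m₂)
    (v : State n m₁ m₂ → ℝ → VCtrl l) (z : ℝ → State n m₁ m₂) : ℝ :=
  (z g.tf ∘ Sum.inl) ⬝ᵥ (g.F₁ *ᵥ (z g.tf ∘ Sum.inl)) +
  ∫ t in (0 : ℝ)..g.tf,
    ((z t ∘ Sum.inl) ⬝ᵥ (g.D₁ t *ᵥ (z t ∘ Sum.inl)) +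
      (z t ∘ Sum.inr) ⬝ᵥ (g.D₂ t *ᵥ (z t ∘ Sum.inr)) +
      ε ^ 2 * (u (z t) t ⬝ᵥ u (z t) t) -
      v (z t) t ⬝ᵥ (g.G t *ᵥ v (z t) t))

/-- The payoff `J(u, v)` for the initial state `z₀`: the cost along the trajectory, which for
`(u, v) ∈ UV` exists and is unique on `[0, tf]`. -/
def J (g : CheapGame n m₁ m₂ l) (ε : ℝ) (u : State n m₁ m₂ → ℝ → UCtrl m₁ m₂)
    (v : State n m₁ m₂ → ℝ → VCtrl l) (z₀ : State n m₁ m₂) : ℝ :=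
  g.costAlong ε u v (Classical.epsilon (g.IsTrajectory u v z₀))

/-- Guaranteed result of a minimizer's feedback `u` (possibly `+∞`). -/
def Ju (g : CheapGame n m₁ m₂ l) (ε : ℝ) (u : State n m₁ m₂ → ℝ → UCtrl m₁ m₂)
    (z₀ : State n m₁ m₂) : EReal :=
  ⨆ v ∈ g.Ev u, (g.J ε u v z₀ : EReal)

/-- Guaranteed result of a maximizer's feedback `v` (possibly `-∞`). -/
def Jv (g : CheapGame n m₁ m₂ l) (ε : ℝ) (v : State n m₁ m₂ → ℝ → VCtrl l)
    (z₀ : State n m₁ m₂) : EReal :=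
  ⨅ u ∈ g.Eu v, (g.J ε u v z₀ : EReal)

/-- `(u, v)` is a saddle point: the two guaranteed results coincide for every initial state. -/
def IsSaddlePoint (g : CheapGame n m₁ m₂ l) (ε : ℝ) (u : State n m₁ m₂ → ℝ → UCtrl m₁ m₂)
    (v : State n m₁ m₂ → ℝ → VCtrl l) : Prop :=
  u ∈ g.Hu ∧ v ∈ g.Hv ∧ ∀ z₀, g.Ju ε u z₀ = g.Jv ε v z₀

/-- `V z₀` is the value of the game attained by the saddle point `(u, v)`. -/
def IsValue (g : CheapGame n m₁ m₂ l) (ε : ℝ) (u : State n m₁ m₂ → ℝ → UCtrl m₁ m₂)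
    (v : State n m₁ m₂ → ℝ → VCtrl l) (V : State n m₁ m₂ → ℝ) : Prop :=
  ∀ z₀, g.Ju ε u z₀ = (V z₀ : EReal) ∧ g.Jv ε v z₀ = (V z₀ : EReal)

/-! ### Riccati equations -/

def A (g : CheapGame n m₁ m₂ l) (t : ℝ) : Matrix (Idx n m₁ m₂) (Idx n m₁ m₂) ℝ :=
  Matrix.fromBlocks (g.A₁ t) (g.A₂ t) (g.A₃ t) (g.A₄ t)

/-- The constant matrix `B = col(0, I)`. -/
def B (n m₁ m₂ : ℕ) : Matrix (Idx n m₁ m₂) (Fin m₁ ⊕ Fin m₂) ℝ :=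
  Matrix.fromRows 0 1

def C (g : CheapGame n m₁ m₂ l) (t : ℝ) : Matrix (Idx n m₁ m₂) (Fin l) ℝ :=
  Matrix.fromRows (g.C₁ t) (g.C₂ t)

def F (g : CheapGame n m₁ m₂ l) : Matrix (Idx n m₁ m₂) (Idx n m₁ m₂) ℝ :=
  Matrix.fromBlocks g.F₁ 0 0 0

def D (g : CheapGame n m₁ m₂ l) (t : ℝ) : Matrix (Idx n m₁ m₂) (Idx n m₁ m₂) ℝ :=
  Matrix.fromBlocks (g.D₁ t) 0 0 (g.D₂ t)

def Su (n m₁ m₂ : ℕ) (ε : ℝ) : Matrix (Idx n m₁ m₂) (Idx n m₁ m₂) ℝ :=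
  (ε ^ 2)⁻¹ • (B n m₁ m₂ * (B n m₁ m₂)ᵀ)

def Sv (g : CheapGame n m₁ m₂ l) (t : ℝ) : Matrix (Idx n m₁ m₂) (Idx n m₁ m₂) ℝ :=
  g.C t * (g.G t)⁻¹ * (g.C t)ᵀ

/-- `K` solves, on the entire interval `[0, tf]`, the terminal-value problem
`K' = -K A - Aᵀ K + K (S_u(ε) - S_v) K - D`, `K(tf) = F`. -/
def SolvesRiccati (g : CheapGame n m₁ m₂ l) (ε : ℝ)
    (K : ℝ → Matrix (Idx n m₁ m₂) (Idx n m₁ m₂) ℝ) : Prop :=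
  K g.tf = g.F ∧
  ∀ t ∈ Icc 0 g.tf, MatHasDerivWithinAt K
    (-(K t * g.A t) - (g.A t)ᵀ * K t + K t * (Su n m₁ m₂ ε - g.Sv t) * K t - g.D t)
    (Icc 0 g.tf) t

/-- `K` is a symmetric solution, on the entire interval `[0, tf]`, of the full Riccati problem. -/
def IsSymmSolution (g : CheapGame n m₁ m₂ l) (ε : ℝ)
    (K : ℝ → Matrix (Idx n m₁ m₂) (Idx n m₁ m₂) ℝ) : Prop :=
  g.SolvesRiccati ε K ∧ ∀ t ∈ Icc 0 g.tf, (K t).IsSymm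

/-- First `m₁` columns of `A₂`. -/
def A₂l (g : CheapGame n m₁ m₂ l) (t : ℝ) : Matrix (Fin n) (Fin m₁) ℝ := (g.A₂ t).toCols₁

/-- Last `m₂` columns of `A₂`. -/
def A₂r (g : CheapGame n m₁ m₂ l) (t : ℝ) : Matrix (Fin n) (Fin m₂) ℝ := (g.A₂ t).toCols₂

/-- The positive definite part of the fast state cost. -/
def Lam (g : CheapGame n m₁ m₂ l) (t : ℝ) : Matrix (Fin m₁) (Fin m₁) ℝ :=
  Matrix.diagonal fun p => g.lam t (Sum.inl p)

/-- Upper left `n × n` block of `S_v`. -/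
def Sv₁ (g : CheapGame n m₁ m₂ l) (t : ℝ) : Matrix (Fin n) (Fin n) ℝ := (g.Sv t).toBlocks₁₁

/-- The last `m₂` columns of `A₂` vanish identically. -/
def AssumptionA2 (g : CheapGame n m₁ m₂ l) : Prop :=
  ∀ t ∈ Icc 0 g.tf, g.A₂r t = 0

/-- The coefficient functions are continuously differentiable on `[0, tf]`. -/
def AssumptionA3 (g : CheapGame n m₁ m₂ l) : Prop :=
  MatC1On g.A₁ (Icc 0 g.tf) ∧ MatC1On g.A₂ (Icc 0 g.tf) ∧
  MatC1On g.A₃ (Icc 0 g.tf) ∧ MatC1On g.A₄ (Icc 0 g.tf) ∧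
  MatC1On g.C₁ (Icc 0 g.tf) ∧ MatC1On g.C₂ (Icc 0 g.tf) ∧
  MatC1On g.D₁ (Icc 0 g.tf) ∧ MatC1On g.D₂ (Icc 0 g.tf) ∧
  MatC1On g.G (Icc 0 g.tf)

/-- The reduced (`n × n`) game Riccati problem has a solution on the entire interval `[0, tf]`. -/
def AssumptionA4 (g : CheapGame n m₁ m₂ l) : Prop :=
  ∃ K : ℝ → Matrix (Fin n) (Fin n) ℝ, K g.tf = g.F₁ ∧
    ∀ t ∈ Icc 0 g.tf, MatHasDerivWithinAt K
      (-(K t * g.A₁ t) - (g.A₁ t)ᵀ * K t +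
        K t * (g.A₂l t * (g.Lam t)⁻¹ * (g.A₂l t)ᵀ - g.Sv₁ t) * K t - g.D₁ t)
      (Icc 0 g.tf) t

/-- The full Riccati problem has a symmetric solution on the entire interval `[0, tf]`. -/
def AssumptionA1 (g : CheapGame n m₁ m₂ l) (ε : ℝ) : Prop :=
  ∃ K, g.IsSymmSolution ε K

/-- The `ε`-scaled block matrix with blocks `K₁, …, K₆`. -/
def scaledBlocks (ε : ℝ) (K₁ : Matrix (Fin n) (Fin n) ℝ) (K₂ : Matrix (Fin n) (Fin m₁) ℝ)
    (K₃ : Matrix (Fin n) (Fin m₂) ℝ) (K₄ : Matrix (Fin m₁) (Fin m₁) ℝ)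
    (K₅ : Matrix (Fin m₁) (Fin m₂) ℝ) (K₆ : Matrix (Fin m₂) (Fin m₂) ℝ) :
    Matrix (Idx n m₁ m₂) (Idx n m₁ m₂) ℝ :=
  Matrix.fromBlocks
    K₁ (Matrix.fromCols (ε • K₂) (ε • K₃))
    (Matrix.fromRows (ε • K₂ᵀ) (ε • K₃ᵀ))
    (Matrix.fromBlocks (ε • K₄) (ε ^ 2 • K₅) (ε ^ 2 • K₅ᵀ) (ε ^ 2 • K₆))

/-- All entries of a matrix are bounded by `M` in absolute value. -/
def EntriesLe {ι κ : Type*} (X : Matrix ι κ ℝ) (M : ℝ) : Prop := ∀ i j, |X i j| ≤ M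

/-- `K` has on `[0, tf]` the `ε`-scaled block form, with symmetric diagonal blocks and with blocks
bounded by `M`. (The scaling carries information because `M` is chosen independently of `ε`.) -/
def HasScaledBlockForm (g : CheapGame n m₁ m₂ l) (ε M : ℝ)
    (K : ℝ → Matrix (Idx n m₁ m₂) (Idx n m₁ m₂) ℝ) : Prop :=
  ∃ (K₁ : ℝ → Matrix (Fin n) (Fin n) ℝ) (K₂ : ℝ → Matrix (Fin n) (Fin m₁) ℝ)
    (K₃ : ℝ → Matrix (Fin n) (Fin m₂) ℝ) (K₄ : ℝ → Matrix (Fin m₁) (Fin m₁) ℝ)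
    (K₅ : ℝ → Matrix (Fin m₁) (Fin m₂) ℝ) (K₆ : ℝ → Matrix (Fin m₂) (Fin m₂) ℝ),
    ∀ t ∈ Icc 0 g.tf,
      K t = scaledBlocks ε (K₁ t) (K₂ t) (K₃ t) (K₄ t) (K₅ t) (K₆ t) ∧
      (K₁ t).IsSymm ∧ (K₄ t).IsSymm ∧ (K₆ t).IsSymm ∧
      EntriesLe (K₁ t) M ∧ EntriesLe (K₂ t) M ∧ EntriesLe (K₃ t) M ∧
      EntriesLe (K₄ t) M ∧ EntriesLe (K₅ t) M ∧ EntriesLe (K₆ t) M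

/-- The minimizer's linear feedback `-ε⁻² Bᵀ K(t) z`. -/
def uStar (ε : ℝ) (K : ℝ → Matrix (Idx n m₁ m₂) (Idx n m₁ m₂) ℝ) (z : State n m₁ m₂) (t : ℝ) :
    UCtrl m₁ m₂ :=
  -((ε ^ 2)⁻¹ • ((B n m₁ m₂)ᵀ *ᵥ (K t *ᵥ z)))

/-- The maximizer's linear feedback `G(t)⁻¹ C(t)ᵀ K(t) z`. -/
def vStar (g : CheapGame n m₁ m₂ l) (K : ℝ → Matrix (Idx n m₁ m₂) (Idx n m₁ m₂) ℝ)
    (z : State n m₁ m₂) (t : ℝ) : VCtrl l :=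
  (g.G t)⁻¹ *ᵥ ((g.C t)ᵀ *ᵥ (K t *ᵥ z))

end CheapGame

end

/-! Verification is completion of squares. If `K` solves the Riccati problem, then along every
admissible trajectory the derivative of zᵀKz is `gap` minus the running cost, where `gap` is ε²|u -
u*|² - (v - v*)ᵀG(v - v*). Hence J(u,v) = z₀ᵀK(0)z₀ + ∫ gap (`J_eq_add_integral_gap`), and the
saddle inequalities and the value follow from the signs of the two squares.

Solvability is the harder half, because S_u - S_v is indefinite and solutions might blow up. As D
and F are nonnegative, zero is a subsolution, so K ≥ 0; only an upper bound is missing, and any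
supersolution gives one (`exists_riccati_solution`). The supersolution has an upper left part with
blocks X₁, εX₂, εX₄ and a decoupled block ε²k·1 on the unweighted fast coordinates
(`exists_scaled_supersolution`). Here X₁ is a strict supersolution of the reduced equation, obtained
by perturbing its given solution, X₄ = (Λ + β)^{1/2} and X₂ = X₁Ā₂X₄⁻¹. Then X₂X₂ᵀ reproduces the
quadratic term of the reduced equation, the leading slow-fast coupling cancels, and (A2) makes the
coupling to the unweighted coordinates of order ε. After rescaling, the residual tends to a positive
definite block diagonal matrix, so by compactness it is positive definite for small parameters.

From 0 ≤ K ≤ X one gets |K_ij| ≤ c·w_i·w_j with weights 1, √ε, ε on the three groups of coordinates.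
This is the claimed order except for K₂ and K₅, where a factor √ε is lost. It is regained from the
equations: a suitably scaled column w of `K` in the weighted fast rows satisfies ε w' = P w - h with
bounded h, where P = ε⁻¹K restricted to those rows and columns. The block P itself solves ε P' = P²
- L with L ≥ μ² > 0, so P ≥ μ tanh(μ(t_f - t)/ε) (`layer_le_of_riccati`). This damping vanishes at
t_f but still bounds w uniformly in ε (`abs_le_of_stiff_linear`). -/

noncomputable section

namespace CheapGame

/-! ### Solvability of differential equations on a whole interval from a priori bounds. -/

section OrdinaryDifferentialEquations

open Metric

theorem exists_solution_of_lipschitz_of_bounded {E : Type*} [NormedAddCommGroup E]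
    [NormedSpace ℝ E] [CompleteSpace E] {f : ℝ → E → E} {a b t₀ : ℝ} (ht₀ : t₀ ∈ Icc a b)
    {K L : ℝ≥0} (hK : ∀ t ∈ Icc a b, LipschitzWith K (f t))
    (hc : ∀ x, ContinuousOn (f · x) (Icc a b)) (hL : ∀ t ∈ Icc a b, ∀ x, ‖f t x‖ ≤ L) (x₀ : E) :
    ∃ x : ℝ → E, x t₀ = x₀ ∧ ∀ t ∈ Icc a b, HasDerivWithinAt x (f t (x t)) (Icc a b) t := by
  have hab : a ≤ b := ht₀.1.trans ht₀.2
  -- The radius L(b - a) is the farthest a curve of speed at most L can travel, so no smallness of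
  -- the interval is needed.
  have hpl : IsPicardLindelof f (⟨t₀, ht₀⟩ : Icc a b) x₀ (L * (b - a).toNNReal) 0 L K :=
    { lipschitzOnWith := fun t ht => (hK t ht).lipschitzOnWith
      continuousOn := fun x _ => hc x
      norm_le := fun t ht x _ => hL t ht x
      mul_max_le := by
        have h1 : max (b - t₀) (t₀ - a) ≤ b - a :=
          max_le (by linarith [ht₀.1]) (by linarith [ht₀.2])
        have h2 : ((b - a).toNNReal : ℝ) = b - a := Real.coe_toNNReal _ (by linarith)
        simp only [NNReal.coe_mul, h2, NNReal.coe_zero, sub_zero]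
        exact mul_le_mul_of_nonneg_left h1 L.2 }
  exact hpl.exists_eq_forall_mem_Icc_hasDerivWithinAt₀

variable {ι : Type*} [Fintype ι]

/-- Truncation of all coordinates to `[-R, R]`. -/
def clamp (R : ℝ) (x : ι → ℝ) : ι → ℝ := fun i => max (-R) (min R (x i))

theorem norm_clamp_le {R : ℝ} (hR : 0 ≤ R) (x : ι → ℝ) : ‖clamp R x‖ ≤ R := by
  rw [pi_norm_le_iff_of_nonneg hR]
  intro i
  rw [Real.norm_eq_abs, abs_le]
  exact ⟨le_max_left _ _, max_le (by linarith) (min_le_left _ _)⟩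

theorem clamp_eq_self {R : ℝ} {x : ι → ℝ} (hx : ‖x‖ ≤ R) : clamp R x = x := by
  funext i
  have h := abs_le.1 ((norm_le_pi_norm x i).trans hx)
  simp [clamp, h.1, h.2]

theorem norm_clamp_le_norm {R : ℝ} (hR : 0 ≤ R) (x : ι → ℝ) : ‖clamp R x‖ ≤ ‖x‖ := by
  rw [pi_norm_le_iff_of_nonneg (norm_nonneg _)]
  intro i
  refine le_trans ?_ (norm_le_pi_norm x i)
  simp only [Real.norm_eq_abs, clamp]
  rcases abs_cases (x i) with h | h <;> rw [abs_le] <;> constructor <;> grind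

theorem lipschitzWith_clamp (R : ℝ) : LipschitzWith 1 (clamp R : (ι → ℝ) → ι → ℝ) := by
  refine LipschitzWith.of_dist_le_mul fun x y => ?_
  rw [NNReal.coe_one, one_mul, dist_pi_le_iff dist_nonneg]
  intro i
  refine le_trans ?_ (dist_le_pi_dist x y i)
  simp only [Real.dist_eq, clamp]
  have h1 := abs_max_sub_max_le_max (-R) (min R (x i)) (-R) (min R (y i))
  have h2 := abs_min_sub_min_le_max R (x i) R (y i)
  rw [sub_self, abs_zero, max_eq_right (abs_nonneg (min R (x i) - min R (y i)))] at h1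
  rw [sub_self, abs_zero, max_eq_right (abs_nonneg (x i - y i))] at h2
  exact h1.trans h2

/-- A continuous function which is bounded by `R` at the right end, and which satisfies the bound
`R` wherever it satisfies the weaker bound `R + 1` to the right, is bounded by `R`. -/
theorem le_of_bootstrap {φ : ℝ → ℝ} {a b R : ℝ} (hφ : ContinuousOn φ (Icc a b))
    (hb : φ b ≤ R) (h : ∀ t ∈ Icc a b, (∀ s ∈ Icc t b, φ s ≤ R + 1) → φ t ≤ R) :
    ∀ t ∈ Icc a b, φ t ≤ R := by
  intro t₁ ht₁
  by_contra hcon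
  push Not at hcon
  have hab : a ≤ b := ht₁.1.trans ht₁.2
  -- The last time τ at which φ ≥ R + 1 gives the contradiction: to its right the weak bound holds,
  -- hence the strong one, and continuity carries φ ≤ R back to τ.
  let S : Set ℝ := {t | t ∈ Icc t₁ b ∧ R + 1 ≤ φ t}
  have hφ1 : ContinuousOn φ (Icc t₁ b) := hφ.mono (Icc_subset_Icc_left ht₁.1)
  have hSc : IsClosed S := by
    have := hφ1.preimage_isClosed_of_isClosed isClosed_Icc (isClosed_Ici (a := R + 1))
    exact this
  have hSne : S.Nonempty := by
    by_contra hne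
    rw [not_nonempty_iff_eq_empty] at hne
    have : φ t₁ ≤ R := h t₁ ht₁ fun s hs => by
      by_contra h2
      have : s ∈ S := ⟨hs, by linarith⟩
      simp [hne] at this
    linarith
  have hbd : BddAbove S := ⟨b, fun t ht => ht.1.2⟩
  have hmem := hSc.csSup_mem hSne hbd
  set τ := sSup S
  have hτ : τ ∈ Icc t₁ b := hmem.1
  have hlt : ∀ s ∈ Ioc τ b, φ s < R + 1 := by
    intro s hs
    by_contra h2
    have : s ∈ S := ⟨⟨hτ.1.trans hs.1.le, hs.2⟩, by linarith⟩
    exact absurd (le_csSup hbd this) (not_le.2 hs.1)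
  have hle : ∀ s ∈ Ioc τ b, φ s ≤ R := fun s hs =>
    h s ⟨ht₁.1.trans (hτ.1.trans hs.1.le), hs.2⟩ fun r hr =>
      (hlt r ⟨hs.1.trans_le hr.1, hr.2⟩).le
  have hτb : τ < b := by
    rcases hτ.2.lt_or_eq with h1 | h1
    · exact h1
    · have := hmem.2
      rw [h1] at this
      linarith
  have hcw : ContinuousWithinAt φ (Ioc τ b) τ :=
    (hφ1 τ hτ).mono fun s hs => ⟨hτ.1.trans hs.1.le, hs.2⟩
  have hcl : τ ∈ closure (Ioc τ b) := by
    rw [closure_Ioc hτb.ne]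
    exact left_mem_Icc.2 hτb.le
  have := hcw.closure_le hcl continuousWithinAt_const hle
  linarith [hmem.2]

/-- Truncating the argument of the vector field makes it bounded and globally Lipschitz, so the
truncated equation is solvable on the whole interval. As long as its solution stays in the ball of
radius R + 1 it solves the original equation and the a priori bound applies; the bootstrap then
keeps it in the ball of radius R. -/
theorem exists_terminal_solution_of_apriori_bound {f : ℝ → (ι → ℝ) → ι → ℝ} {a b : ℝ}
    (hab : a ≤ b) (hc : ∀ x, ContinuousOn (f · x) (Icc a b))
    (hL : ∀ R : ℝ, ∃ K : ℝ≥0, ∀ t ∈ Icc a b, LipschitzOnWith K (f t) (closedBall 0 R))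
    (xb : ι → ℝ) {R : ℝ} (hR : 0 ≤ R)
    (hap : ∀ t ∈ Icc a b, ∀ x : ℝ → ι → ℝ, x b = xb →
      (∀ s ∈ Icc t b, HasDerivWithinAt x (f s (x s)) (Icc t b) s) → ‖x t‖ ≤ R) :
    ∃ x : ℝ → ι → ℝ, x b = xb ∧ ∀ s ∈ Icc a b, HasDerivWithinAt x (f s (x s)) (Icc a b) s := by
  -- Truncation at R + 1 rather than R leaves the margin which the bootstrap needs.
  obtain ⟨K, hK⟩ := hL (R + 1)
  have hmemc : ∀ x : ι → ℝ, clamp (R + 1) x ∈ closedBall (0 : ι → ℝ) (R + 1) := fun x => by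
    simpa using norm_clamp_le (by linarith) x
  obtain ⟨c, hcb⟩ := (isCompact_Icc.image_of_continuousOn (hc 0).norm).bddAbove
  have hc0 : ∀ t ∈ Icc a b, ‖f t 0‖ ≤ c := fun t ht => hcb ⟨t, ht, rfl⟩
  have hc00 : 0 ≤ c := (norm_nonneg _).trans (hc0 a (left_mem_Icc.2 hab))
  have hbound : ∀ t ∈ Icc a b, ∀ x, ‖f t (clamp (R + 1) x)‖ ≤
      ((c + K * (R + 1)).toNNReal : ℝ≥0) := by
    intro t ht x
    rw [Real.coe_toNNReal _ (by positivity)]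
    have h1 := (hK t ht).norm_sub_le (hmemc x) (mem_closedBall_self (by linarith))
    rw [sub_zero] at h1
    have h2 : ‖f t (clamp (R + 1) x)‖ ≤ ‖f t 0‖ + ‖f t (clamp (R + 1) x) - f t 0‖ :=
      norm_le_insert' _ _
    have h3 : (K : ℝ) * ‖clamp (R + 1) x‖ ≤ K * (R + 1) :=
      mul_le_mul_of_nonneg_left (norm_clamp_le (by linarith) x) K.2
    linarith [hc0 t ht]
  obtain ⟨x, hx1, hx2⟩ := exists_solution_of_lipschitz_of_bounded
    (f := fun t x => f t (clamp (R + 1) x)) (right_mem_Icc.2 hab) (K := K)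
    (fun t ht => by
      have := (hK t ht).comp ((lipschitzWith_clamp (ι := ι) (R + 1)).lipschitzOnWith (s := univ))
        (fun x _ => hmemc x)
      rw [mul_one, lipschitzOnWith_univ] at this
      exact this)
    (fun x => hc _) hbound xb
  have hsol : ∀ t ∈ Icc a b, (∀ s ∈ Icc t b, ‖x s‖ ≤ R + 1) → ‖x t‖ ≤ R := by
    intro t ht h
    refine hap t ht x hx1 fun s hs => ?_
    have := (hx2 s ⟨ht.1.trans hs.1, hs.2⟩).mono (Icc_subset_Icc_left ht.1)
    rwa [clamp_eq_self (h s hs)] at this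
  have hcont : ContinuousOn (fun t => ‖x t‖) (Icc a b) :=
    fun t ht => (hx2 t ht).continuousWithinAt.norm
  have hball := le_of_bootstrap hcont
    -- At t = b the interval is a single point and the differential equation is void, so the a
    -- priori bound reads ‖xb‖ ≤ R.
    (hap b (right_mem_Icc.2 hab) x hx1 fun s hs => by
      rw [Icc_self, mem_singleton_iff] at hs
      subst hs
      rw [Icc_self]
      simp [hasDerivWithinAt_iff_tendsto_slope]) hsol
  refine ⟨x, hx1, fun s hs => ?_⟩
  have := hx2 s hs
  rwa [clamp_eq_self ((hball s hs).trans (by linarith))] at this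

end OrdinaryDifferentialEquations

/-! ### Entrywise bounds for matrices. -/

section EntryBounds

variable {ι κ ν : Type*}

theorem EntriesLe.nonneg {X : Matrix ι κ ℝ} {p : ℝ} (h : EntriesLe X p) (i : ι) (j : κ) : 0 ≤ p :=
  (abs_nonneg _).trans (h i j)

theorem EntriesLe.add {X Y : Matrix ι κ ℝ} {p q : ℝ} (hX : EntriesLe X p) (hY : EntriesLe Y q) :
    EntriesLe (X + Y) (p + q) := fun i j => (abs_add_le _ _).trans (add_le_add (hX i j) (hY i j))

theorem EntriesLe.neg {X : Matrix ι κ ℝ} {p : ℝ} (hX : EntriesLe X p) : EntriesLe (-X) p :=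
  fun i j => by simpa using hX i j

theorem EntriesLe.sub {X Y : Matrix ι κ ℝ} {p q : ℝ} (hX : EntriesLe X p) (hY : EntriesLe Y q) :
    EntriesLe (X - Y) (p + q) := by
  rw [sub_eq_add_neg]
  exact hX.add hY.neg

theorem EntriesLe.transpose {X : Matrix ι κ ℝ} {p : ℝ} (hX : EntriesLe X p) : EntriesLe Xᵀ p :=
  fun i j => hX j i

theorem EntriesLe.mul [Fintype κ] {X : Matrix ι κ ℝ} {Y : Matrix κ ν ℝ} {p q : ℝ}
    (hX : EntriesLe X p) (hY : EntriesLe Y q) : EntriesLe (X * Y) (Fintype.card κ * (p * q)) := by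
  intro i j
  rw [Matrix.mul_apply]
  refine (Finset.abs_sum_le_sum_abs _ _).trans ?_
  refine (Finset.sum_le_card_nsmul _ _ (p * q) fun k _ => ?_).trans (by simp)
  rw [abs_mul]
  exact mul_le_mul (hX i k) (hY k j) (abs_nonneg _) (hX.nonneg i k)

theorem EntriesLe.norm_mulVec_le [Fintype κ] [Fintype ι] {X : Matrix ι κ ℝ} {p : ℝ} (hp : 0 ≤ p)
    (hX : EntriesLe X p) (x : κ → ℝ) : ‖X *ᵥ x‖ ≤ Fintype.card κ * p * ‖x‖ := by
  rw [pi_norm_le_iff_of_nonneg (by positivity)]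
  intro i
  rw [Matrix.mulVec, dotProduct, Real.norm_eq_abs]
  refine (Finset.abs_sum_le_sum_abs _ _).trans ?_
  refine (Finset.sum_le_card_nsmul _ _ (p * ‖x‖) fun k _ => ?_).trans (by simp [mul_assoc])
  rw [abs_mul]
  exact mul_le_mul (hX i k) (norm_le_pi_norm x k) (abs_nonneg _) hp

end EntryBounds

end CheapGame

/-! ### Continuity of matrix functions. -/

section MatrixFunctions

open CheapGame

variable {ι κ ν : Type*} {s : Set ℝ}

theorem MatContOn.exists_entriesLe [Finite ι] [Finite κ] {M : ℝ → Matrix ι κ ℝ} {a b : ℝ}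
    (hM : MatContOn M (Icc a b)) : ∃ c, 0 ≤ c ∧ ∀ t ∈ Icc a b, EntriesLe (M t) c := by
  cases nonempty_fintype ι
  cases nonempty_fintype κ
  have h : ∀ i j, ∃ c, ∀ t ∈ Icc a b, |M t i j| ≤ c := fun i j => by
    obtain ⟨c, hc⟩ := (isCompact_Icc.image_of_continuousOn (hM i j).abs).bddAbove
    exact ⟨c, fun t ht => hc ⟨t, ht, rfl⟩⟩
  choose c hc using h
  refine ⟨∑ i, ∑ j, |c i j|, Finset.sum_nonneg fun i _ => Finset.sum_nonneg fun j _ => abs_nonneg _,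
    fun t ht i j => ?_⟩
  calc |M t i j| ≤ |c i j| := (hc i j t ht).trans (le_abs_self _)
    _ ≤ ∑ j, |c i j| := Finset.single_le_sum (f := fun j => |c i j|) (fun j _ => abs_nonneg _)
        (Finset.mem_univ j)
    _ ≤ _ := Finset.single_le_sum (f := fun i => ∑ j, |c i j|)
        (fun i _ => Finset.sum_nonneg fun j _ => abs_nonneg _) (Finset.mem_univ i)

theorem MatContOn.mono {M : ℝ → Matrix ι κ ℝ} {s' : Set ℝ} (hM : MatContOn M s) (h : s' ⊆ s) :
    MatContOn M s' := fun i j => (hM i j).mono h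

theorem MatContOn.const (M : Matrix ι κ ℝ) : MatContOn (fun _ => M) s :=
  fun _ _ => continuousOn_const

theorem MatContOn.transpose {M : ℝ → Matrix ι κ ℝ} (hM : MatContOn M s) :
    MatContOn (fun t => (M t)ᵀ) s := fun i j => hM j i

theorem MatContOn.add {M N : ℝ → Matrix ι κ ℝ} (hM : MatContOn M s) (hN : MatContOn N s) :
    MatContOn (fun t => M t + N t) s := fun i j => (hM i j).add (hN i j)

theorem MatContOn.sub {M N : ℝ → Matrix ι κ ℝ} (hM : MatContOn M s) (hN : MatContOn N s) :
    MatContOn (fun t => M t - N t) s := fun i j => (hM i j).sub (hN i j)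

theorem MatContOn.neg {M : ℝ → Matrix ι κ ℝ} (hM : MatContOn M s) :
    MatContOn (fun t => -M t) s := fun i j => (hM i j).neg

theorem MatContOn.smul {M : ℝ → Matrix ι κ ℝ} {c : ℝ → ℝ} (hc : ContinuousOn c s)
    (hM : MatContOn M s) : MatContOn (fun t => c t • M t) s := fun i j => hc.mul (hM i j)

theorem MatContOn.mul [Fintype κ] {M : ℝ → Matrix ι κ ℝ} {N : ℝ → Matrix κ ν ℝ}
    (hM : MatContOn M s) (hN : MatContOn N s) : MatContOn (fun t => M t * N t) s := fun i j => by
  simp only [Matrix.mul_apply]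
  exact continuousOn_finsetSum _ fun k _ => (hM i k).mul (hN k j)

theorem matContOn_iff {M : ℝ → Matrix ι κ ℝ} : MatContOn M s ↔ ContinuousOn M s :=
  ⟨fun h => continuousOn_pi.2 fun i => continuousOn_pi.2 (h i),
    fun h i j => continuousOn_pi.1 (continuousOn_pi.1 h i) j⟩

theorem MatContOn.mulVec [Fintype κ] {M : ℝ → Matrix ι κ ℝ} {x : ℝ → κ → ℝ} (hM : MatContOn M s)
    (hx : ContinuousOn x s) : ContinuousOn (fun t => M t *ᵥ x t) s := by
  rw [continuousOn_pi] at hx ⊢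
  intro i
  simp only [Matrix.mulVec, dotProduct]
  exact continuousOn_finsetSum _ fun k _ => (hM i k).mul (hx k)

end MatrixFunctions

namespace CheapGame

/-! ### Linear differential equations. -/

section LinearEquations

variable {ι : Type*} [Fintype ι]

theorem exists_linear_solution {M : ℝ → Matrix ι ι ℝ} {a b : ℝ} (hab : a ≤ b)
    (hM : MatContOn M (Icc a b)) (x₀ : ι → ℝ) :
    ∃ x : ℝ → ι → ℝ, x a = x₀ ∧ ∀ t ∈ Icc a b, HasDerivWithinAt x (M t *ᵥ x t) (Icc a b) t := by
  obtain ⟨c, hc0, hc⟩ := hM.exists_entriesLe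
  set k : ℝ := Fintype.card ι * c with hk
  have hk0 : 0 ≤ k := by positivity
  have hkb : ∀ t ∈ Icc a b, ∀ x, ‖M t *ᵥ x‖ ≤ k * ‖x‖ := fun t ht x =>
    (hc t ht).norm_mulVec_le hc0 x
  -- This is Grönwall's bound. Since truncation does not increase the norm, it holds for the
  -- truncated equation too, so truncation at R is never active.
  set R : ℝ := ‖x₀‖ * Real.exp (k * (b - a)) with hR
  have hR0 : 0 ≤ R := by positivity
  obtain ⟨x, hx1, hx2⟩ := exists_solution_of_lipschitz_of_bounded
    (f := fun t x => M t *ᵥ clamp R x) (left_mem_Icc.2 hab) (K := k.toNNReal)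
    (L := (k * R).toNNReal)
    (fun t ht => LipschitzWith.of_dist_le_mul fun x y => by
      rw [dist_eq_norm, ← Matrix.mulVec_sub, Real.coe_toNNReal _ hk0]
      refine (hkb t ht _).trans (mul_le_mul_of_nonneg_left ?_ hk0)
      rw [← dist_eq_norm]
      simpa using (lipschitzWith_clamp R).dist_le_mul x y)
    (fun x => hM.mulVec continuousOn_const)
    (fun t ht x => by
      rw [Real.coe_toNNReal _ (by positivity)]
      exact (hkb t ht _).trans (mul_le_mul_of_nonneg_left (norm_clamp_le hR0 x) hk0)) x₀
  have hcont : ContinuousOn x (Icc a b) := fun t ht => (hx2 t ht).continuousWithinAt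
  have hbd := norm_le_gronwallBound_of_norm_deriv_right_le hcont
    (f' := fun t => M t *ᵥ clamp R (x t)) (δ := ‖x₀‖) (K := k) (ε := 0)
    (fun t ht => by
      have h1 := hx2 t (Ico_subset_Icc_self ht)
      exact (h1.mono (Icc_subset_Icc_left ht.1)).mono_of_mem_nhdsWithin (Icc_mem_nhdsGE ht.2))
    (by rw [hx1])
    (fun t ht => by
      rw [add_zero]
      exact (hkb t (Ico_subset_Icc_self ht) _).trans
        (mul_le_mul_of_nonneg_left (norm_clamp_le_norm hR0 _) hk0))
  refine ⟨x, hx1, fun t ht => ?_⟩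
  have h := hx2 t ht
  have hxR : ‖x t‖ ≤ R := by
    refine (hbd t ht).trans ?_
    rw [gronwallBound_ε0, hR]
    gcongr
    exact ht.2
  simp only [clamp_eq_self hxR] at h
  exact h

end LinearEquations

end CheapGame

/-! ### Derivatives of matrix functions. -/

section MatrixDerivatives

variable {ι κ ν : Type*} {s : Set ℝ} {t : ℝ}

theorem MatHasDerivWithinAt.mono {M : ℝ → Matrix ι κ ℝ} {M' : Matrix ι κ ℝ} {s' : Set ℝ}
    (h : MatHasDerivWithinAt M M' s t) (hs : s' ⊆ s) : MatHasDerivWithinAt M M' s' t :=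
  fun i j => (h i j).mono hs

theorem MatHasDerivWithinAt.transpose {M : ℝ → Matrix ι κ ℝ} {M' : Matrix ι κ ℝ}
    (h : MatHasDerivWithinAt M M' s t) : MatHasDerivWithinAt (fun r => (M r)ᵀ) M'ᵀ s t :=
  fun i j => h j i

theorem MatHasDerivWithinAt.add {M N : ℝ → Matrix ι κ ℝ} {M' N' : Matrix ι κ ℝ}
    (hM : MatHasDerivWithinAt M M' s t) (hN : MatHasDerivWithinAt N N' s t) :
    MatHasDerivWithinAt (fun r => M r + N r) (M' + N') s t :=
  fun i j => (hM i j).add (hN i j)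

theorem MatHasDerivWithinAt.sub {M N : ℝ → Matrix ι κ ℝ} {M' N' : Matrix ι κ ℝ}
    (hM : MatHasDerivWithinAt M M' s t) (hN : MatHasDerivWithinAt N N' s t) :
    MatHasDerivWithinAt (fun r => M r - N r) (M' - N') s t :=
  fun i j => (hM i j).sub (hN i j)

theorem MatHasDerivWithinAt.hasDerivWithinAt_mulVec [Finite ι] [Fintype κ] {M : ℝ → Matrix ι κ ℝ}
    {M' : Matrix ι κ ℝ} {x : ℝ → κ → ℝ} {x' : κ → ℝ} (hM : MatHasDerivWithinAt M M' s t)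
    (hx : HasDerivWithinAt x x' s t) :
    HasDerivWithinAt (fun r => M r *ᵥ x r) (M' *ᵥ x t + M t *ᵥ x') s t := by
  cases nonempty_fintype ι
  rw [hasDerivWithinAt_pi] at hx ⊢
  intro i
  simp only [Matrix.mulVec, dotProduct, Pi.add_apply, ← Finset.sum_add_distrib]
  exact HasDerivWithinAt.fun_sum fun k _ => (hM i k).mul (hx k)

theorem HasDerivWithinAt.dotProduct [Fintype κ] {x y : ℝ → κ → ℝ} {x' y' : κ → ℝ}
    (hx : HasDerivWithinAt x x' s t) (hy : HasDerivWithinAt y y' s t) :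
    HasDerivWithinAt (fun r => x r ⬝ᵥ y r) (x' ⬝ᵥ y t + x t ⬝ᵥ y') s t := by
  rw [hasDerivWithinAt_pi] at hx hy
  simp only [_root_.dotProduct, ← Finset.sum_add_distrib]
  exact HasDerivWithinAt.fun_sum fun k _ => (hx k).mul (hy k)

theorem matContOn_of_hasDerivWithinAt {M M' : ℝ → Matrix ι κ ℝ}
    (h : ∀ t ∈ s, MatHasDerivWithinAt M (M' t) s t) : MatContOn M s :=
  fun i j t ht => (h t ht i j).continuousWithinAt

end MatrixDerivatives

/-! ### Lyapunov inequalities and Sylvester equations. -/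

namespace CheapGame

/-- Nonnegativity of the quadratic form of a square matrix, symmetric or not. -/
def QuadNonneg {ι : Type*} [Fintype ι] (M : Matrix ι ι ℝ) : Prop := ∀ w, 0 ≤ w ⬝ᵥ (M *ᵥ w)

section Lyapunov

variable {ι : Type*} [Fintype ι]

theorem quadNonneg_of_posSemidef {M : Matrix ι ι ℝ} (hM : M.PosSemidef) : QuadNonneg M :=
  fun w => by simpa using hM.dotProduct_mulVec_nonneg w

theorem quadForm_pi_single [DecidableEq ι] (M : Matrix ι ι ℝ) (i j : ι) (a b : ℝ) :
    (Pi.single i a + Pi.single j b) ⬝ᵥ (M *ᵥ (Pi.single i a + Pi.single j b)) =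
      a * a * M i i + a * b * M i j + b * a * M j i + b * b * M j j := by
  simp only [Matrix.mulVec_add, add_dotProduct, dotProduct_add, single_dotProduct,
    Matrix.mulVec_single, Pi.smul_apply, MulOpposite.smul_eq_mul_unop, MulOpposite.unop_op,
    Matrix.col_apply]
  ring

theorem QuadNonneg.diag_nonneg {M : Matrix ι ι ℝ} (hM : QuadNonneg M) (i : ι) : 0 ≤ M i i := by
  classical
  have := hM (Pi.single i 1 + Pi.single i 0)
  rw [quadForm_pi_single] at this
  simpa using this

/-- On the plane of two coordinate vectors the form gives a nonnegative quadratic polynomial, whose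
discriminant is nonpositive. -/
theorem QuadNonneg.sq_le {M : Matrix ι ι ℝ} (hM : QuadNonneg M) (hs : M.IsSymm) (i j : ι) :
    M i j ^ 2 ≤ M i i * M j j := by
  classical
  have h : ∀ x : ℝ, 0 ≤ M i i * (x * x) + (2 * M i j) * x + M j j := fun x => by
    have h := hM (Pi.single i x + Pi.single j 1)
    rw [quadForm_pi_single, hs.apply i j] at h
    linarith
  have := discrim_le_zero h
  rw [discrim] at this
  nlinarith

/-- Bounds on the diagonal of a nonnegative symmetric matrix control every entry. The weights p and
q later carry the powers of ε from the diagonal to the off-diagonal blocks. -/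
theorem QuadNonneg.abs_le {M : Matrix ι ι ℝ} (hM : QuadNonneg M) (hs : M.IsSymm) {i j : ι}
    {c p q : ℝ} (hc : 0 ≤ c) (hp : 0 ≤ p) (hq : 0 ≤ q) (hi : M i i ≤ c * p ^ 2)
    (hj : M j j ≤ c * q ^ 2) : |M i j| ≤ c * p * q := by
  refine abs_le_of_sq_le_sq ?_ (by positivity)
  calc M i j ^ 2 ≤ M i i * M j j := hM.sq_le hs i j
    _ ≤ (c * p ^ 2) * (c * q ^ 2) :=
        mul_le_mul hi hj (hM.diag_nonneg j) (by positivity)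
    _ = (c * p * q) ^ 2 := by ring

theorem hasDerivWithinAt_bilinear {E : ℝ → Matrix ι ι ℝ} {E' M N : Matrix ι ι ℝ}
    {x y : ℝ → ι → ℝ} {s : Set ℝ} {t : ℝ} (hE : MatHasDerivWithinAt E E' s t)
    (hx : HasDerivWithinAt x (N *ᵥ x t) s t) (hy : HasDerivWithinAt y (M *ᵥ y t) s t) :
    HasDerivWithinAt (fun r => x r ⬝ᵥ (E r *ᵥ y r)) (x t ⬝ᵥ ((E' + Nᵀ * E t + E t * M) *ᵥ y t))
      s t := by
  refine (hx.dotProduct (hE.hasDerivWithinAt_mulVec hy)).congr_deriv ?_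
  simp only [Matrix.add_mulVec, dotProduct_add, ← Matrix.mulVec_mulVec]
  rw [Matrix.dotProduct_mulVec (x t) Nᵀ, Matrix.vecMul_transpose]
  ring

/-- A matrix function with `-E' - Mᵀ E - E M ≥ 0` and `E(b) ≥ 0` is nonnegative. -/
theorem quadNonneg_of_lyapunov {E E' M : ℝ → Matrix ι ι ℝ} {a b : ℝ}
    (hM : MatContOn M (Icc a b)) (hE : ∀ t ∈ Icc a b, MatHasDerivWithinAt E (E' t) (Icc a b) t)
    (h : ∀ t ∈ Icc a b, QuadNonneg (-E' t - (M t)ᵀ * E t - E t * M t)) (hb : QuadNonneg (E b)) :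
    ∀ t ∈ Icc a b, QuadNonneg (E t) := by
  intro t ht w
  have hsub : Icc t b ⊆ Icc a b := Icc_subset_Icc_left ht.1
  -- Along the flow x' = M x started from w at time t, the form xᵀEx does not increase, and it ends
  -- at a nonnegative value.
  obtain ⟨x, hx0, hx⟩ := exists_linear_solution ht.2 (hM.mono hsub) w
  have hd : ∀ r ∈ Icc t b, HasDerivWithinAt (fun r => x r ⬝ᵥ (E r *ᵥ x r))
      (x r ⬝ᵥ ((E' r + (M r)ᵀ * E r + E r * M r) *ᵥ x r)) (Icc t b) r := fun r hr =>
    hasDerivWithinAt_bilinear ((hE r (hsub hr)).mono hsub) (hx r hr) (hx r hr)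
  have hanti : AntitoneOn (fun r => x r ⬝ᵥ (E r *ᵥ x r)) (Icc t b) := by
    refine antitoneOn_of_hasDerivWithinAt_nonpos (convex_Icc t b)
      (fun r hr => (hd r hr).continuousWithinAt)
      (fun r hr => (hd r (interior_subset hr)).mono interior_subset) fun r hr => ?_
    have h1 := h r (hsub (interior_subset hr)) (x r)
    have h2 : E' r + (M r)ᵀ * E r + E r * M r = -(-E' r - (M r)ᵀ * E r - E r * M r) := by abel
    rw [h2, Matrix.neg_mulVec, dotProduct_neg]
    linarith
  have := hanti (left_mem_Icc.2 ht.2) (right_mem_Icc.2 ht.2) ht.2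
  simp only [hx0] at this
  exact (hb _).trans this

theorem eq_zero_of_bilinear_forms {M : Matrix ι ι ℝ} (h : ∀ v w, v ⬝ᵥ (M *ᵥ w) = 0) : M = 0 := by
  classical
  ext i j
  simpa using h (Pi.single i 1) (Pi.single j 1)

/-- A solution of `E' = -Nᵀ E - E M` vanishing at the right end vanishes. -/
theorem eq_zero_of_sylvester {E E' M N : ℝ → Matrix ι ι ℝ} {a b : ℝ}
    (hM : MatContOn M (Icc a b)) (hN : MatContOn N (Icc a b))
    (hE : ∀ t ∈ Icc a b, MatHasDerivWithinAt E (E' t) (Icc a b) t)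
    (h : ∀ t ∈ Icc a b, E' t + (N t)ᵀ * E t + E t * M t = 0) (hb : E b = 0) :
    ∀ t ∈ Icc a b, E t = 0 := by
  intro t ht
  refine eq_zero_of_bilinear_forms fun v w => ?_
  have hsub : Icc t b ⊆ Icc a b := Icc_subset_Icc_left ht.1
  -- Two independent flows make xᵀEy constant, which determines `E` without assuming it symmetric.
  obtain ⟨x, hx0, hx⟩ := exists_linear_solution ht.2 (hN.mono hsub) v
  obtain ⟨y, hy0, hy⟩ := exists_linear_solution ht.2 (hM.mono hsub) w
  have hd : ∀ r ∈ Icc t b, HasDerivWithinAt (fun r => x r ⬝ᵥ (E r *ᵥ y r)) 0 (Icc t b) r :=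
    fun r hr => by
      have := hasDerivWithinAt_bilinear ((hE r (hsub hr)).mono hsub) (hx r hr) (hy r hr)
      rwa [h r (hsub hr), Matrix.zero_mulVec, dotProduct_zero] at this
  have hanti : AntitoneOn (fun r => x r ⬝ᵥ (E r *ᵥ y r)) (Icc t b) :=
    antitoneOn_of_hasDerivWithinAt_nonpos (convex_Icc t b)
      (fun r hr => (hd r hr).continuousWithinAt)
      (fun r hr => (hd r (interior_subset hr)).mono interior_subset) fun r hr => le_rfl
  have hmono : MonotoneOn (fun r => x r ⬝ᵥ (E r *ᵥ y r)) (Icc t b) :=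
    monotoneOn_of_hasDerivWithinAt_nonneg (convex_Icc t b)
      (fun r hr => (hd r hr).continuousWithinAt)
      (fun r hr => (hd r (interior_subset hr)).mono interior_subset) fun r hr => le_rfl
  have h1 := hanti (left_mem_Icc.2 ht.2) (right_mem_Icc.2 ht.2) ht.2
  have h2 := hmono (left_mem_Icc.2 ht.2) (right_mem_Icc.2 ht.2) ht.2
  simp only [hx0, hy0, hb, Matrix.zero_mulVec, dotProduct_zero] at h1 h2
  exact le_antisymm h2 h1

end Lyapunov

/-! ### Riccati equations: uniqueness, comparison, existence. -/

section Riccati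

variable {ι : Type*} [Fintype ι]

/-- Right-hand side of the matrix Riccati equation `X' = -X A - Aᵀ X + X S X - D`. -/
def riccati (A S D X : Matrix ι ι ℝ) : Matrix ι ι ℝ := -(X * A) - Aᵀ * X + X * S * X - D

/-- The quadratic difference is split asymmetrically as (X - Y)SX + YS(X - Y), so the difference is
linear in X - Y. This serves both uniqueness and the local Lipschitz bound. -/
theorem riccati_sub_riccati (A S D X Y : Matrix ι ι ℝ) :
    riccati A S D X - riccati A S D Y =
      -((X - Y) * A) - Aᵀ * (X - Y) + (X - Y) * S * X + Y * S * (X - Y) := by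
  simp only [riccati]
  noncomm_ring

theorem riccati_transpose {A S D X : Matrix ι ι ℝ} (hS : S.IsSymm) (hD : D.IsSymm) :
    (riccati A S D X)ᵀ = riccati A S D Xᵀ := by
  simp only [riccati, Matrix.transpose_sub, Matrix.transpose_add, Matrix.transpose_neg,
    Matrix.transpose_mul, Matrix.transpose_transpose, hS.eq, hD.eq, Matrix.mul_assoc]
  abel

theorem _root_.MatContOn.riccati {A S D X : ℝ → Matrix ι ι ℝ} {s : Set ℝ} (hA : MatContOn A s)
    (hS : MatContOn S s) (hD : MatContOn D s) (hX : MatContOn X s) :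
    MatContOn (fun t => riccati (A t) (S t) (D t) (X t)) s :=
  (((hX.mul hA).neg.sub (hA.transpose.mul hX)).add ((hX.mul hS).mul hX)).sub hD

variable {A S D : ℝ → Matrix ι ι ℝ} {a b : ℝ}

theorem riccati_solution_unique (hA : MatContOn A (Icc a b)) (hS : MatContOn S (Icc a b))
    {X Y : ℝ → Matrix ι ι ℝ}
    (hX : ∀ t ∈ Icc a b, MatHasDerivWithinAt X (riccati (A t) (S t) (D t) (X t)) (Icc a b) t)
    (hY : ∀ t ∈ Icc a b, MatHasDerivWithinAt Y (riccati (A t) (S t) (D t) (Y t)) (Icc a b) t)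
    (hb : X b = Y b) : EqOn X Y (Icc a b) := by
  have hXc := matContOn_of_hasDerivWithinAt hX
  have hYc := matContOn_of_hasDerivWithinAt hY
  intro t ht
  -- With these choices the asymmetric splitting says exactly that E = X - Y satisfies E' + NᵀE + EM
  -- = 0.
  refine sub_eq_zero.1 (eq_zero_of_sylvester (E := fun t => X t - Y t)
    (M := fun t => A t - S t * X t) (N := fun t => A t - (S t)ᵀ * (Y t)ᵀ)
    (hA.sub (hS.mul hXc)) (hA.sub (hS.transpose.mul hYc.transpose))
    (fun t ht => (hX t ht).sub (hY t ht)) (fun t _ => ?_) (by simp [hb]) t ht)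
  rw [riccati_sub_riccati]
  simp only [Matrix.transpose_sub, Matrix.transpose_mul, Matrix.transpose_transpose]
  noncomm_ring

/-- The transpose solves the same terminal value problem, so uniqueness applies. -/
theorem riccati_solution_isSymm (hA : MatContOn A (Icc a b)) (hS : MatContOn S (Icc a b))
    (hSs : ∀ t ∈ Icc a b, (S t).IsSymm) (hDs : ∀ t ∈ Icc a b, (D t).IsSymm)
    {X : ℝ → Matrix ι ι ℝ}
    (hX : ∀ t ∈ Icc a b, MatHasDerivWithinAt X (riccati (A t) (S t) (D t) (X t)) (Icc a b) t)
    (hb : (X b).IsSymm) : ∀ t ∈ Icc a b, (X t).IsSymm :=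
  riccati_solution_unique (D := D) hA hS (X := fun t => (X t)ᵀ)
    (fun t ht => by
      rw [← riccati_transpose (hSs t ht) (hDs t ht)]
      exact (hX t ht).transpose) hX hb

/-- The symmetric splitting M = A - ½SX absorbs the whole quadratic term into the Lyapunov operator
and leaves exactly `D`; no sign of `S` is needed. -/
theorem riccati_solution_nonneg (hA : MatContOn A (Icc a b)) (hS : MatContOn S (Icc a b))
    (hSs : ∀ t ∈ Icc a b, (S t).IsSymm) (hD : ∀ t ∈ Icc a b, QuadNonneg (D t))
    {X : ℝ → Matrix ι ι ℝ}
    (hX : ∀ t ∈ Icc a b, MatHasDerivWithinAt X (riccati (A t) (S t) (D t) (X t)) (Icc a b) t)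
    (hXs : ∀ t ∈ Icc a b, (X t).IsSymm) (hb : QuadNonneg (X b)) :
    ∀ t ∈ Icc a b, QuadNonneg (X t) := by
  have hXc := matContOn_of_hasDerivWithinAt hX
  refine quadNonneg_of_lyapunov (M := fun t => A t - (1 / 2 : ℝ) • (S t * X t))
    (hA.sub (MatContOn.smul continuousOn_const (hS.mul hXc))) hX (fun t ht => ?_) hb
  convert hD t ht using 1
  simp only [riccati, Matrix.transpose_sub, Matrix.transpose_smul, Matrix.transpose_mul,
    (hSs t ht).eq, (hXs t ht).eq, sub_mul, mul_sub, smul_mul_assoc, mul_smul_comm,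
    Matrix.mul_assoc]
  module

/-- Comparison with a supersolution. -/
theorem riccati_solution_le (hA : MatContOn A (Icc a b)) (hS : MatContOn S (Icc a b))
    (hSs : ∀ t ∈ Icc a b, (S t).IsSymm) {X Y Y' : ℝ → Matrix ι ι ℝ}
    (hX : ∀ t ∈ Icc a b, MatHasDerivWithinAt X (riccati (A t) (S t) (D t) (X t)) (Icc a b) t)
    (hXs : ∀ t ∈ Icc a b, (X t).IsSymm)
    (hY : ∀ t ∈ Icc a b, MatHasDerivWithinAt Y (Y' t) (Icc a b) t)
    (hYs : ∀ t ∈ Icc a b, (Y t).IsSymm)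
    (hY' : ∀ t ∈ Icc a b, QuadNonneg (riccati (A t) (S t) (D t) (Y t) - Y' t))
    (hb : QuadNonneg (Y b - X b)) :
    ∀ t ∈ Icc a b, QuadNonneg (Y t - X t) := by
  have hXc := matContOn_of_hasDerivWithinAt hX
  have hYc := matContOn_of_hasDerivWithinAt hY
  -- The identity 2(YSY - XSX) = (Y + X)S(Y - X) + (Y - X)S(Y + X) dictates `M`; the Lyapunov
  -- residual of Y - X is then the residual of the supersolution.
  refine quadNonneg_of_lyapunov (E := fun t => Y t - X t)
    (M := fun t => A t - (1 / 2 : ℝ) • (S t * (Y t + X t)))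
    (hA.sub (MatContOn.smul continuousOn_const (hS.mul (hYc.add hXc))))
    (fun t ht => (hY t ht).sub (hX t ht)) (fun t ht => ?_) hb
  convert hY' t ht using 1
  simp only [riccati, Matrix.transpose_sub, Matrix.transpose_smul, Matrix.transpose_mul,
    Matrix.transpose_add, (hSs t ht).eq, (hXs t ht).eq, (hYs t ht).eq, sub_mul, mul_sub, add_mul,
    mul_add, smul_mul_assoc, mul_smul_comm, Matrix.mul_assoc]
  module

/-- Solvability of the terminal value problem below a supersolution. -/
theorem exists_riccati_solution (hab : a ≤ b) (hA : MatContOn A (Icc a b))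
    (hS : MatContOn S (Icc a b)) (hDc : MatContOn D (Icc a b))
    (hSs : ∀ t ∈ Icc a b, (S t).IsSymm) (hDs : ∀ t ∈ Icc a b, (D t).IsSymm)
    (hD : ∀ t ∈ Icc a b, QuadNonneg (D t)) {F : Matrix ι ι ℝ} (hFs : F.IsSymm)
    (hF : QuadNonneg F) {Y Y' : ℝ → Matrix ι ι ℝ}
    (hY : ∀ t ∈ Icc a b, MatHasDerivWithinAt Y (Y' t) (Icc a b) t)
    (hYs : ∀ t ∈ Icc a b, (Y t).IsSymm)
    (hY' : ∀ t ∈ Icc a b, QuadNonneg (riccati (A t) (S t) (D t) (Y t) - Y' t))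
    (hb : QuadNonneg (Y b - F)) :
    ∃ X : ℝ → Matrix ι ι ℝ, X b = F ∧
      (∀ t ∈ Icc a b, MatHasDerivWithinAt X (riccati (A t) (S t) (D t) (X t)) (Icc a b) t) ∧
      (∀ t ∈ Icc a b, (X t).IsSymm ∧ QuadNonneg (X t) ∧ QuadNonneg (Y t - X t)) := by
  -- Comparison is proved on every interval [t, b], since the a priori bound must hold for solutions
  -- known only there.
  have key : ∀ t ∈ Icc a b, ∀ X : ℝ → Matrix ι ι ℝ, X b = F →
      (∀ r ∈ Icc t b, MatHasDerivWithinAt X (riccati (A r) (S r) (D r) (X r)) (Icc t b) r) →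
      ∀ r ∈ Icc t b, (X r).IsSymm ∧ QuadNonneg (X r) ∧ QuadNonneg (Y r - X r) := by
    intro t ht X hXb hX
    have hsub : Icc t b ⊆ Icc a b := Icc_subset_Icc_left ht.1
    have hs := riccati_solution_isSymm (hA.mono hsub) (hS.mono hsub) (fun r hr => hSs r (hsub hr))
      (fun r hr => hDs r (hsub hr)) hX (by rwa [hXb])
    have h0 := riccati_solution_nonneg (hA.mono hsub) (hS.mono hsub) (fun r hr => hSs r (hsub hr))
      (fun r hr => hD r (hsub hr)) hX hs (by rwa [hXb])
    have h1 := riccati_solution_le (hA.mono hsub) (hS.mono hsub) (fun r hr => hSs r (hsub hr))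
      hX hs (fun r hr => (hY r (hsub hr)).mono hsub) (fun r hr => hYs r (hsub hr))
      (fun r hr => hY' r (hsub hr)) (by rwa [hXb])
    exact fun r hr => ⟨hs r hr, h0 r hr, h1 r hr⟩
  obtain ⟨c, hc0, hc⟩ := (matContOn_of_hasDerivWithinAt hY).exists_entriesLe
  obtain ⟨ca, hca0, hca⟩ := hA.exists_entriesLe
  obtain ⟨cs, hcs0, hcs⟩ := hS.exists_entriesLe
  -- Matrices are flattened to vectors, so that the sup norm is the largest absolute value of an
  -- entry.
  let toMat : (ι × ι → ℝ) → Matrix ι ι ℝ := fun x => Matrix.of fun i j => x (i, j)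
  have hmatderiv : ∀ (x : ℝ → ι × ι → ℝ) (s : Set ℝ) (r : ℝ) (M' : Matrix ι ι ℝ),
      HasDerivWithinAt x (fun p => M' p.1 p.2) s r →
        MatHasDerivWithinAt (fun r => toMat (x r)) M' s r := fun x s r M' h i j =>
    (hasDerivWithinAt_pi.1 h) (i, j)
  obtain ⟨x, hxb, hx⟩ := exists_terminal_solution_of_apriori_bound
    (f := fun t x p => riccati (A t) (S t) (D t) (toMat x) p.1 p.2) hab
    (fun x => continuousOn_pi.2 fun p => (hA.riccati hS hDc (MatContOn.const (toMat x))) p.1 p.2)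
    (fun R => by
      let N : ℝ := Fintype.card ι
      refine ⟨(N * ca + N * ca + N * (N * cs * |R|) + N * (N * (|R| * cs))).toNNReal,
        fun t ht => LipschitzOnWith.of_dist_le_mul fun x hx y hy => ?_⟩
      rw [Real.coe_toNNReal _ (by positivity), dist_pi_le_iff (by positivity)]
      intro p
      have hbd : ∀ x ∈ Metric.closedBall (0 : ι × ι → ℝ) R, EntriesLe (toMat x) |R| :=
        fun x hx i j => by
          have h1 : ‖x‖ ≤ R := by simpa using hx
          exact (norm_le_pi_norm x (i, j)).trans (h1.trans (le_abs_self R))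
      have hdiff : EntriesLe (toMat x - toMat y) (dist x y) := fun i j =>
        dist_le_pi_dist x y (i, j)
      have h1 := riccati_sub_riccati (A t) (S t) (D t) (toMat x) (toMat y)
      have h2 := ((((hdiff.mul (hca t ht)).neg).sub ((hca t ht).transpose.mul hdiff)).add
        ((hdiff.mul (hcs t ht)).mul (hbd x hx))).add (((hbd y hy).mul (hcs t ht)).mul hdiff)
      rw [← h1] at h2
      refine (h2 p.1 p.2).trans (le_of_eq ?_)
      simp only [N]
      ring)
    (fun p => F p.1 p.2) hc0
    (fun t ht x hxb hx => by
      have hX := key t ht (fun r => toMat (x r)) (by ext i j; simp [toMat, hxb])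
        (fun r hr => hmatderiv x _ r _ (hx r hr)) t (left_mem_Icc.2 ht.2)
      rw [pi_norm_le_iff_of_nonneg hc0]
      intro p
      -- From X ≤ Y the diagonal of X is at most c, and X ≥ 0 then bounds all entries by c.
      have hdiag : ∀ i, toMat (x t) i i ≤ c * 1 ^ 2 := fun i => by
        have h1 := hX.2.2.diag_nonneg i
        rw [Matrix.sub_apply] at h1
        have h2 := (le_abs_self _).trans (hc t ht i i)
        linarith
      have := hX.2.1.abs_le hX.1 hc0 zero_le_one zero_le_one (hdiag p.1) (hdiag p.2)
      simpa [toMat] using this)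
  have hX := fun r hr => hmatderiv x _ r _ (hx r hr)
  have hXb : toMat (x b) = F := by ext i j; simp [toMat, hxb]
  exact ⟨fun r => toMat (x r), hXb, hX, key a (left_mem_Icc.2 hab) _ hXb hX⟩

end Riccati

end CheapGame

namespace CheapGame

/-! ### Boundary layer estimates for the stiff fast variables. -/

section FastVariables

variable {ι : Type*} [Fintype ι]

theorem dotProduct_le_sqrt_mul {v w : ι → ℝ} {C : ℝ} (hC : 0 ≤ C) (hw : w ⬝ᵥ w ≤ C ^ 2) :
    v ⬝ᵥ w ≤ √(v ⬝ᵥ v) * C := by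
  have h1 : (v ⬝ᵥ w) ^ 2 ≤ (v ⬝ᵥ v) * (w ⬝ᵥ w) := by
    simpa [dotProduct, sq] using Finset.sum_mul_sq_le_sq_mul_sq Finset.univ v w
  have h0 : 0 ≤ v ⬝ᵥ v := by simpa using dotProduct_star_self_nonneg v
  refine le_of_abs_le (abs_le_of_sq_le_sq ?_ (by positivity))
  rw [mul_pow, Real.sq_sqrt h0]
  exact h1.trans (mul_le_mul_of_nonneg_left hw h0)

theorem hasDerivAt_layer (μ ε b t : ℝ) :
    HasDerivAt (fun r => μ * (b - r) / ε) (-(μ / ε)) t := by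
  have := (((hasDerivAt_id t).const_sub b).const_mul μ).div_const ε
  simpa [neg_div] using this

/-- A symmetric solution of `ε P' = P² - L` with `L ≥ μ²` and `P(b) = 0` is bounded below by
`μ tanh (μ (b - t) / ε)`. -/
theorem layer_le_of_riccati [DecidableEq ι] {P L : ℝ → Matrix ι ι ℝ} {a b ε μ : ℝ} (hε : 0 < ε)
    (hP : ∀ t ∈ Icc a b, MatHasDerivWithinAt P (ε⁻¹ • (P t * P t - L t)) (Icc a b) t)
    (hPs : ∀ t ∈ Icc a b, (P t).IsSymm) (hPb : P b = 0)
    (hL : ∀ t ∈ Icc a b, ∀ w, μ ^ 2 * (w ⬝ᵥ w) ≤ w ⬝ᵥ (L t *ᵥ w)) :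
    ∀ t ∈ Icc a b, ∀ w, μ * Real.sinh (μ * (b - t) / ε) * (w ⬝ᵥ w) ≤
      Real.cosh (μ * (b - t) / ε) * (w ⬝ᵥ (P t *ᵥ w)) := by
  -- p = μ tanh(μ(b - t)/ε) is the scalar solution of ε p' = p² - μ² with p(b) = 0.
  set p : ℝ → ℝ := fun t => μ * (Real.sinh (μ * (b - t) / ε) / Real.cosh (μ * (b - t) / ε)) with hp
  have hpd : ∀ t, HasDerivAt p (ε⁻¹ * (p t ^ 2 - μ ^ 2)) t := by
    intro t
    have h1 := hasDerivAt_layer μ ε b t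
    have hc := (Real.cosh_pos (μ * (b - t) / ε)).ne'
    refine ((h1.sinh.div h1.cosh hc).const_mul μ).congr_deriv ?_
    have := Real.cosh_sq (μ * (b - t) / ε)
    simp only [hp]
    field_simp
    ring_nf
  have hpc : Continuous p := continuous_iff_continuousAt.2 fun t => (hpd t).continuousAt
  have hPc := matContOn_of_hasDerivWithinAt hP
  -- Since P and p·1 commute, P² - p² is split symmetrically by `M`, and the Lyapunov residual of P
  -- - p·1 is ε⁻¹(L - μ²), which is nonnegative.
  have key := quadNonneg_of_lyapunov (a := a) (b := b) (E := fun t => P t - p t • 1)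
    (E' := fun t => ε⁻¹ • (P t * P t - L t) - (ε⁻¹ * (p t ^ 2 - μ ^ 2)) • 1)
    (M := fun t => (-(ε⁻¹ / 2)) • (P t + p t • 1))
    (MatContOn.smul continuousOn_const
      (hPc.add (MatContOn.smul hpc.continuousOn (MatContOn.const 1))))
    (fun t ht => (hP t ht).sub fun i j => ((hpd t).mul_const _).hasDerivWithinAt)
    (fun t ht w => by
      have h1 : -(ε⁻¹ • (P t * P t - L t) - (ε⁻¹ * (p t ^ 2 - μ ^ 2)) • (1 : Matrix ι ι ℝ)) -
          ((-(ε⁻¹ / 2)) • (P t + p t • (1 : Matrix ι ι ℝ)))ᵀ * (P t - p t • (1 : Matrix ι ι ℝ)) -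
          (P t - p t • (1 : Matrix ι ι ℝ)) * ((-(ε⁻¹ / 2)) • (P t + p t • (1 : Matrix ι ι ℝ))) =
          ε⁻¹ • (L t - μ ^ 2 • (1 : Matrix ι ι ℝ)) := by
        simp only [Matrix.transpose_smul, Matrix.transpose_add, (hPs t ht).eq,
          Matrix.transpose_one, smul_mul_assoc, mul_smul_comm, add_mul, mul_add, mul_sub, sub_mul,
          mul_one, one_mul]
        module
      rw [h1, Matrix.smul_mulVec, dotProduct_smul, Matrix.sub_mulVec, Matrix.smul_mulVec,
        Matrix.one_mulVec, dotProduct_sub, dotProduct_smul, smul_eq_mul, smul_eq_mul]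
      exact mul_nonneg (by positivity) (sub_nonneg.2 (hL t ht w)))
    (fun w => by simp [hPb, hp])
  intro t ht w
  have h1 := key t ht w
  have hc := Real.cosh_pos (μ * (b - t) / ε)
  rw [Matrix.sub_mulVec, Matrix.smul_mulVec, Matrix.one_mulVec, dotProduct_sub, dotProduct_smul,
    smul_eq_mul] at h1
  have h2 := mul_nonneg hc.le h1
  have h3 : Real.cosh (μ * (b - t) / ε) * p t = μ * Real.sinh (μ * (b - t) / ε) := by
    simp only [hp]
    field_simp
  rw [mul_sub, ← mul_assoc, h3] at h2
  linarith

/-- A solution of the stiff equation `ε w' = P w - h` with `w(b) = 0` is bounded independently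
of `ε` if `P(t) ≥ μ tanh (μ (b - t) / ε)`. -/
theorem abs_le_of_stiff_linear {P : ℝ → Matrix ι ι ℝ} {w h : ℝ → ι → ℝ} {a b ε μ C : ℝ}
    (hε : 0 < ε) (hμ : 0 < μ) (hC : 0 ≤ C)
    (hP : ∀ t ∈ Icc a b, ∀ w, μ * Real.sinh (μ * (b - t) / ε) * (w ⬝ᵥ w) ≤
      Real.cosh (μ * (b - t) / ε) * (w ⬝ᵥ (P t *ᵥ w)))
    (hw : ∀ t ∈ Icc a b, HasDerivWithinAt w (ε⁻¹ • (P t *ᵥ w t - h t)) (Icc a b) t)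
    (hh : ∀ t ∈ Icc a b, h t ⬝ᵥ h t ≤ C ^ 2) (hb : w b = 0) :
    ∀ t ∈ Icc a b, ∀ i, |w t i| ≤ 1 + C / μ := by
  have hw0 : ∀ t, 0 ≤ w t ⬝ᵥ w t := fun t => by simpa using dotProduct_star_self_nonneg (w t)
  -- The weight cosh² is the integrating factor of the damping 2μ tanh/ε for |w|². The added 1 keeps
  -- the square root differentiable where w = 0 and makes f(b) = 1.
  set q : ℝ → ℝ := fun t => (w t ⬝ᵥ w t) * Real.cosh (μ * (b - t) / ε) ^ 2 + 1 with hq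
  have hqpos : ∀ t, 0 < q t := fun t => by
    have := hw0 t
    simp only [hq]
    positivity
  set f : ℝ → ℝ := fun t => √(q t) - C / μ * Real.sinh (μ * (b - t) / ε) with hf
  have hqd : ∀ t ∈ Icc a b, HasDerivWithinAt q (2 / ε * Real.cosh (μ * (b - t) / ε) *
      (Real.cosh (μ * (b - t) / ε) * (w t ⬝ᵥ (P t *ᵥ w t)) -
        Real.cosh (μ * (b - t) / ε) * (w t ⬝ᵥ h t) -
        μ * Real.sinh (μ * (b - t) / ε) * (w t ⬝ᵥ w t))) (Icc a b) t := by
    intro t ht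
    have h1 := (hasDerivAt_layer μ ε b t).cosh.hasDerivWithinAt (s := Icc a b)
    refine ((((hw t ht).dotProduct (hw t ht)).mul (h1.pow 2)).add_const 1).congr_deriv ?_
    rw [dotProduct_comm _ (w t)]
    simp only [dotProduct_smul, dotProduct_sub, smul_eq_mul, Pi.pow_apply]
    field_simp
    ring
  have hfd : ∀ t ∈ Icc a b, HasDerivWithinAt f (2 / ε * Real.cosh (μ * (b - t) / ε) *
      (Real.cosh (μ * (b - t) / ε) * (w t ⬝ᵥ (P t *ᵥ w t)) -
        Real.cosh (μ * (b - t) / ε) * (w t ⬝ᵥ h t) -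
        μ * Real.sinh (μ * (b - t) / ε) * (w t ⬝ᵥ w t)) / (2 * √(q t)) -
      C / μ * (Real.cosh (μ * (b - t) / ε) * (-(μ / ε)))) (Icc a b) t := fun t ht =>
    ((hqd t ht).sqrt (hqpos t).ne').sub
      ((hasDerivAt_layer μ ε b t).sinh.const_mul (C / μ)).hasDerivWithinAt
  have hmono : MonotoneOn f (Icc a b) := by
    refine monotoneOn_of_hasDerivWithinAt_nonneg (convex_Icc a b)
      (fun r hr => (hfd r hr).continuousWithinAt)
      (fun r hr => (hfd r (interior_subset hr)).mono interior_subset) fun t ht => ?_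
    replace ht := interior_subset ht
    set ch := Real.cosh (μ * (b - t) / ε) with hch
    have hc : 0 < ch := Real.cosh_pos _
    have h1 := hP t ht (w t)
    have h2 := dotProduct_le_sqrt_mul hC (hh t ht) (v := w t)
    have h3 : ch * √(w t ⬝ᵥ w t) ≤ √(q t) := by
      refine Real.le_sqrt_of_sq_le ?_
      rw [mul_pow, Real.sq_sqrt (hw0 t)]
      simp only [hq, ← hch]
      linarith
    have hs : 0 < √(q t) := Real.sqrt_pos.2 (hqpos t)
    have h4 : C / μ * (ch * (-(μ / ε))) = -(C * ch / ε) := by field_simp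
    rw [h4, sub_neg_eq_add]
    -- The lower bound on P cancels the term from differentiating cosh; only the forcing remains.
    -- Its contribution to the derivative of √q is at least -C cosh/ε, which the sinh term of `f`
    -- compensates.
    have h5 : -(C * √(q t)) ≤ ch * (w t ⬝ᵥ (P t *ᵥ w t)) - ch * (w t ⬝ᵥ h t) -
        μ * Real.sinh (μ * (b - t) / ε) * (w t ⬝ᵥ w t) := by
      have h6 : ch * (w t ⬝ᵥ h t) ≤ C * √(q t) :=
        calc ch * (w t ⬝ᵥ h t) ≤ ch * (√(w t ⬝ᵥ w t) * C) := mul_le_mul_of_nonneg_left h2 hc.le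
          _ = C * (ch * √(w t ⬝ᵥ w t)) := by ring
          _ ≤ C * √(q t) := mul_le_mul_of_nonneg_left h3 hC
      linarith
    have h7 := mul_le_mul_of_nonneg_left h5 (show 0 ≤ 2 / ε * ch by positivity)
    have h8 := div_le_div_of_nonneg_right h7 (show 0 ≤ 2 * √(q t) by positivity)
    have h9 : 2 / ε * ch * -(C * √(q t)) / (2 * √(q t)) = -(C * ch / ε) := by field_simp
    linarith
  intro t ht i
  have h1 := hmono ht (right_mem_Icc.2 (ht.1.trans ht.2)) ht.2
  have h2 : f b = 1 := by simp [hf, hq, hb]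
  rw [h2] at h1
  simp only [hf] at h1
  set ch := Real.cosh (μ * (b - t) / ε) with hch
  have hc : 1 ≤ ch := Real.one_le_cosh _
  have hsc : Real.sinh (μ * (b - t) / ε) ≤ ch := (Real.sinh_lt_cosh _).le
  have h3 : |w t i| * ch ≤ √(q t) := by
    refine Real.le_sqrt_of_sq_le ?_
    rw [mul_pow, sq_abs]
    have h4 : w t i ^ 2 ≤ w t ⬝ᵥ w t := by
      rw [dotProduct, sq]
      exact Finset.single_le_sum (f := fun i => w t i * w t i) (fun j _ => mul_self_nonneg _)
        (Finset.mem_univ i)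
    have := mul_le_mul_of_nonneg_right h4 (sq_nonneg ch)
    simp only [hq, ← hch]
    linarith
  have h5 : C / μ * Real.sinh (μ * (b - t) / ε) ≤ C / μ * ch :=
    mul_le_mul_of_nonneg_left hsc (by positivity)
  have h6 : |w t i| * ch ≤ (1 + C / μ) * ch := by nlinarith
  exact le_of_mul_le_mul_right h6 (by linarith)

end FastVariables

/-! ### Stability of positive definiteness under perturbation. -/

section Compactness

variable {ι P : Type*} [Fintype ι] [TopologicalSpace P]

/-- Positive definiteness, uniformly on a compact set of times, is stable under perturbation. -/
theorem eventually_quadForm_pos {T : Type*} [TopologicalSpace T] [CompactSpace T]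
    {R : P → T → Matrix ι ι ℝ} (hR : Continuous fun q : P × T => R q.1 q.2) {p₀ : P}
    (hpos : ∀ t, ∀ w, w ≠ 0 → 0 < w ⬝ᵥ (R p₀ t *ᵥ w)) :
    ∀ᶠ p in 𝓝 p₀, ∀ t, ∀ w, w ≠ 0 → 0 < w ⬝ᵥ (R p t *ᵥ w) := by
  -- By homogeneity it is enough to test unit vectors, so positivity is required only on a compact
  -- set.
  have hK : IsCompact ((univ : Set T) ×ˢ Metric.sphere (0 : ι → ℝ) 1) :=
    isCompact_univ.prod (isCompact_sphere 0 1)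
  have hcont : Continuous fun q : P × (T × (ι → ℝ)) => q.2.2 ⬝ᵥ (R q.1 q.2.1 *ᵥ q.2.2) := by
    have h1 : Continuous fun q : P × (T × (ι → ℝ)) => R q.1 q.2.1 :=
      hR.comp (continuous_fst.prodMk (continuous_fst.comp continuous_snd))
    have h2 : Continuous fun q : P × (T × (ι → ℝ)) => q.2.2 :=
      continuous_snd.comp continuous_snd
    exact h2.dotProduct (h1.matrix_mulVec h2)
  have := hK.eventually_forall_of_forall_eventually (x₀ := p₀)
    (P := fun p y => 0 < y.2 ⬝ᵥ (R p y.1 *ᵥ y.2)) (fun y hy => by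
      have hy0 : y.2 ≠ 0 := by
        intro h0
        have := hy.2
        simp [h0] at this
      exact hcont.continuousAt.eventually (lt_mem_nhds (hpos y.1 y.2 hy0)))
  filter_upwards [this] with p hp t w hw
  have hn : ‖w‖ ≠ 0 := norm_ne_zero_iff.2 hw
  have h1 := hp (t, ‖w‖⁻¹ • w) ⟨mem_univ _, by simp [norm_smul, hn]⟩
  simp only [Matrix.mulVec_smul, smul_dotProduct, dotProduct_smul, smul_eq_mul] at h1
  have h2 : 0 < ‖w‖⁻¹ := by positivity
  exact (mul_pos_iff_of_pos_left h2).1 ((mul_pos_iff_of_pos_left h2).1 h1)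

theorem _root_.MatContOn.continuous_restrict {κ ν : Type*} {M : ℝ → Matrix κ ν ℝ} {s : Set ℝ}
    (hM : MatContOn M s) : Continuous fun t : s => M t :=
  continuousOn_iff_continuous_domRestrict.1 (matContOn_iff.1 hM)

end Compactness

end CheapGame

section MatrixDerivatives

variable {ι κ ν : Type*} {s : Set ℝ} {t : ℝ}

theorem MatHasDerivWithinAt.mul [Fintype κ] {M : ℝ → Matrix ι κ ℝ} {N : ℝ → Matrix κ ν ℝ}
    {M' : Matrix ι κ ℝ} {N' : Matrix κ ν ℝ} (hM : MatHasDerivWithinAt M M' s t)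
    (hN : MatHasDerivWithinAt N N' s t) :
    MatHasDerivWithinAt (fun r => M r * N r) (M' * N t + M t * N') s t := by
  intro i j
  simp only [Matrix.mul_apply, Matrix.add_apply, ← Finset.sum_add_distrib]
  exact HasDerivWithinAt.fun_sum fun k _ => (hM i k).mul (hN k j)

theorem MatC1On.exists_deriv {M : ℝ → Matrix ι κ ℝ} {a b : ℝ} (hab : a < b)
    (hM : MatC1On M (Icc a b)) : ∃ M' : ℝ → Matrix ι κ ℝ, MatContOn M' (Icc a b) ∧
      ∀ t ∈ Icc a b, MatHasDerivWithinAt M (M' t) (Icc a b) t :=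
  ⟨fun t i j => derivWithin (fun t => M t i j) (Icc a b) t,
    fun i j => (hM i j).continuousOn_derivWithin (uniqueDiffOn_Icc hab) le_rfl,
    fun t ht i j => (((hM i j).differentiableOn one_ne_zero) t ht).hasDerivWithinAt⟩

end MatrixDerivatives

namespace CheapGame

theorem exists_pos_of_eventually_nhds_zero {p : ℝ → Prop} (h : ∀ᶠ x in 𝓝 (0 : ℝ), p x) :
    ∃ x, 0 < x ∧ p x :=
  (((h.filter_mono nhdsWithin_le_nhds).and self_mem_nhdsWithin :
    ∀ᶠ x in 𝓝[>] (0 : ℝ), p x ∧ x ∈ Ioi 0).exists).imp fun _ hx => ⟨hx.2, hx.1⟩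

/-! ### Strict supersolutions of the reduced equation. -/

section ReducedProblem

variable {ι : Type*} [Fintype ι] [DecidableEq ι]

theorem quadForm_one_pos {w : ι → ℝ} (hw : w ≠ 0) : 0 < w ⬝ᵥ ((1 : Matrix ι ι ℝ) *ᵥ w) := by
  rw [Matrix.one_mulVec]
  simpa using Matrix.dotProduct_star_self_pos_iff.2 hw

/-- A solution of a Riccati equation can be perturbed to a strict supersolution. -/
theorem exists_strict_supersolution {A N D K : ℝ → Matrix ι ι ℝ} {a b : ℝ}
    (hA : MatContOn A (Icc a b)) (hN : MatContOn N (Icc a b)) (hD : MatContOn D (Icc a b))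
    (hK : ∀ t ∈ Icc a b, MatHasDerivWithinAt K (riccati (A t) (N t) (D t) (K t)) (Icc a b) t)
    (hKs : ∀ t ∈ Icc a b, (K t).IsSymm) :
    ∃ X X' : ℝ → Matrix ι ι ℝ, ∃ δ : ℝ, 0 < δ ∧ MatContOn X' (Icc a b) ∧
      (∀ t ∈ Icc a b, MatHasDerivWithinAt X (X' t) (Icc a b) t) ∧
      (∀ t ∈ Icc a b, (X t).IsSymm) ∧ X b - K b = δ • 1 ∧
      ∀ t ∈ Icc a b, ∀ w, w ≠ 0 → 0 < w ⬝ᵥ ((riccati (A t) (N t) (D t) (X t) - X' t) *ᵥ w) := by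
  have hKc := matContOn_of_hasDerivWithinAt hK
  have hK'c := hA.riccati hN hD hKc
  set Q : ℝ → Matrix ι ι ℝ := fun t => -A t - (A t)ᵀ + N t * K t + K t * N t with hQ
  have hQc : MatContOn Q (Icc a b) :=
    ((hA.neg.sub hA.transpose).add (hN.mul hKc)).add (hKc.mul hN)
  have hQr := hQc.continuous_restrict
  have hNr := hN.continuous_restrict
  -- For X = K + δη·1 with η' = -ν⁻¹η, the residual is δη(ν⁻¹ + Q + δηN). A small ν makes ν⁻¹ + Q
  -- positive definite, whatever the sign of Q.
  obtain ⟨ν, hν, hνpos⟩ := exists_pos_of_eventually_nhds_zero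
    (eventually_quadForm_pos (T := Icc a b) (p₀ := (0 : ℝ))
      (R := fun ν t => (1 : Matrix ι ι ℝ) + ν • Q t)
      (continuous_const.add (continuous_fst.smul (hQr.comp continuous_snd)))
      fun t w hw => by simpa using quadForm_one_pos hw)
  set η : ℝ → ℝ := fun t => Real.exp (ν⁻¹ * (b - t)) with hη
  have hηc : Continuous η := by fun_prop
  have hηd : ∀ t, HasDerivAt η (-(ν⁻¹ * η t)) t := fun t => by
    have h1 := (((hasDerivAt_id t).const_sub b).const_mul ν⁻¹).exp
    refine h1.congr_deriv ?_
    simp only [hη, id]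
    ring
  -- With ν and hence η fixed, δ is taken small enough that the quadratic remainder δηN does not
  -- destroy positivity.
  obtain ⟨δ, hδ, hδpos⟩ := exists_pos_of_eventually_nhds_zero
    (eventually_quadForm_pos (T := Icc a b) (p₀ := (0 : ℝ))
      (R := fun δ t => ν⁻¹ • (1 : Matrix ι ι ℝ) + Q t + (δ * η t) • N t)
      ((continuous_const.add (hQr.comp continuous_snd)).add
        ((continuous_fst.mul (hηc.comp (continuous_subtype_val.comp continuous_snd))).smul
          (hNr.comp continuous_snd)))
      fun t w hw => by
        have h1 := mul_pos (inv_pos.2 hν) (hνpos t w hw)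
        rw [← smul_eq_mul, ← dotProduct_smul, ← Matrix.smul_mulVec, smul_add, smul_smul,
          inv_mul_cancel₀ hν.ne', one_smul] at h1
        simpa using h1)
  refine ⟨fun t => K t + (δ * η t) • 1,
    fun t => riccati (A t) (N t) (D t) (K t) + (δ * -(ν⁻¹ * η t)) • 1, δ, hδ,
    hK'c.add (MatContOn.smul (by fun_prop) (MatContOn.const 1)),
    fun t ht => (hK t ht).add fun i j =>
      (((hηd t).const_mul δ).mul_const _).hasDerivWithinAt,
    fun t ht => (hKs t ht).add (by simp [Matrix.IsSymm]), by simp [hη], fun t ht w hw => ?_⟩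
  have h1 := mul_pos (mul_pos hδ (Real.exp_pos (ν⁻¹ * (b - t)))) (hδpos ⟨t, ht⟩ w hw)
  rw [← smul_eq_mul, ← dotProduct_smul, ← Matrix.smul_mulVec] at h1
  have h2 := riccati_sub_riccati (A t) (N t) (D t) (K t + (δ * η t) • 1) (K t)
  rw [sub_eq_iff_eq_add] at h2
  have h3 : riccati (A t) (N t) (D t) (K t + (δ * η t) • 1) -
      (riccati (A t) (N t) (D t) (K t) + (δ * -(ν⁻¹ * η t)) • 1) =
      (δ * η t) • (ν⁻¹ • (1 : Matrix ι ι ℝ) + Q t + (δ * η t) • N t) := by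
    rw [h2]
    simp only [hQ, add_sub_cancel_left, smul_mul_assoc, mul_smul_comm, mul_one, one_mul, mul_add]
    module
  beta_reduce
  rw [h3]
  exact h1

theorem inv_diagonal_of_pos {d : ι → ℝ} (hd : ∀ p, 0 < d p) :
    (Matrix.diagonal d)⁻¹ = Matrix.diagonal fun p => (d p)⁻¹ := by
  refine Matrix.inv_eq_right_inv ?_
  rw [Matrix.diagonal_mul_diagonal, ← Matrix.diagonal_one]
  congr 1
  funext p
  exact mul_inv_cancel₀ (hd p).ne'

variable {κ : Type*} [Fintype κ] [DecidableEq κ]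

/-- Slow part `X₁`, coupling `X₂` and fast part `X₄` of a supersolution, to leading order. -/
theorem exists_leading_order_supersolution {A S D K : ℝ → Matrix ι ι ℝ} {a₂ : ℝ → Matrix ι κ ℝ}
    {lam : ℝ → κ → ℝ} {a b : ℝ} (hab : a < b)
    (hA : MatContOn A (Icc a b)) (hS : MatContOn S (Icc a b)) (hD : MatContOn D (Icc a b))
    (ha₂ : MatC1On a₂ (Icc a b)) (hlam : ∀ p, ContDiffOn ℝ 1 (fun t => lam t p) (Icc a b))
    (hlam0 : ∀ t ∈ Icc a b, ∀ p, 0 < lam t p)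
    (hK : ∀ t ∈ Icc a b, MatHasDerivWithinAt K (riccati (A t)
      (a₂ t * (Matrix.diagonal (lam t))⁻¹ * (a₂ t)ᵀ - S t) (D t) (K t)) (Icc a b) t)
    (hKs : ∀ t ∈ Icc a b, (K t).IsSymm) :
    ∃ (X₁ X₁' : ℝ → Matrix ι ι ℝ) (X₂ X₂' : ℝ → Matrix ι κ ℝ) (X₄' : ℝ → Matrix κ κ ℝ)
      (r : ℝ → κ → ℝ) (δ β : ℝ), 0 < δ ∧ 0 < β ∧ MatContOn X₁' (Icc a b) ∧
      MatContOn X₂' (Icc a b) ∧ MatContOn X₄' (Icc a b) ∧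
      (∀ t ∈ Icc a b, MatHasDerivWithinAt X₁ (X₁' t) (Icc a b) t) ∧
      (∀ t ∈ Icc a b, MatHasDerivWithinAt X₂ (X₂' t) (Icc a b) t) ∧
      (∀ t ∈ Icc a b, MatHasDerivWithinAt (fun t => Matrix.diagonal (r t)) (X₄' t) (Icc a b) t) ∧
      (∀ t ∈ Icc a b, (X₁ t).IsSymm) ∧ X₁ b - K b = δ • 1 ∧ (∀ t ∈ Icc a b, ∀ p, 0 < r t p) ∧
      (∀ t ∈ Icc a b, X₁ t * a₂ t = X₂ t * Matrix.diagonal (r t)) ∧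
      (∀ t ∈ Icc a b, Matrix.diagonal (r t) * Matrix.diagonal (r t) =
        Matrix.diagonal (lam t) + β • 1) ∧
      ∀ t ∈ Icc a b, ∀ w, w ≠ 0 → 0 < w ⬝ᵥ ((-(X₁ t * A t) - (A t)ᵀ * X₁ t + X₂ t * (X₂ t)ᵀ -
        X₁ t * S t * X₁ t - D t - X₁' t) *ᵥ w) := by
  have ha₂c : MatContOn a₂ (Icc a b) := fun i j => (ha₂ i j).continuousOn
  have hNc : MatContOn (fun t => a₂ t * (Matrix.diagonal (lam t))⁻¹ * (a₂ t)ᵀ - S t) (Icc a b) := by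
    refine MatContOn.sub ((ha₂c.mul ?_).mul ha₂c.transpose) hS
    refine matContOn_iff.2 (ContinuousOn.congr (f := fun t => Matrix.diagonal fun p => (lam t p)⁻¹)
      ?_ fun t ht => inv_diagonal_of_pos (hlam0 t ht))
    refine matContOn_iff.1 fun i j => ?_
    by_cases hij : i = j
    · subst hij
      simp only [Matrix.diagonal_apply_eq]
      exact (hlam i).continuousOn.inv₀ fun t ht => (hlam0 t ht i).ne'
    · simp only [Matrix.diagonal_apply_ne _ hij]
      exact continuousOn_const
  obtain ⟨X, X', δ, hδ, hX'c, hX, hXs, hXb, hXpos⟩ := exists_strict_supersolution hA hNc hD hK hKs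
  have hXc := matContOn_of_hasDerivWithinAt hX
  have hXr := hXc.continuous_restrict
  have hX'r := hX'c.continuous_restrict
  have hAr := hA.continuous_restrict
  have hSr := hS.continuous_restrict
  have hDr := hD.continuous_restrict
  have ha₂r := ha₂c.continuous_restrict
  -- Strictness leaves room to replace Λ by Λ + θ², which will leave a positive residual β = θ² on
  -- the fast block. The parameter enters squared so that Λ + θ² is invertible for θ of either sign.
  obtain ⟨θ, hθ, hθpos⟩ := exists_pos_of_eventually_nhds_zero
    (eventually_quadForm_pos (T := Icc a b) (p₀ := (0 : ℝ))
      (R := fun θ t => riccati (A t)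
        (a₂ t * (Matrix.diagonal fun p => (lam t p + θ ^ 2)⁻¹) * (a₂ t)ᵀ - S t) (D t) (X t) - X' t)
      (by
        have h1 : Continuous fun q : ℝ × Icc a b =>
            Matrix.diagonal fun p => (lam q.2 p + q.1 ^ 2)⁻¹ := by
          refine Continuous.matrix_diagonal (continuous_pi fun p => ?_)
          have h2 : Continuous fun q : ℝ × Icc a b => lam q.2 p :=
            (continuousOn_iff_continuous_domRestrict.1 (hlam p).continuousOn).comp continuous_snd
          have h3 : Continuous fun q : ℝ × Icc a b => q.1 ^ 2 := continuous_fst.pow 2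
          refine (h2.add h3).inv₀ fun q => ?_
          exact (add_pos_of_pos_of_nonneg (hlam0 q.2 q.2.2 p) (sq_nonneg q.1)).ne'
        have hX2 := hXr.comp (continuous_snd (X := ℝ))
        have hA2 := hAr.comp (continuous_snd (X := ℝ))
        have ha2 := ha₂r.comp (continuous_snd (X := ℝ))
        exact (((((hX2.matrix_mul hA2).neg.sub (hA2.matrix_transpose.matrix_mul hX2)).add
          ((hX2.matrix_mul (((ha2.matrix_mul h1).matrix_mul ha2.matrix_transpose).sub
            (hSr.comp continuous_snd))).matrix_mul hX2)).sub (hDr.comp continuous_snd)).sub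
            (hX'r.comp continuous_snd)))
      fun t w hw => by
        have h1 := hXpos t t.2 w hw
        rw [inv_diagonal_of_pos (hlam0 t t.2)] at h1
        simpa using h1)
  set r : ℝ → κ → ℝ := fun t p => √(lam t p + θ ^ 2) with hr
  have hrpos : ∀ t ∈ Icc a b, ∀ p, 0 < r t p := fun t ht p => by
    have := hlam0 t ht p
    exact Real.sqrt_pos.2 (by positivity)
  have hr2 : ∀ t ∈ Icc a b, ∀ p, r t p * r t p = lam t p + θ ^ 2 := fun t ht p => by
    have := hlam0 t ht p
    exact Real.mul_self_sqrt (by positivity)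
  have hrC1 : ∀ p, ContDiffOn ℝ 1 (fun t => r t p) (Icc a b) := fun p =>
    ((hlam p).add contDiffOn_const).sqrt fun t ht => by
      have := hlam0 t ht p
      positivity
  have hrdiag : MatC1On (fun t => Matrix.diagonal (r t)) (Icc a b) := fun i j => by
    by_cases hij : i = j
    · subst hij
      simpa only [Matrix.diagonal_apply_eq] using hrC1 i
    · simpa only [Matrix.diagonal_apply_ne _ hij] using contDiffOn_const
  have hLC1 : MatC1On (fun t => a₂ t * Matrix.diagonal fun p => (r t p)⁻¹) (Icc a b) :=
    fun i j => by
      simp only [Matrix.mul_diagonal]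
      exact (ha₂ i j).mul ((hrC1 j).inv fun t ht => (hrpos t ht j).ne')
  obtain ⟨X₄', hX₄'c, hX₄⟩ := hrdiag.exists_deriv hab
  obtain ⟨L', hL'c, hL⟩ := hLC1.exists_deriv hab
  have hLc := matContOn_of_hasDerivWithinAt hL
  -- X₂ is forced by X₁a₂ = X₂X₄, and then X₂X₂ᵀ = X₁a₂(Λ + θ²)⁻¹a₂ᵀX₁ is the quadratic term of the
  -- reduced equation. Continuous differentiability of a₂ and Λ is what makes X₂ and X₄ continuously
  -- differentiable.
  refine ⟨X, X', fun t => X t * (a₂ t * Matrix.diagonal fun p => (r t p)⁻¹),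
    fun t => X' t * (a₂ t * Matrix.diagonal fun p => (r t p)⁻¹) + X t * L' t, X₄', r, δ, θ ^ 2,
    hδ, by positivity, hX'c, (hX'c.mul hLc).add (hXc.mul hL'c), hX₄'c, hX,
    fun t ht => (hX t ht).mul (hL t ht), hX₄, hXs, hXb, hrpos, fun t ht => ?_, fun t ht => ?_,
    fun t ht w hw => ?_⟩
  · have h1 : (fun p => (r t p)⁻¹ * r t p) = 1 := by
      funext p
      exact inv_mul_cancel₀ (hrpos t ht p).ne'
    rw [Matrix.mul_assoc, Matrix.mul_assoc, Matrix.diagonal_mul_diagonal, h1]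
    simp
  · rw [Matrix.diagonal_mul_diagonal, ← Matrix.diagonal_one, ← Matrix.diagonal_smul,
      Matrix.diagonal_add]
    congr 1
    funext p
    simp [hr2 t ht p]
  · have h1 := hθpos ⟨t, ht⟩ w hw
    have h2 : (Matrix.diagonal fun p => (lam t p + θ ^ 2)⁻¹) =
        (Matrix.diagonal fun p => (r t p)⁻¹) * Matrix.diagonal fun p => (r t p)⁻¹ := by
      rw [Matrix.diagonal_mul_diagonal]
      congr 1
      funext p
      rw [← mul_inv, hr2 t ht p]
    have h3 : -(X t * A t) - (A t)ᵀ * X t +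
        X t * (a₂ t * Matrix.diagonal fun p => (r t p)⁻¹) *
          (X t * (a₂ t * Matrix.diagonal fun p => (r t p)⁻¹))ᵀ - X t * S t * X t - D t - X' t =
        riccati (A t) (a₂ t * (Matrix.diagonal fun p => (lam t p + θ ^ 2)⁻¹) * (a₂ t)ᵀ - S t) (D t)
          (X t) - X' t := by
      rw [h2]
      simp only [riccati, Matrix.transpose_mul, (hXs t ht).eq, Matrix.diagonal_transpose, mul_sub,
        sub_mul, Matrix.mul_assoc]
      abel
    beta_reduce
    rw [h3]
    exact h1

end ReducedProblem

end CheapGame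

namespace CheapGame

/-! ### Quadratic forms of block matrices. -/

section BlockForms

variable {ι κ : Type*} [Fintype ι] [Fintype κ]

theorem quadForm_fromBlocks (P : Matrix ι ι ℝ) (Q : Matrix ι κ ℝ) (R : Matrix κ ι ℝ)
    (S : Matrix κ κ ℝ) (w : ι ⊕ κ → ℝ) :
    w ⬝ᵥ (Matrix.fromBlocks P Q R S *ᵥ w) =
      (w ∘ Sum.inl) ⬝ᵥ (P *ᵥ (w ∘ Sum.inl)) + (w ∘ Sum.inl) ⬝ᵥ (Q *ᵥ (w ∘ Sum.inr)) +
      ((w ∘ Sum.inr) ⬝ᵥ (R *ᵥ (w ∘ Sum.inl)) + (w ∘ Sum.inr) ⬝ᵥ (S *ᵥ (w ∘ Sum.inr))) := by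
  conv_lhs => rw [← Sum.elim_comp_inl_inr w]
  rw [Matrix.fromBlocks_mulVec, sumElim_dotProduct_sumElim]
  simp only [dotProduct_add, Sum.elim_comp_inl, Sum.elim_comp_inr]

theorem quadForm_fromBlocks_diagonal_pos {P : Matrix ι ι ℝ} {S : Matrix κ κ ℝ}
    (hP : ∀ w, w ≠ 0 → 0 < w ⬝ᵥ (P *ᵥ w)) (hS : ∀ w, w ≠ 0 → 0 < w ⬝ᵥ (S *ᵥ w)) :
    ∀ w, w ≠ 0 → 0 < w ⬝ᵥ (Matrix.fromBlocks P 0 0 S *ᵥ w) := by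
  intro w hw
  rw [quadForm_fromBlocks]
  simp only [Matrix.zero_mulVec, dotProduct_zero, add_zero, zero_add]
  by_cases h1 : w ∘ Sum.inl = 0
  · have h2 : w ∘ Sum.inr ≠ 0 := by
      intro h2
      apply hw
      rw [← Sum.elim_comp_inl_inr w, h1, h2]
      funext i
      cases i <;> rfl
    simpa [h1] using hS _ h2
  · have h3 := hP _ h1
    by_cases h2 : w ∘ Sum.inr = 0
    · simpa [h2] using h3
    · exact add_pos h3 (hS _ h2)

/-- This is congruence by diag(1, s); it transfers positivity from rescaled residuals to the
original ones. -/
theorem quadNonneg_fromBlocks_smul {P : Matrix ι ι ℝ} {Q : Matrix ι κ ℝ} {S : Matrix κ κ ℝ}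
    (s : ℝ) (h : ∀ w, w ≠ 0 → 0 < w ⬝ᵥ (Matrix.fromBlocks P Q Qᵀ S *ᵥ w)) :
    QuadNonneg (Matrix.fromBlocks P (s • Q) (s • Qᵀ) (s ^ 2 • S)) := by
  intro w
  have h1 : 0 ≤ (Sum.elim (w ∘ Sum.inl) (s • (w ∘ Sum.inr))) ⬝ᵥ
      (Matrix.fromBlocks P Q Qᵀ S *ᵥ (Sum.elim (w ∘ Sum.inl) (s • (w ∘ Sum.inr)))) := by
    by_cases h0 : Sum.elim (w ∘ Sum.inl) (s • (w ∘ Sum.inr)) = 0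
    · simp [h0]
    · exact (h _ h0).le
  rw [quadForm_fromBlocks] at h1 ⊢
  simp only [Sum.elim_comp_inl, Sum.elim_comp_inr, Matrix.mulVec_smul, Matrix.smul_mulVec,
    dotProduct_smul, smul_dotProduct, smul_eq_mul] at h1 ⊢
  linarith

theorem quadForm_smul_one_pos [DecidableEq ι] {c : ℝ} (hc : 0 < c) :
    ∀ w : ι → ℝ, w ≠ 0 → 0 < w ⬝ᵥ ((c • (1 : Matrix ι ι ℝ)) *ᵥ w) := fun w hw => by
  rw [Matrix.smul_mulVec, dotProduct_smul, smul_eq_mul]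
  exact mul_pos hc (quadForm_one_pos hw)

theorem quadForm_diagonal_pos [DecidableEq ι] {d : ι → ℝ} (hd : ∀ i, 0 < d i) :
    ∀ w : ι → ℝ, w ≠ 0 → 0 < w ⬝ᵥ (Matrix.diagonal d *ᵥ w) := fun w hw => by
  obtain ⟨i, hi⟩ := Function.ne_iff.1 hw
  simp only [dotProduct, Matrix.mulVec_diagonal]
  refine Finset.sum_pos' (fun j _ => ?_) ⟨i, Finset.mem_univ i, ?_⟩
  · nlinarith [hd j, mul_nonneg (hd j).le (mul_self_nonneg (w j))]
  · have : 0 < w i * w i := mul_self_pos.2 hi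
    nlinarith [mul_pos (hd i) this]

theorem QuadNonneg.submatrix_equiv {M : Matrix ι ι ℝ} (hM : QuadNonneg M) (e : κ ≃ ι) :
    QuadNonneg (M.submatrix e e) := fun w => by
  have := hM (w ∘ e.symm)
  rw [Matrix.submatrix_mulVec_equiv]
  rw [← comp_equiv_dotProduct_comp_equiv _ _ e] at this
  simpa [Function.comp_assoc] using this

theorem riccati_submatrix_equiv (A S D X : Matrix ι ι ℝ) (e : κ ≃ ι) :
    riccati (A.submatrix e e) (S.submatrix e e) (D.submatrix e e) (X.submatrix e e) =
      (riccati A S D X).submatrix e e := by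
  simp only [riccati, Matrix.transpose_submatrix, Matrix.submatrix_mul_equiv, Matrix.submatrix_sub,
    Matrix.submatrix_add, Matrix.submatrix_neg, Pi.sub_apply, Pi.add_apply, Pi.neg_apply]

theorem continuous_fromRows {T μ₁ μ₂ ν : Type*} [TopologicalSpace T] {M : T → Matrix μ₁ ν ℝ}
    {N : T → Matrix μ₂ ν ℝ} (hM : Continuous M) (hN : Continuous N) :
    Continuous fun t => Matrix.fromRows (M t) (N t) := by
  refine continuous_matrix fun i j => ?_
  cases i with
  | inl i => exact hM.matrix_elem i j
  | inr i => exact hN.matrix_elem i j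

end BlockForms

/-! ### The supersolution of the full equation. -/

section Supersolution

/-- The `2 × 2` block upper left part of the supersolution. -/
def slowFast {μ₁ μ₂ : Type*} (ε : ℝ) (X₁ : Matrix μ₁ μ₁ ℝ) (X₂ : Matrix μ₁ μ₂ ℝ)
    (X₄ : Matrix μ₂ μ₂ ℝ) :
    Matrix (μ₁ ⊕ μ₂) (μ₁ ⊕ μ₂) ℝ :=
  Matrix.fromBlocks X₁ (ε • X₂) (ε • X₂ᵀ) (ε • X₄)

theorem slowFast_isSymm {μ₁ μ₂ : Type*} {ε : ℝ}
    {X₁ : Matrix μ₁ μ₁ ℝ} {X₂ : Matrix μ₁ μ₂ ℝ} {X₄ : Matrix μ₂ μ₂ ℝ}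
    (h₁ : X₁.IsSymm) (h₄ : X₄.IsSymm) : (slowFast ε X₁ X₂ X₄).IsSymm := by
  rw [Matrix.IsSymm, slowFast, Matrix.fromBlocks_transpose]
  simp [h₁.eq, h₄.eq]

variable {ι κ ρ : Type*} [Fintype ι] [Fintype κ] [Fintype ρ] [DecidableEq κ] [DecidableEq ρ]

/-- The supersolution is block diagonal with a constant multiple of 1 as its last block, so its
residual decouples except through `Ab`, `Ac` and `Sb`. -/
theorem riccati_fromBlocks_sub (Aa Sa Da Y Y' P : Matrix ι ι ℝ) (Ab Sb : Matrix ι ρ ℝ)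
    (Ac : Matrix ρ ι ℝ) (Ad Sd : Matrix ρ ρ ℝ) (q c : ℝ) (hY : Y.IsSymm) :
    riccati (Matrix.fromBlocks Aa Ab Ac Ad)
        (q • Matrix.fromBlocks P 0 0 1 - Matrix.fromBlocks Sa Sb Sbᵀ Sd)
        (Matrix.fromBlocks Da 0 0 0) (Matrix.fromBlocks Y 0 0 (c • 1)) -
        Matrix.fromBlocks Y' 0 0 0 =
      Matrix.fromBlocks (riccati Aa (q • P - Sa) Da Y - Y')
        (-(Y * Ab) - c • Acᵀ - c • (Y * Sb)) (-(Y * Ab) - c • Acᵀ - c • (Y * Sb))ᵀ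
        (-(c • (Ad + Adᵀ)) + (c ^ 2 * q) • 1 - c ^ 2 • Sd) := by
  simp only [riccati, Matrix.fromBlocks_smul, sub_eq_add_neg, Matrix.fromBlocks_neg,
    Matrix.fromBlocks_add, Matrix.fromBlocks_multiply, Matrix.fromBlocks_transpose,
    Matrix.mul_zero, Matrix.zero_mul, add_zero, zero_add, smul_zero, neg_zero, mul_smul_comm,
    smul_mul_assoc, Matrix.mul_smul, Matrix.smul_mul, mul_one, one_mul, Matrix.mul_one,
    Matrix.one_mul,
    Matrix.transpose_add, Matrix.transpose_neg, Matrix.transpose_mul, Matrix.transpose_smul,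
    Matrix.transpose_transpose, hY.eq]
  congr 1 <;> simp only [Matrix.mul_neg, Matrix.neg_mul, smul_add, smul_neg] <;> module

/-- The factor ε⁻² of S_u exactly compensates the factors ε in the second block column of `slowFast`
and in its second block row, so this term of the residual does not depend on ε. -/
theorem slowFast_mul_proj_mul {ε : ℝ} (X₁ : Matrix ι ι ℝ) (X₂ : Matrix ι κ ℝ)
    (X₄ : Matrix κ κ ℝ) (hε : ε ≠ 0) :
    slowFast ε X₁ X₂ X₄ * ((ε ^ 2)⁻¹ • Matrix.fromBlocks 0 0 0 1) * slowFast ε X₁ X₂ X₄ =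
      Matrix.fromBlocks (X₂ * X₂ᵀ) (X₂ * X₄) (X₄ * X₂ᵀ) (X₄ * X₄) := by
  simp only [slowFast, Matrix.fromBlocks_multiply, Matrix.mul_smul, Matrix.smul_mul,
    Matrix.mul_zero, Matrix.mul_one, zero_add, Matrix.zero_mul, smul_zero]
  have h : (ε ^ 2)⁻¹ * (ε * ε) = 1 := by field_simp
  rw [Matrix.fromBlocks_smul]
  simp only [smul_smul, h, one_smul]

/-- The zero upper block is assumption (A2). It makes this coupling of order ε, as the rescaling of
the residual requires; X₁ times a nonzero block would be of order 1. -/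
theorem slowFast_mul_fromRows {ι κ ρ : Type*} [Fintype ι] [Fintype κ] (ε : ℝ)
    (X₁ : Matrix ι ι ℝ) (X₂ : Matrix ι κ ℝ)
    (X₄ : Matrix κ κ ℝ) (N : Matrix κ ρ ℝ) :
    slowFast ε X₁ X₂ X₄ * Matrix.fromRows (0 : Matrix ι ρ ℝ) N =
      ε • Matrix.fromRows (X₂ * N) (X₄ * N) := by
  rw [slowFast, Matrix.fromBlocks_mul_fromRows]
  ext i j
  cases i <;> simp

/-- Entrywise derivative of a block matrix. -/
theorem matHasDerivWithinAt_fromBlocks {α₁ α₂ β₁ β₂ : Type*} {P : ℝ → Matrix α₁ β₁ ℝ}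
    {Q : ℝ → Matrix α₁ β₂ ℝ} {R : ℝ → Matrix α₂ β₁ ℝ} {S : ℝ → Matrix α₂ β₂ ℝ}
    {P' : Matrix α₁ β₁ ℝ} {Q' : Matrix α₁ β₂ ℝ} {R' : Matrix α₂ β₁ ℝ} {S' : Matrix α₂ β₂ ℝ}
    {s : Set ℝ} {t : ℝ} (hP : MatHasDerivWithinAt P P' s t) (hQ : MatHasDerivWithinAt Q Q' s t)
    (hR : MatHasDerivWithinAt R R' s t) (hS : MatHasDerivWithinAt S S' s t) :
    MatHasDerivWithinAt (fun r => Matrix.fromBlocks (P r) (Q r) (R r) (S r))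
      (Matrix.fromBlocks P' Q' R' S') s t := by
  rintro (i | i) (j | j)
  exacts [hP i j, hQ i j, hR i j, hS i j]

theorem _root_.MatHasDerivWithinAt.const_smul {α β : Type*} {P : ℝ → Matrix α β ℝ}
    {P' : Matrix α β ℝ} {s : Set ℝ} {t : ℝ} (hP : MatHasDerivWithinAt P P' s t) (c : ℝ) :
    MatHasDerivWithinAt (fun r => c • P r) (c • P') s t := fun i j => (hP i j).const_mul c

/-- The residual of the supersolution on the slow and the weighted fast variables. -/
def residualSlowFast (A S D H Y Y' : Matrix ι ι ℝ) : Matrix ι ι ℝ :=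
  -(Y * A) - Aᵀ * Y + H - Y * S * Y - D - Y'

/-- The rescaled coupling of the residual to the unweighted fast variables. -/
def residualCoupling (ε ν : ℝ) (Y : Matrix ι ι ℝ) (H S : Matrix ι ρ ℝ) (A : Matrix ρ ι ℝ) :
    Matrix ι ρ ℝ :=
  -(ν • H) - ε • Aᵀ - ε • (Y * S)

/-- The rescaled residual on the unweighted fast variables. -/
def residualFast {ρ : Type*} [DecidableEq ρ] (ε ν : ℝ) (A S : Matrix ρ ρ ℝ) : Matrix ρ ρ ℝ :=
  -(ν • (A + Aᵀ)) + 1 - ε ^ 2 • S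

theorem continuous_slowFast {T μ₁ μ₂ : Type*} [TopologicalSpace T] {f : T → ℝ}
    {X₁ : T → Matrix μ₁ μ₁ ℝ} {X₂ : T → Matrix μ₁ μ₂ ℝ} {X₄ : T → Matrix μ₂ μ₂ ℝ}
    (hf : Continuous f) (h₁ : Continuous X₁) (h₂ : Continuous X₂) (h₄ : Continuous X₄) :
    Continuous fun t => slowFast (f t) (X₁ t) (X₂ t) (X₄ t) := by
  simp only [slowFast]
  fun_prop

/-- The relations X₁a₂ = X₂X₄ and X₄² = L + β are designed so that, at ε = 0, the off-diagonal
blocks cancel and the fast block reduces to β. -/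
theorem residualSlowFast_zero {A₁ S₁ D₁ X₁ X₁' : Matrix ι ι ℝ} {a₂ X₂ X₂' S₂ : Matrix ι κ ℝ}
    {A₃ S₃ : Matrix κ ι ℝ} {A₄ L X₄ X₄' S₄ : Matrix κ κ ℝ} {β : ℝ} (h₁ : X₁.IsSymm)
    (h₄ : X₄.IsSymm) (h₁₂ : X₁ * a₂ = X₂ * X₄) (h₄₄ : X₄ * X₄ = L + β • 1) :
    residualSlowFast (Matrix.fromBlocks A₁ a₂ A₃ A₄) (Matrix.fromBlocks S₁ S₂ S₃ S₄)
        (Matrix.fromBlocks D₁ 0 0 L)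
        (Matrix.fromBlocks (X₂ * X₂ᵀ) (X₂ * X₄) (X₄ * X₂ᵀ) (X₄ * X₄))
        (slowFast 0 X₁ X₂ X₄) (slowFast 0 X₁' X₂' X₄') =
      Matrix.fromBlocks (-(X₁ * A₁) - A₁ᵀ * X₁ + X₂ * X₂ᵀ - X₁ * S₁ * X₁ - D₁ - X₁') 0 0
        (β • 1) := by
  have h2 : a₂ᵀ * X₁ = X₄ * X₂ᵀ := by
    have := congrArg Matrix.transpose h₁₂
    rwa [Matrix.transpose_mul, Matrix.transpose_mul, h₁.eq, h₄.eq] at this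
  simp only [residualSlowFast, slowFast, zero_smul, Matrix.fromBlocks_multiply,
    Matrix.fromBlocks_transpose, Matrix.mul_zero, Matrix.zero_mul, add_zero, h₁₂, h2, h₄₄,
    sub_eq_add_neg, Matrix.fromBlocks_neg, Matrix.fromBlocks_add, neg_zero, zero_add]
  congr 1 <;> abel

theorem exists_quadForm_pos {T : Type*} [TopologicalSpace T] [CompactSpace T]
    {R : (ℝ × ℝ) × T → Matrix ι ι ℝ} (hR : Continuous R)
    (hpos : ∀ t, ∀ w, w ≠ 0 → 0 < w ⬝ᵥ (R ((0, 0), t) *ᵥ w)) :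
    ∃ η : ℝ, 0 < η ∧ ∀ ε ν, |ε| < η → |ν| < η → ∀ t, ∀ w, w ≠ 0 →
      0 < w ⬝ᵥ (R ((ε, ν), t) *ᵥ w) := by
  obtain ⟨η, hη, hηpos⟩ := Metric.eventually_nhds_iff.1
    (eventually_quadForm_pos (R := fun q t => R (q, t)) hR hpos)
  refine ⟨η, hη, fun ε ν hε hν => hηpos (y := (ε, ν)) ?_⟩
  rw [Prod.dist_eq, max_lt_iff, Real.dist_eq, Real.dist_eq, sub_zero, sub_zero]
  exact ⟨hε, hν⟩

/-- The rescaled residual of the supersolution is positive definite for small parameters. -/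
theorem exists_residual_pos [DecidableEq ι] {T : Type*} [TopologicalSpace T] [CompactSpace T]
    {A₁ S₁ D₁ X₁ X₁' : T → Matrix ι ι ℝ} {a₂ X₂ X₂' S₂ : T → Matrix ι κ ℝ}
    {A₃ S₃ : T → Matrix κ ι ℝ} {A₄ L X₄ X₄' S₄ : T → Matrix κ κ ℝ} {N : T → Matrix κ ρ ℝ}
    {Ac : T → Matrix ρ (ι ⊕ κ) ℝ} {Ad Sd : T → Matrix ρ ρ ℝ} {Sb : T → Matrix (ι ⊕ κ) ρ ℝ} {β : ℝ}
    (hβ : 0 < β) (hA₁ : Continuous A₁) (ha₂ : Continuous a₂) (hA₃ : Continuous A₃)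
    (hA₄ : Continuous A₄) (hN : Continuous N) (hAc : Continuous Ac) (hAd : Continuous Ad)
    (hS₁ : Continuous S₁) (hS₂ : Continuous S₂) (hS₃ : Continuous S₃) (hS₄ : Continuous S₄)
    (hSb : Continuous Sb) (hSd : Continuous Sd) (hD₁ : Continuous D₁) (hL : Continuous L)
    (hX₁ : Continuous X₁) (hX₂ : Continuous X₂) (hX₄ : Continuous X₄)
    (hX₁' : Continuous X₁') (hX₂' : Continuous X₂') (hX₄' : Continuous X₄')
    (hX₁s : ∀ t, (X₁ t).IsSymm) (hX₄s : ∀ t, (X₄ t).IsSymm)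
    (h₁₂ : ∀ t, X₁ t * a₂ t = X₂ t * X₄ t) (h₄₄ : ∀ t, X₄ t * X₄ t = L t + β • 1)
    (hpos : ∀ t, ∀ w, w ≠ 0 → 0 < w ⬝ᵥ ((-(X₁ t * A₁ t) - (A₁ t)ᵀ * X₁ t + X₂ t * (X₂ t)ᵀ -
        X₁ t * S₁ t * X₁ t - D₁ t - X₁' t) *ᵥ w)) :
    ∃ η : ℝ, 0 < η ∧ ∀ ε ν, |ε| < η → |ν| < η → ∀ t, ∀ w, w ≠ 0 → 0 < w ⬝ᵥ (Matrix.fromBlocks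
      (residualSlowFast (Matrix.fromBlocks (A₁ t) (a₂ t) (A₃ t) (A₄ t))
        (Matrix.fromBlocks (S₁ t) (S₂ t) (S₃ t) (S₄ t)) (Matrix.fromBlocks (D₁ t) 0 0 (L t))
        (Matrix.fromBlocks (X₂ t * (X₂ t)ᵀ) (X₂ t * X₄ t) (X₄ t * (X₂ t)ᵀ) (X₄ t * X₄ t))
        (slowFast ε (X₁ t) (X₂ t) (X₄ t)) (slowFast ε (X₁' t) (X₂' t) (X₄' t)))
      (residualCoupling ε ν (slowFast ε (X₁ t) (X₂ t) (X₄ t))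
        (Matrix.fromRows (X₂ t * N t) (X₄ t * N t)) (Sb t) (Ac t))
      (residualCoupling ε ν (slowFast ε (X₁ t) (X₂ t) (X₄ t))
        (Matrix.fromRows (X₂ t * N t) (X₄ t * N t)) (Sb t) (Ac t))ᵀ
      (residualFast ε ν (Ad t) (Sd t)) *ᵥ w) := by
  have hY : Continuous fun q : (ℝ × ℝ) × T => slowFast q.1.1 (X₁ q.2) (X₂ q.2) (X₄ q.2) :=
    continuous_slowFast (by fun_prop) (by fun_prop) (by fun_prop) (by fun_prop)
  have hY' : Continuous fun q : (ℝ × ℝ) × T => slowFast q.1.1 (X₁' q.2) (X₂' q.2) (X₄' q.2) :=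
    continuous_slowFast (by fun_prop) (by fun_prop) (by fun_prop) (by fun_prop)
  have hHN : Continuous fun q : (ℝ × ℝ) × T =>
      Matrix.fromRows (X₂ q.2 * N q.2) (X₄ q.2 * N q.2) :=
    continuous_fromRows (by fun_prop) (by fun_prop)
  have hV : Continuous fun q : (ℝ × ℝ) × T => residualCoupling q.1.1 q.1.2
      (slowFast q.1.1 (X₁ q.2) (X₂ q.2) (X₄ q.2))
      (Matrix.fromRows (X₂ q.2 * N q.2) (X₄ q.2 * N q.2)) (Sb q.2) (Ac q.2) :=
    (((by fun_prop : Continuous fun q : (ℝ × ℝ) × T => q.1.2).smul hHN).neg.sub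
      (by fun_prop)).sub ((by fun_prop : Continuous fun q : (ℝ × ℝ) × T => q.1.1).smul
      (hY.matrix_mul (by fun_prop)))
  have hW : Continuous fun q : (ℝ × ℝ) × T => residualFast q.1.1 q.1.2 (Ad q.2) (Sd q.2) := by
    simp only [residualFast]
    fun_prop
  have hA : Continuous fun q : (ℝ × ℝ) × T =>
      Matrix.fromBlocks (A₁ q.2) (a₂ q.2) (A₃ q.2) (A₄ q.2) := by fun_prop
  have hS : Continuous fun q : (ℝ × ℝ) × T =>
      Matrix.fromBlocks (S₁ q.2) (S₂ q.2) (S₃ q.2) (S₄ q.2) := by fun_prop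
  have hU : Continuous fun q : (ℝ × ℝ) × T =>
      residualSlowFast (Matrix.fromBlocks (A₁ q.2) (a₂ q.2) (A₃ q.2) (A₄ q.2))
        (Matrix.fromBlocks (S₁ q.2) (S₂ q.2) (S₃ q.2) (S₄ q.2))
        (Matrix.fromBlocks (D₁ q.2) 0 0 (L q.2))
        (Matrix.fromBlocks (X₂ q.2 * (X₂ q.2)ᵀ) (X₂ q.2 * X₄ q.2) (X₄ q.2 * (X₂ q.2)ᵀ)
          (X₄ q.2 * X₄ q.2))
        (slowFast q.1.1 (X₁ q.2) (X₂ q.2) (X₄ q.2))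
        (slowFast q.1.1 (X₁' q.2) (X₂' q.2) (X₄' q.2)) :=
    ((((((hY.matrix_mul hA).neg.sub (hA.matrix_transpose.matrix_mul hY)).add
      (by fun_prop)).sub ((hY.matrix_mul hS).matrix_mul hY)).sub (by fun_prop)).sub hY')
  have hR := hU.matrix_fromBlocks hV hV.matrix_transpose hW
  -- At ε = ν = 0 the rescaled residual is block diagonal with three positive definite blocks: the
  -- strict reduced residual, β·1 and 1.
  have h0 := exists_quadForm_pos hR fun t => by
    have h1 : residualCoupling 0 0 (slowFast 0 (X₁ t) (X₂ t) (X₄ t))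
        (Matrix.fromRows (X₂ t * N t) (X₄ t * N t)) (Sb t) (Ac t) = 0 := by
      simp [residualCoupling]
    have h2 : residualFast 0 0 (Ad t) (Sd t) = 1 := by simp [residualFast]
    simp only [h1, h2, Matrix.transpose_zero,
      residualSlowFast_zero (hX₁s t) (hX₄s t) (h₁₂ t) (h₄₄ t)]
    exact quadForm_fromBlocks_diagonal_pos (quadForm_fromBlocks_diagonal_pos (hpos t)
      (quadForm_smul_one_pos hβ)) fun w hw => quadForm_one_pos hw
  exact h0

/-- A family of supersolutions of the full Riccati equation with the right order in `ε`. -/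
theorem exists_scaled_supersolution [DecidableEq ι] {a b : ℝ} (hab : a < b)
    {A₁ S₁ D₁ K : ℝ → Matrix ι ι ℝ} {a₂ : ℝ → Matrix ι κ ℝ} {A₃ : ℝ → Matrix κ ι ℝ}
    {A₄ : ℝ → Matrix κ κ ℝ} {lam : ℝ → κ → ℝ} {N : ℝ → Matrix κ ρ ℝ}
    {Ac : ℝ → Matrix ρ (ι ⊕ κ) ℝ} {Ad Sd : ℝ → Matrix ρ ρ ℝ} {Sb : ℝ → Matrix (ι ⊕ κ) ρ ℝ}
    {S₂ : ℝ → Matrix ι κ ℝ} {S₃ : ℝ → Matrix κ ι ℝ} {S₄ : ℝ → Matrix κ κ ℝ}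
    (hA₁ : MatContOn A₁ (Icc a b)) (hA₃ : MatContOn A₃ (Icc a b)) (hA₄ : MatContOn A₄ (Icc a b))
    (hN : MatContOn N (Icc a b)) (hAc : MatContOn Ac (Icc a b)) (hAd : MatContOn Ad (Icc a b))
    (hS₁ : MatContOn S₁ (Icc a b)) (hS₂ : MatContOn S₂ (Icc a b)) (hS₃ : MatContOn S₃ (Icc a b))
    (hS₄ : MatContOn S₄ (Icc a b)) (hSb : MatContOn Sb (Icc a b)) (hSd : MatContOn Sd (Icc a b))
    (hD₁ : MatContOn D₁ (Icc a b)) (ha₂ : MatC1On a₂ (Icc a b))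
    (hlam : ∀ p, ContDiffOn ℝ 1 (fun t => lam t p) (Icc a b))
    (hlam0 : ∀ t ∈ Icc a b, ∀ p, 0 < lam t p)
    (hK : ∀ t ∈ Icc a b, MatHasDerivWithinAt K (riccati (A₁ t)
      (a₂ t * (Matrix.diagonal (lam t))⁻¹ * (a₂ t)ᵀ - S₁ t) (D₁ t) (K t)) (Icc a b) t)
    (hKs : ∀ t ∈ Icc a b, (K t).IsSymm) :
    ∃ ε₀ c : ℝ, 0 < ε₀ ∧ 0 ≤ c ∧ ∀ ε ∈ Ioc 0 ε₀, ∃ X X' : ℝ → Matrix ((ι ⊕ κ) ⊕ ρ) ((ι ⊕ κ) ⊕ ρ) ℝ,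
      (∀ t ∈ Icc a b, MatHasDerivWithinAt X (X' t) (Icc a b) t) ∧
      (∀ t ∈ Icc a b, (X t).IsSymm) ∧
      (∀ t ∈ Icc a b, QuadNonneg (riccati
        (Matrix.fromBlocks (Matrix.fromBlocks (A₁ t) (a₂ t) (A₃ t) (A₄ t)) (Matrix.fromRows 0 (N t))
          (Ac t) (Ad t))
        ((ε ^ 2)⁻¹ • Matrix.fromBlocks (Matrix.fromBlocks 0 0 0 1) 0 0 1 -
          Matrix.fromBlocks (Matrix.fromBlocks (S₁ t) (S₂ t) (S₃ t) (S₄ t)) (Sb t) (Sb t)ᵀ (Sd t))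
        (Matrix.fromBlocks (Matrix.fromBlocks (D₁ t) 0 0 (Matrix.diagonal (lam t))) 0 0 0)
        (X t) - X' t)) ∧
      QuadNonneg (X b - Matrix.fromBlocks (Matrix.fromBlocks (K b) 0 0 0) 0 0 0) ∧
      ∀ t ∈ Icc a b, (∀ i, X t (Sum.inl (Sum.inl i)) (Sum.inl (Sum.inl i)) ≤ c) ∧
        (∀ i, X t (Sum.inl (Sum.inr i)) (Sum.inl (Sum.inr i)) ≤ c * ε) ∧
        ∀ i, X t (Sum.inr i) (Sum.inr i) ≤ c * ε ^ 2 := by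
  obtain ⟨X₁, X₁', X₂, X₂', X₄', r, δ, β, hδ, hβ, hX₁'c, hX₂'c, hX₄'c, hX₁, hX₂, hX₄, hX₁s, hX₁b,
    hr, hX₁₂, hX₄sq, hpos⟩ :=
    exists_leading_order_supersolution hab hA₁ hS₁ hD₁ ha₂ hlam hlam0 hK hKs
  set X₄ : ℝ → Matrix κ κ ℝ := fun t => Matrix.diagonal (r t) with hX₄def
  have hX₄s : ∀ t, (X₄ t).IsSymm := fun t => Matrix.diagonal_transpose _
  have hlamr : MatContOn (fun t => Matrix.diagonal (lam t)) (Icc a b) :=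
    matContOn_iff.2 <| continuousOn_iff_continuous_domRestrict.2 <|
      Continuous.matrix_diagonal (continuous_pi fun p =>
        continuousOn_iff_continuous_domRestrict.1 (hlam p).continuousOn)
  have ha₂c : MatContOn a₂ (Icc a b) := fun i j => (ha₂ i j).continuousOn
  obtain ⟨η, hη, hηpos⟩ := exists_residual_pos (T := Icc a b) hβ hA₁.continuous_restrict
    ha₂c.continuous_restrict hA₃.continuous_restrict hA₄.continuous_restrict
    hN.continuous_restrict hAc.continuous_restrict hAd.continuous_restrict
    hS₁.continuous_restrict hS₂.continuous_restrict hS₃.continuous_restrict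
    hS₄.continuous_restrict hSb.continuous_restrict hSd.continuous_restrict
    hD₁.continuous_restrict hlamr.continuous_restrict
    (matContOn_of_hasDerivWithinAt hX₁).continuous_restrict
    (matContOn_of_hasDerivWithinAt hX₂).continuous_restrict
    (matContOn_of_hasDerivWithinAt hX₄).continuous_restrict
    hX₁'c.continuous_restrict hX₂'c.continuous_restrict hX₄'c.continuous_restrict
    (fun t => hX₁s t t.2) (fun t => hX₄s t) (fun t => hX₁₂ t t.2) (fun t => hX₄sq t t.2)
    (fun t => hpos t t.2)
  let Y : ℝ → ℝ → Matrix (ι ⊕ κ) (ι ⊕ κ) ℝ := fun ε t => slowFast ε (X₁ t) (X₂ t) (X₄ t)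
  let Y' : ℝ → ℝ → Matrix (ι ⊕ κ) (ι ⊕ κ) ℝ := fun ε t => slowFast ε (X₁' t) (X₂' t) (X₄' t)
  have hbT := right_mem_Icc.2 hab.le
  -- At the terminal time congruence by diag(1, √ε) turns the difference into blocks δ·1, √ε X₂ and
  -- X₄. The strict gap δ absorbs the coupling for small √ε.
  obtain ⟨θ, hθ, hθpos⟩ := Metric.eventually_nhds_iff.1
    (eventually_quadForm_pos (T := Unit) (p₀ := (0 : ℝ))
      (R := fun s _ => Matrix.fromBlocks (δ • (1 : Matrix ι ι ℝ)) (s • X₂ b) (s • X₂ b)ᵀ (X₄ b))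
      (by fun_prop) fun _ => by
        rw [zero_smul, Matrix.transpose_zero]
        exact quadForm_fromBlocks_diagonal_pos (quadForm_smul_one_pos hδ)
          (quadForm_diagonal_pos (hr b hbT)))
  obtain ⟨c₁, hc₁0, hc₁⟩ := (matContOn_of_hasDerivWithinAt hX₁).exists_entriesLe
  obtain ⟨c₄, hc₄0, hc₄⟩ := (matContOn_of_hasDerivWithinAt hX₄).exists_entriesLe
  -- The last block of the supersolution is ε²k·1, and ν = k⁻¹ = η/2 lies in the range where the
  -- residual is positive. A large k is needed because the coupling does not vanish with ε alone.
  set k : ℝ := (η / 2)⁻¹ with hk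
  have hk0 : 0 < k := by positivity
  -- The first bound gives ε < η and the second √ε < θ.
  refine ⟨min (η / 2) ((θ / 2) ^ 2), c₁ + c₄ + k, by positivity, by positivity, fun ε hε => ?_⟩
  have hε0 : 0 < ε := hε.1
  have hεη : ε ≤ η / 2 := hε.2.trans (min_le_left _ _)
  have hεθ : ε ≤ (θ / 2) ^ 2 := hε.2.trans (min_le_right _ _)
  refine ⟨fun t => Matrix.fromBlocks (Y ε t) 0 0 ((ε ^ 2 * k) • 1),
    fun t => Matrix.fromBlocks (Y' ε t) 0 0 0, fun t ht => ?_, fun t ht => ?_, fun t ht => ?_, ?_,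
    fun t ht => ⟨fun i => ?_, fun i => ?_, fun i => ?_⟩⟩
  · refine matHasDerivWithinAt_fromBlocks ?_ (fun i j => hasDerivWithinAt_const _ _ _)
      (fun i j => hasDerivWithinAt_const _ _ _) (fun i j => hasDerivWithinAt_const _ _ _)
    exact matHasDerivWithinAt_fromBlocks (hX₁ t ht) ((hX₂ t ht).const_smul ε)
      ((hX₂ t ht).transpose.const_smul ε) ((hX₄ t ht).const_smul ε)
  · rw [Matrix.IsSymm, Matrix.fromBlocks_transpose, (slowFast_isSymm (hX₁s t ht) (hX₄s t)).eq]
    simp [Y]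
  · beta_reduce
    rw [riccati_fromBlocks_sub _ _ _ _ _ _ _ _ _ _ _ _ _ (slowFast_isSymm (hX₁s t ht) (hX₄s t))]
    have hkη : |k⁻¹| < η := by
      rw [abs_of_pos (inv_pos.2 hk0), hk, inv_inv]
      linarith
    have hεη' : |ε| < η := by
      rw [abs_of_pos hε0]
      linarith
    -- The actual coupling is εk times the rescaled one, and the last diagonal block is (εk)² times
    -- the rescaled one, so congruence by diag(1, εk) recovers the residual.
    have h1 := quadNonneg_fromBlocks_smul (ε * k) (hηpos ε k⁻¹ hεη' hkη ⟨t, ht⟩)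
    have hkk : k * k⁻¹ = 1 := mul_inv_cancel₀ hk0.ne'
    have hV : (ε * k) • residualCoupling ε k⁻¹ (Y ε t)
        (Matrix.fromRows (X₂ t * N t) (X₄ t * N t)) (Sb t) (Ac t) =
        -(Y ε t * Matrix.fromRows (0 : Matrix ι ρ ℝ) (N t)) - (ε ^ 2 * k) • (Ac t)ᵀ -
          (ε ^ 2 * k) • (Y ε t * Sb t) := by
      simp only [Y, residualCoupling, slowFast_mul_fromRows, smul_sub, smul_neg, smul_smul]
      rw [mul_assoc, hkk, mul_one, mul_comm (ε * k) ε, ← mul_assoc, ← sq]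
    have hW : (ε * k) ^ 2 • residualFast ε k⁻¹ (Ad t) (Sd t) =
        -((ε ^ 2 * k) • (Ad t + (Ad t)ᵀ)) + ((ε ^ 2 * k) ^ 2 * (ε ^ 2)⁻¹) • 1 -
          (ε ^ 2 * k) ^ 2 • Sd t := by
      simp only [residualFast, smul_sub, smul_neg, smul_smul, smul_add]
      rw [show (ε * k) ^ 2 * k⁻¹ = ε ^ 2 * k by field_simp,
        show (ε * k) ^ 2 * ε ^ 2 = (ε ^ 2 * k) ^ 2 by ring,
        show (ε ^ 2 * k) ^ 2 * (ε ^ 2)⁻¹ = (ε * k) ^ 2 by field_simp]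
    rw [← Matrix.transpose_smul, hV, hW] at h1
    convert h1 using 2
    simp only [riccati, residualSlowFast, Matrix.mul_sub, Matrix.sub_mul,
      slowFast_mul_proj_mul (X₁ t) (X₂ t) (X₄ t) hε0.ne']
    abel
  · have hs : dist (√ε) 0 < θ := by
      rw [Real.dist_eq, sub_zero, abs_of_nonneg (Real.sqrt_nonneg _)]
      exact ((Real.sqrt_le_sqrt hεθ).trans_eq (Real.sqrt_sq (by positivity))).trans_lt
        (by linarith)
    have h1 := quadNonneg_fromBlocks_smul (√ε) (hθpos hs ())
    have h2 : Matrix.fromBlocks (Y ε b) 0 0 ((ε ^ 2 * k) • (1 : Matrix ρ ρ ℝ)) -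
        Matrix.fromBlocks (Matrix.fromBlocks (K b) 0 0 0) 0 0 0 =
        Matrix.fromBlocks (Matrix.fromBlocks (δ • (1 : Matrix ι ι ℝ)) (√ε • √ε • X₂ b)
          (√ε • (√ε • X₂ b)ᵀ) (√ε ^ 2 • X₄ b)) 0 0 ((ε ^ 2 * k) • (1 : Matrix ρ ρ ℝ)) := by
      simp only [Y, slowFast, sub_eq_add_neg, Matrix.fromBlocks_neg, Matrix.fromBlocks_add,
        neg_zero, add_zero, ← hX₁b, Matrix.transpose_smul, smul_smul, Real.mul_self_sqrt hε0.le,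
        Real.sq_sqrt hε0.le]
    beta_reduce
    rw [h2]
    intro w
    rw [quadForm_fromBlocks]
    simp only [Matrix.zero_mulVec, dotProduct_zero, add_zero, zero_add]
    refine add_nonneg (h1 _) ?_
    by_cases hw : w ∘ Sum.inr = 0
    · simp [hw]
    · exact (quadForm_smul_one_pos (by positivity) _ hw).le
  · have := (le_abs_self _).trans (hc₁ t ht i i)
    simp only [Y, slowFast, Matrix.fromBlocks_apply₁₁]
    linarith
  · have := (le_abs_self _).trans (hc₄ t ht i i)
    simp only [Y, slowFast, Matrix.fromBlocks_apply₁₁, Matrix.fromBlocks_apply₂₂, Matrix.smul_apply,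
      smul_eq_mul]
    nlinarith
  · simp only [Matrix.fromBlocks_apply₂₂, Matrix.smul_apply, Matrix.one_apply_eq, smul_eq_mul]
    nlinarith [sq_nonneg ε, mul_nonneg (sq_nonneg ε) (add_nonneg hc₁0 hc₄0)]

end Supersolution

end CheapGame

/-! ### The coefficients of the game, and solvability with weighted bounds. -/

theorem MatContOn.matrix_inv {κ : Type*} [Fintype κ] [DecidableEq κ] {M : ℝ → Matrix κ κ ℝ}
    {s : Set ℝ} (hM : MatContOn M s) (hdet : ∀ t ∈ s, (M t).det ≠ 0) :
    MatContOn (fun t => (M t)⁻¹) s := by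
  have h := hM.continuous_restrict
  have h1 : Continuous fun t : s => (M t)⁻¹ := by
    simp only [Matrix.inv_def, Ring.inverse_eq_inv']
    exact (h.matrix_det.inv₀ fun t => hdet t t.2).smul h.matrix_adjugate
  exact matContOn_iff.2 (continuousOn_iff_continuous_domRestrict.2 h1)

theorem MatContOn.submatrix {α β γ δ : Type*} {M : ℝ → Matrix α β ℝ} {s : Set ℝ}
    (hM : MatContOn M s) (e : γ → α) (f : δ → β) : MatContOn (fun t => (M t).submatrix e f) s :=
  fun i j => hM (e i) (f j)

namespace CheapGame

section BlockFunctions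

variable {α₁ α₂ β₁ β₂ : Type*} {s : Set ℝ}

theorem matContOn_fromBlocks {P : ℝ → Matrix α₁ β₁ ℝ} {Q : ℝ → Matrix α₁ β₂ ℝ}
    {R : ℝ → Matrix α₂ β₁ ℝ} {S : ℝ → Matrix α₂ β₂ ℝ} (hP : MatContOn P s) (hQ : MatContOn Q s)
    (hR : MatContOn R s) (hS : MatContOn S s) :
    MatContOn (fun t => Matrix.fromBlocks (P t) (Q t) (R t) (S t)) s := by
  rintro (i | i) (j | j)
  exacts [hP i j, hQ i j, hR i j, hS i j]

theorem matContOn_fromRows {P : ℝ → Matrix α₁ β₁ ℝ} {R : ℝ → Matrix α₂ β₁ ℝ} (hP : MatContOn P s)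
    (hR : MatContOn R s) : MatContOn (fun t => Matrix.fromRows (P t) (R t)) s := by
  rintro (i | i) j
  exacts [hP i j, hR i j]

end BlockFunctions

variable {n m₁ m₂ l : ℕ}

namespace Standing

variable {g : CheapGame n m₁ m₂ l}

theorem cont_A (hg : g.Standing) : MatContOn g.A (Icc 0 g.tf) :=
  matContOn_fromBlocks hg.cont_A₁ hg.cont_A₂ hg.cont_A₃ hg.cont_A₄

theorem cont_C (hg : g.Standing) : MatContOn g.C (Icc 0 g.tf) :=
  matContOn_fromRows hg.cont_C₁ hg.cont_C₂

theorem cont_D (hg : g.Standing) : MatContOn g.D (Icc 0 g.tf) :=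
  matContOn_fromBlocks hg.cont_D₁ (MatContOn.const 0) (MatContOn.const 0) hg.cont_D₂

theorem cont_G_inv (hg : g.Standing) : MatContOn (fun t => (g.G t)⁻¹) (Icc 0 g.tf) :=
  hg.cont_G.matrix_inv fun t ht => (hg.G_pd t ht).det_pos.ne'

theorem cont_Sv (hg : g.Standing) : MatContOn g.Sv (Icc 0 g.tf) :=
  (hg.cont_C.mul hg.cont_G_inv).mul hg.cont_C.transpose

theorem G_isSymm (hg : g.Standing) {t : ℝ} (ht : t ∈ Icc 0 g.tf) : (g.G t).IsSymm := by
  simpa [Matrix.IsHermitian, Matrix.IsSymm] using (hg.G_pd t ht).isHermitian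

theorem F₁_isSymm (hg : g.Standing) : g.F₁.IsSymm := by
  simpa [Matrix.IsHermitian, Matrix.IsSymm] using hg.F₁_psd.1

theorem D₁_isSymm (hg : g.Standing) {t : ℝ} (ht : t ∈ Icc 0 g.tf) : (g.D₁ t).IsSymm := by
  simpa [Matrix.IsHermitian, Matrix.IsSymm] using (hg.D₁_psd t ht).1

theorem G_inv_isSymm (hg : g.Standing) {t : ℝ} (ht : t ∈ Icc 0 g.tf) : (g.G t)⁻¹.IsSymm := by
  rw [Matrix.IsSymm, Matrix.transpose_nonsing_inv, (hg.G_isSymm ht).eq]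

theorem Sv_isSymm (hg : g.Standing) {t : ℝ} (ht : t ∈ Icc 0 g.tf) : (g.Sv t).IsSymm := by
  rw [Matrix.IsSymm, Sv, Matrix.transpose_mul, Matrix.transpose_mul, Matrix.transpose_transpose,
    (hg.G_inv_isSymm ht).eq, Matrix.mul_assoc]

theorem F_isSymm (hg : g.Standing) : g.F.IsSymm := by
  simp [Matrix.IsSymm, F, Matrix.fromBlocks_transpose, hg.F₁_isSymm.eq]

theorem F_nonneg (hg : g.Standing) : QuadNonneg g.F := fun w => by
  rw [F, quadForm_fromBlocks]
  simpa using quadNonneg_of_posSemidef hg.F₁_psd (w ∘ Sum.inl)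

theorem D_isSymm (hg : g.Standing) {t : ℝ} (ht : t ∈ Icc 0 g.tf) : (g.D t).IsSymm := by
  simp [Matrix.IsSymm, D, D₂, Matrix.fromBlocks_transpose, (hg.D₁_isSymm ht).eq]

theorem D_nonneg (hg : g.Standing) {t : ℝ} (ht : t ∈ Icc 0 g.tf) : QuadNonneg (g.D t) :=
  fun w => by
    rw [D, quadForm_fromBlocks]
    have h1 := quadNonneg_of_posSemidef (hg.D₁_psd t ht) (w ∘ Sum.inl)
    have h2 : 0 ≤ (w ∘ Sum.inr) ⬝ᵥ (g.D₂ t *ᵥ (w ∘ Sum.inr)) := by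
      simp only [D₂, dotProduct, Matrix.mulVec_diagonal]
      refine Finset.sum_nonneg fun p _ => ?_
      have h3 : 0 ≤ g.lam t p := by
        rcases p with p | p
        · exact (hg.lam_pos t ht p).le
        · exact (hg.lam_zero t ht p).ge
      rw [mul_left_comm]
      exact mul_nonneg h3 (mul_self_nonneg _)
    simpa using add_nonneg h1 h2

end Standing

theorem Su_isSymm (ε : ℝ) : (Su n m₁ m₂ ε).IsSymm := by
  simp [Matrix.IsSymm, Su, Matrix.transpose_mul]

theorem Su_eq (ε : ℝ) : Su n m₁ m₂ ε = (ε ^ 2)⁻¹ • Matrix.fromBlocks 0 0 0 1 := by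
  rw [Su, B, Matrix.transpose_fromRows, Matrix.fromRows_mul_fromCols]
  simp

/-- The magnitude of the state coordinates in the solution of the Riccati problem. -/
def weight (ε : ℝ) : Idx n m₁ m₂ → ℝ := Sum.elim (fun _ => 1) (Sum.elim (fun _ => √ε) fun _ => ε)

/-- Grouping of the slow coordinates with the weighted fast ones. -/
def regroup (n m₁ m₂ : ℕ) : Idx n m₁ m₂ ≃ (Fin n ⊕ Fin m₁) ⊕ Fin m₂ :=
  (Equiv.sumAssoc (Fin n) (Fin m₁) (Fin m₂)).symm

@[simp] theorem regroup_inl (i : Fin n) : regroup n m₁ m₂ (Sum.inl i) = Sum.inl (Sum.inl i) := rfl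

@[simp] theorem regroup_inr_inl (i : Fin m₁) :
    regroup n m₁ m₂ (Sum.inr (Sum.inl i)) = Sum.inl (Sum.inr i) := rfl

@[simp] theorem regroup_inr_inr (i : Fin m₂) :
    regroup n m₁ m₂ (Sum.inr (Sum.inr i)) = Sum.inr i := rfl

theorem A_eq_regroup {g : CheapGame n m₁ m₂ l} {t : ℝ} (h : g.A₂r t = 0) :
    g.A t = (Matrix.fromBlocks
      (Matrix.fromBlocks (g.A₁ t) (g.A₂l t) (g.A₃ t).toRows₁ (g.A₄ t).toBlocks₁₁)
      (Matrix.fromRows 0 (g.A₄ t).toBlocks₁₂) (Matrix.fromCols (g.A₃ t).toRows₂ (g.A₄ t).toBlocks₂₁)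
      (g.A₄ t).toBlocks₂₂).submatrix (regroup n m₁ m₂) (regroup n m₁ m₂) := by
  have h' : ∀ i j, g.A₂ t i (Sum.inr j) = 0 := fun i j => congrFun (congrFun h i) j
  ext (i | i | i) (j | j | j) <;>
    simp [A, A₂l, Matrix.toRows₁, Matrix.toRows₂, Matrix.toCols₁, Matrix.toBlocks₁₁,
      Matrix.toBlocks₁₂, Matrix.toBlocks₂₁, Matrix.toBlocks₂₂, h']

theorem Sv_eq_regroup {g : CheapGame n m₁ m₂ l} {t : ℝ} (h : (g.Sv t).IsSymm) :
    g.Sv t = (Matrix.fromBlocks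
      (Matrix.fromBlocks (g.Sv₁ t)
        ((g.Sv t).submatrix Sum.inl fun p => Sum.inr (Sum.inl p))
        ((g.Sv t).submatrix (fun p => Sum.inr (Sum.inl p)) Sum.inl)
        ((g.Sv t).submatrix (fun p => Sum.inr (Sum.inl p)) fun p => Sum.inr (Sum.inl p)))
      ((g.Sv t).submatrix (Sum.elim Sum.inl fun p => Sum.inr (Sum.inl p))
        fun p => Sum.inr (Sum.inr p))
      ((g.Sv t).submatrix (Sum.elim Sum.inl fun p => Sum.inr (Sum.inl p))
        fun p => Sum.inr (Sum.inr p))ᵀ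
      ((g.Sv t).submatrix (fun p => Sum.inr (Sum.inr p)) fun p => Sum.inr (Sum.inr p))).submatrix
      (regroup n m₁ m₂) (regroup n m₁ m₂) := by
  ext (i | i | i) (j | j | j) <;> simp [Sv₁, Matrix.toBlocks₁₁, h.apply]

theorem Su_eq_regroup (ε : ℝ) : Su n m₁ m₂ ε =
    ((ε ^ 2)⁻¹ • Matrix.fromBlocks (Matrix.fromBlocks 0 0 0 1) 0 0 1).submatrix
      (regroup n m₁ m₂) (regroup n m₁ m₂) := by
  rw [Su_eq]
  ext (i | i | i) (j | j | j) <;> simp [Matrix.one_apply]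

theorem F_eq_regroup (g : CheapGame n m₁ m₂ l) : g.F =
    (Matrix.fromBlocks (Matrix.fromBlocks g.F₁ 0 0 0) 0 0 0).submatrix
      (regroup n m₁ m₂) (regroup n m₁ m₂) := by
  ext (i | i | i) (j | j | j) <;> simp [F]

theorem D_eq_regroup {g : CheapGame n m₁ m₂ l} (hg : g.Standing) {t : ℝ} (ht : t ∈ Icc 0 g.tf) :
    g.D t = (Matrix.fromBlocks (Matrix.fromBlocks (g.D₁ t) 0 0
      (Matrix.diagonal fun p => g.lam t (Sum.inl p))) 0 0 0).submatrix
      (regroup n m₁ m₂) (regroup n m₁ m₂) := by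
  ext (i | i | i) (j | j | j) <;>
    simp [D, D₂, Matrix.diagonal_apply, hg.lam_zero t ht]

/-- The solution lies between zero and the scaled supersolution, whose diagonal has orders 1, ε, ε².
These are the squares of the weights, so the entries are of order `weight` times `weight`. This is
sharp enough for all blocks except K₂ and K₅. -/
theorem exists_solution_weighted_bound {g : CheapGame n m₁ m₂ l} (hg : g.Standing)
    (hA2 : g.AssumptionA2) (hA3 : g.AssumptionA3) (hA4 : g.AssumptionA4) :
    ∃ ε₀ c : ℝ, 0 < ε₀ ∧ 0 ≤ c ∧ ∀ ε ∈ Ioc 0 ε₀, ∃ K, g.IsSymmSolution ε K ∧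
      ∀ t ∈ Icc 0 g.tf, ∀ i j, |K t i j| ≤ c * weight ε i * weight ε j := by
  obtain ⟨K₀, hK₀b, hK₀⟩ := hA4
  have hSv₁c : MatContOn g.Sv₁ (Icc 0 g.tf) := fun i j => hg.cont_Sv (Sum.inl i) (Sum.inl j)
  have ha₂ : MatC1On g.A₂l (Icc 0 g.tf) := fun i j => hA3.2.1 i (Sum.inl j)
  have ha₂c : MatContOn g.A₂l (Icc 0 g.tf) := fun i j => (ha₂ i j).continuousOn
  have hlam : ∀ p : Fin m₁, ContDiffOn ℝ 1 (fun t => g.lam t (Sum.inl p)) (Icc 0 g.tf) :=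
      fun p => by
    simpa [D₂] using hA3.2.2.2.2.2.2.2.1 (Sum.inl p) (Sum.inl p)
  have hLamc : MatContOn (fun t => (g.Lam t)⁻¹) (Icc 0 g.tf) := by
    refine MatContOn.matrix_inv (fun i j => ?_) fun t ht => ?_
    · by_cases hij : i = j
      · subst hij
        simpa [Lam] using (hlam i).continuousOn
      · simpa [Lam, Matrix.diagonal_apply_ne _ hij] using continuousOn_const
    · rw [Lam, Matrix.det_diagonal]
      exact Finset.prod_ne_zero_iff.2 fun p _ => (hg.lam_pos t ht p).ne'
  have hNc := ((ha₂c.mul hLamc).mul ha₂c.transpose).sub hSv₁c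
  -- (A4) does not ask for symmetry; it follows from uniqueness.
  have hK₀s := riccati_solution_isSymm (D := g.D₁) hg.cont_A₁ hNc
    (fun t ht => by
      have h1 : ((g.Lam t)⁻¹)ᵀ = (g.Lam t)⁻¹ := by
        rw [Matrix.transpose_nonsing_inv, Lam, Matrix.diagonal_transpose]
      have h2 : (g.Sv₁ t)ᵀ = g.Sv₁ t := by
        ext i j
        exact (hg.Sv_isSymm ht).apply _ _
      simp only [Matrix.IsSymm, Matrix.transpose_sub, Matrix.transpose_mul,
        Matrix.transpose_transpose, h1, h2, Matrix.mul_assoc])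
    (fun t ht => hg.D₁_isSymm ht) hK₀ (by rw [hK₀b]; exact hg.F₁_isSymm)
  obtain ⟨ε₀, c, hε₀, hc, H⟩ := exists_scaled_supersolution hg.tf_pos (A₁ := g.A₁) (S₁ := g.Sv₁)
    (D₁ := g.D₁) (K := K₀) (a₂ := g.A₂l) (A₃ := fun t => (g.A₃ t).toRows₁)
    (A₄ := fun t => (g.A₄ t).toBlocks₁₁) (lam := fun t p => g.lam t (Sum.inl p))
    (N := fun t => (g.A₄ t).toBlocks₁₂)
    (Ac := fun t => Matrix.fromCols (g.A₃ t).toRows₂ (g.A₄ t).toBlocks₂₁)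
    (Ad := fun t => (g.A₄ t).toBlocks₂₂)
    (Sd := fun t => (g.Sv t).submatrix (fun p => Sum.inr (Sum.inr p)) fun p => Sum.inr (Sum.inr p))
    (Sb := fun t => (g.Sv t).submatrix (Sum.elim Sum.inl fun p => Sum.inr (Sum.inl p))
      fun p => Sum.inr (Sum.inr p))
    (S₂ := fun t => (g.Sv t).submatrix Sum.inl fun p => Sum.inr (Sum.inl p))
    (S₃ := fun t => (g.Sv t).submatrix (fun p => Sum.inr (Sum.inl p)) Sum.inl)
    (S₄ := fun t => (g.Sv t).submatrix (fun p => Sum.inr (Sum.inl p)) fun p => Sum.inr (Sum.inl p))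
    hg.cont_A₁ (fun i j => hg.cont_A₃ (Sum.inl i) j)
    (fun i j => hg.cont_A₄ (Sum.inl i) (Sum.inl j)) (fun i j => hg.cont_A₄ (Sum.inl i) (Sum.inr j))
    (by
      rintro i (j | j)
      exacts [hg.cont_A₃ (Sum.inr i) j, hg.cont_A₄ (Sum.inr i) (Sum.inl j)])
    (fun i j => hg.cont_A₄ (Sum.inr i) (Sum.inr j)) hSv₁c (hg.cont_Sv.submatrix _ _)
    (hg.cont_Sv.submatrix _ _) (hg.cont_Sv.submatrix _ _) (hg.cont_Sv.submatrix _ _)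
    (hg.cont_Sv.submatrix _ _) hg.cont_D₁ ha₂ hlam hg.lam_pos hK₀ hK₀s
  refine ⟨ε₀, c, hε₀, hc, fun ε hε => ?_⟩
  obtain ⟨X, X', hX, hXs, hX', hXb, hXd⟩ := H ε hε
  set σ := regroup n m₁ m₂
  have hr : ∀ t ∈ Icc 0 g.tf, QuadNonneg (riccati (g.A t) (Su n m₁ m₂ ε - g.Sv t) (g.D t)
      ((X t).submatrix σ σ) - (X' t).submatrix σ σ) := fun t ht => by
    rw [A_eq_regroup (hA2 t ht), Sv_eq_regroup (hg.Sv_isSymm ht), Su_eq_regroup,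
      D_eq_regroup hg ht, ← Pi.sub_apply, ← Pi.sub_apply, ← Matrix.submatrix_sub,
      riccati_submatrix_equiv, ← Pi.sub_apply, ← Pi.sub_apply, ← Matrix.submatrix_sub]
    exact (hX' t ht).submatrix_equiv σ
  have hb : QuadNonneg ((X g.tf).submatrix σ σ - g.F) := by
    rw [F_eq_regroup, ← hK₀b, ← Pi.sub_apply, ← Pi.sub_apply, ← Matrix.submatrix_sub]
    exact hXb.submatrix_equiv σ
  obtain ⟨K, hKb, hK, hKp⟩ := exists_riccati_solution hg.tf_pos.le hg.cont_A
    ((MatContOn.const (Su n m₁ m₂ ε)).sub hg.cont_Sv) hg.cont_D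
    (fun t ht => (Su_isSymm ε).sub (hg.Sv_isSymm ht)) (fun t ht => hg.D_isSymm ht)
    (fun t ht => hg.D_nonneg ht) hg.F_isSymm hg.F_nonneg
    (Y := fun t => (X t).submatrix σ σ) (Y' := fun t => (X' t).submatrix σ σ)
    (fun t ht i j => hX t ht (σ i) (σ j)) (fun t ht => (hXs t ht).submatrix σ) hr hb
  refine ⟨K, ⟨⟨hKb, hK⟩, fun t ht => (hKp t ht).1⟩, fun t ht i j => ?_⟩
  have hdiag : ∀ i, K t i i ≤ c * weight ε i ^ 2 := fun i => by
    have h1 := (hKp t ht).2.2.diag_nonneg i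
    simp only [Matrix.sub_apply, Matrix.submatrix_apply] at h1
    have h2 : X t (σ i) (σ i) ≤ c * weight ε i ^ 2 := by
      rcases i with i | i | i
      · simpa [weight, σ] using (hXd t ht).1 i
      · simpa [weight, σ, Real.sq_sqrt hε.1.le] using (hXd t ht).2.1 i
      · simpa [weight, σ] using (hXd t ht).2.2 i
    linarith
  have hw : ∀ i : Idx n m₁ m₂, 0 ≤ weight ε i := fun i => by
    rcases i with i | i | i
    exacts [zero_le_one, Real.sqrt_nonneg _, hε.1.le]
  exact (hKp t ht).2.1.abs_le (hKp t ht).1 hc (hw i) (hw j) (hdiag i) (hdiag j)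

end CheapGame

/-! ### Estimates for the non-stiff terms. -/

namespace CheapGame

theorem abs_sum_le_card_mul {κ : Type*} [Fintype κ] {f : κ → ℝ} {x : ℝ} (h : ∀ k, |f k| ≤ x) :
    |∑ k, f k| ≤ Fintype.card κ * x :=
  (Finset.abs_sum_le_sum_abs _ _).trans
    ((Finset.sum_le_card_nsmul _ _ x fun k _ => h k).trans (by simp))

theorem quadForm_ge_of_entriesLe {κ : Type*} [Fintype κ] {E : Matrix κ κ ℝ} {q : ℝ}
    (hE : EntriesLe E q) (w : κ → ℝ) : -(Fintype.card κ * q * (w ⬝ᵥ w)) ≤ w ⬝ᵥ (E *ᵥ w) := by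
  have h1 : ∀ i j, -(q / 2 * (w i * w i) + q / 2 * (w j * w j)) ≤ w i * (E i j * w j) := by
    intro i j
    have h2 := abs_le.1 (hE i j)
    have hq := hE.nonneg i j
    have h3 : |w i * (E i j * w j)| ≤ q * (|w i| * |w j|) := by
      rw [abs_mul, abs_mul]
      nlinarith [mul_le_mul_of_nonneg_right (hE i j) (mul_nonneg (abs_nonneg (w i))
        (abs_nonneg (w j)))]
    have h4 : |w i| * |w j| ≤ (w i * w i + w j * w j) / 2 := by
      nlinarith [sq_nonneg (|w i| - |w j|), abs_mul_abs_self (w i), abs_mul_abs_self (w j)]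
    nlinarith [neg_abs_le (w i * (E i j * w j)), mul_le_mul_of_nonneg_left h4 hq]
  calc -(Fintype.card κ * q * (w ⬝ᵥ w))
      = ∑ i, ∑ j, -(q / 2 * (w i * w i) + q / 2 * (w j * w j)) := by
        have h2 : ∀ i, ∑ j, -(q / 2 * (w i * w i) + q / 2 * (w j * w j)) =
            -(Fintype.card κ * (q / 2) * (w i * w i) + q / 2 * (w ⬝ᵥ w)) := fun i => by
          rw [Finset.sum_neg_distrib, Finset.sum_add_distrib, Finset.sum_const, dotProduct,
            Finset.mul_sum, Finset.card_univ, nsmul_eq_mul, ← mul_assoc]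
        simp only [h2, Finset.sum_neg_distrib, Finset.sum_add_distrib, ← Finset.mul_sum]
        simp only [dotProduct, Finset.sum_const, Finset.card_univ, nsmul_eq_mul]
        ring
    _ ≤ ∑ i, ∑ j, w i * (E i j * w j) :=
        Finset.sum_le_sum fun i _ => Finset.sum_le_sum fun j _ => h1 i j
    _ = w ⬝ᵥ (E *ᵥ w) := by simp only [dotProduct, Matrix.mulVec, Finset.mul_sum]

variable {n m₁ m₂ l : ℕ}

/-- Index of a weighted fast coordinate. -/
abbrev fastIdx (p : Fin m₁) : Idx n m₁ m₂ := Sum.inr (Sum.inl p)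

/-- Index of an unweighted fast coordinate. -/
abbrev freeIdx (r : Fin m₂) : Idx n m₁ m₂ := Sum.inr (Sum.inr r)

/-- The terms of the Riccati equation which are not stiff. -/
def nonstiff (ε : ℝ) (A S K : Matrix (Idx n m₁ m₂) (Idx n m₁ m₂) ℝ) :
    Matrix (Idx n m₁ m₂) (Idx n m₁ m₂) ℝ :=
  K * A + Aᵀ * K + K * S * K -
    (ε ^ 2)⁻¹ • Matrix.of fun i j => ∑ r, K i (freeIdx r) * K (freeIdx r) j

/-- The term K S_u K is divided between the weighted and the unweighted fast coordinates. Only the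
former is kept apart as stiff: the latter is harmless under the weighted bounds. -/
theorem riccati_apply (ε : ℝ) (A S D K : Matrix (Idx n m₁ m₂) (Idx n m₁ m₂) ℝ)
    (i j : Idx n m₁ m₂) :
    riccati A (Su n m₁ m₂ ε - S) D K i j = -nonstiff ε A S K i j - D i j +
      (ε ^ 2)⁻¹ * ∑ q, K i (fastIdx q) * K (fastIdx q) j := by
  have h1 : K * Su n m₁ m₂ ε * K = (ε ^ 2)⁻¹ • ((K * B n m₁ m₂) * ((B n m₁ m₂)ᵀ * K)) := by
    simp only [Su, Matrix.mul_smul, Matrix.smul_mul, Matrix.mul_assoc]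
  have h2 : ∀ p, (K * B n m₁ m₂) i p = K i (Sum.inr p) := fun p => by
    simp [B, Matrix.mul_apply, Matrix.one_apply]
  have h3 : ∀ p, ((B n m₁ m₂)ᵀ * K) p j = K (Sum.inr p) j := fun p => by
    simp [B, Matrix.mul_apply, Matrix.one_apply]
  have h4 : (K * Su n m₁ m₂ ε * K) i j =
      (ε ^ 2)⁻¹ * (∑ q, K i (fastIdx q) * K (fastIdx q) j +
        ∑ r, K i (freeIdx r) * K (freeIdx r) j) := by
    rw [h1, Matrix.smul_apply, Matrix.mul_apply, smul_eq_mul, Fintype.sum_sum_type]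
    simp only [h2, h3]
  simp only [riccati, nonstiff, Matrix.mul_sub, Matrix.sub_mul, Matrix.sub_apply,
    Matrix.add_apply, Matrix.neg_apply, Matrix.smul_apply, Matrix.of_apply, smul_eq_mul, h4]
  ring

section Bounds

variable {ε a c s : ℝ} {A S K : Matrix (Idx n m₁ m₂) (Idx n m₁ m₂) ℝ}

theorem weight_nonneg (hε : 0 ≤ ε) (i : Idx n m₁ m₂) : 0 ≤ weight ε i := by
  rcases i with i | i | i
  exacts [zero_le_one, Real.sqrt_nonneg _, hε]

theorem weight_le_one (hε1 : ε ≤ 1) (i : Idx n m₁ m₂) : weight ε i ≤ 1 := by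
  rcases i with i | i | i
  exacts [le_rfl, Real.sqrt_le_one.2 hε1, hε1]

/-- A bound for the non-stiff terms. -/
def nonstiffBound (n m₁ m₂ : ℕ) (a c s : ℝ) : ℝ :=
  Fintype.card (Idx n m₁ m₂) * (c * a) +
    Fintype.card (Idx n m₁ m₂) * (Fintype.card (Idx n m₁ m₂) * (c * s) * c) +
    Fintype.card (Fin m₂) * (c * c)

theorem abs_mul_mul_le (hK : ∀ i j, |K i j| ≤ c * weight ε i * weight ε j) (hS : EntriesLe S s)
    (hε : 0 ≤ ε) (hε1 : ε ≤ 1) (hc : 0 ≤ c) (hs : 0 ≤ s) (i j : Idx n m₁ m₂) :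
    |(K * S * K) i j| ≤ Fintype.card (Idx n m₁ m₂) *
      (Fintype.card (Idx n m₁ m₂) * (c * s) * c) * (weight ε i * weight ε j) := by
  have hwi := weight_nonneg hε i
  have hwj := weight_nonneg hε j
  have h1 : ∀ k, |(K * S) i k| ≤ Fintype.card (Idx n m₁ m₂) * (c * s) * weight ε i := fun k => by
    rw [Matrix.mul_apply]
    refine (abs_sum_le_card_mul (x := c * weight ε i * s) fun q => ?_).trans (le_of_eq (by ring))
    rw [abs_mul]
    refine mul_le_mul ((hK i q).trans ?_) (hS q k) (abs_nonneg _) (by positivity)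
    exact mul_le_of_le_one_right (by positivity) (weight_le_one hε1 q)
  rw [Matrix.mul_apply]
  refine (abs_sum_le_card_mul (x := Fintype.card (Idx n m₁ m₂) * (c * s) * weight ε i *
    (c * weight ε j)) fun k => ?_).trans (le_of_eq (by ring))
  rw [abs_mul]
  refine mul_le_mul (h1 k) ((hK k j).trans ?_) (abs_nonneg _) (by positivity)
  rw [mul_right_comm]
  exact mul_le_of_le_one_right (by positivity) (weight_le_one hε1 k)

/-- Each of the two factors carries a weight ε from its unweighted index, which compensates ε⁻². -/
theorem abs_free_sum_le (hK : ∀ i j, |K i j| ≤ c * weight ε i * weight ε j)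
    (hε : 0 < ε) (hc : 0 ≤ c) (i j : Idx n m₁ m₂) :
    |(ε ^ 2)⁻¹ * ∑ r, K i (freeIdx r) * K (freeIdx r) j| ≤
      Fintype.card (Fin m₂) * (c * c) * (weight ε i * weight ε j) := by
  have hwi := weight_nonneg hε.le i
  have hwj := weight_nonneg hε.le j
  rw [abs_mul, abs_of_nonneg (by positivity)]
  have h1 : |∑ r : Fin m₂, K i (freeIdx r) * K (freeIdx r) j| ≤
      Fintype.card (Fin m₂) * ((c * weight ε i * ε) * (c * ε * weight ε j)) :=
    abs_sum_le_card_mul fun r => by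
      rw [abs_mul]
      exact mul_le_mul (hK i (freeIdx r)) (hK (freeIdx r) j) (abs_nonneg _) (by positivity)
  refine (mul_le_mul_of_nonneg_left h1 (by positivity)).trans (le_of_eq ?_)
  field_simp

theorem abs_mul_right_le (hK : ∀ i j, |K i j| ≤ c * weight ε i * weight ε j) (hA : EntriesLe A a)
    (hε : 0 ≤ ε) (hε1 : ε ≤ 1) (hc : 0 ≤ c) (i j : Idx n m₁ m₂) :
    |(K * A) i j| ≤ Fintype.card (Idx n m₁ m₂) * (c * a) * weight ε i := by
  have hwi := weight_nonneg hε i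
  rw [Matrix.mul_apply]
  refine (abs_sum_le_card_mul (x := c * weight ε i * a) fun q => ?_).trans (le_of_eq (by ring))
  rw [abs_mul]
  refine mul_le_mul ((hK i q).trans ?_) (hA q j) (abs_nonneg _) (by positivity)
  exact mul_le_of_le_one_right (by positivity) (weight_le_one hε1 q)

theorem abs_mul_left_le (hK : ∀ i j, |K i j| ≤ c * weight ε i * weight ε j) (hA : EntriesLe A a)
    (hε : 0 ≤ ε) (hε1 : ε ≤ 1) (hc : 0 ≤ c) (i j : Idx n m₁ m₂) :
    |(Aᵀ * K) i j| ≤ Fintype.card (Idx n m₁ m₂) * (c * a) * weight ε j := by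
  have hK' : ∀ i j, |Kᵀ i j| ≤ c * weight ε i * weight ε j := fun i j => by
    rw [mul_right_comm]
    exact hK j i
  have h := abs_mul_right_le hK' hA hε hε1 hc j i
  rwa [← Matrix.transpose_transpose A, ← Matrix.transpose_mul] at h

theorem abs_nonstiff_le (hK : ∀ i j, |K i j| ≤ c * weight ε i * weight ε j)
    (hA : EntriesLe A a) (hS : EntriesLe S s) (hε : 0 < ε) (hε1 : ε ≤ 1) (hc : 0 ≤ c)
    (hs : 0 ≤ s) (i j : Idx n m₁ m₂) :
    |nonstiff ε A S K i j| ≤ nonstiffBound n m₁ m₂ a c s * (weight ε i + weight ε j) := by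
  have hwi := weight_nonneg hε.le i
  have hwj := weight_nonneg hε.le j
  have h1 := abs_mul_right_le hK hA hε.le hε1 hc i j
  have h2 := abs_mul_left_le hK hA hε.le hε1 hc i j
  have h3 := abs_mul_mul_le hK hS hε.le hε1 hc hs i j
  have h4 := abs_free_sum_le hK hε hc i j
  have h5 : weight ε i * weight ε j ≤ weight ε i + weight ε j := by
    nlinarith [mul_le_of_le_one_right hwi (weight_le_one hε1 j)]
  have h6 : |nonstiff ε A S K i j| ≤ |(K * A) i j| + |(Aᵀ * K) i j| + |(K * S * K) i j| +
      |(ε ^ 2)⁻¹ * ∑ r, K i (freeIdx r) * K (freeIdx r) j| := by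
    simp only [nonstiff, Matrix.sub_apply, Matrix.add_apply, Matrix.smul_apply, Matrix.of_apply,
      smul_eq_mul]
    exact (abs_sub _ _).trans (by
      gcongr; exact (abs_add_le _ _).trans (by gcongr; exact abs_add_le _ _))
  have h7 := mul_le_mul_of_nonneg_left h5 (show 0 ≤ (Fintype.card (Idx n m₁ m₂) : ℝ) *
      (Fintype.card (Idx n m₁ m₂) * (c * s) * c) by positivity)
  have h8 := mul_le_mul_of_nonneg_left h5
    (show 0 ≤ (Fintype.card (Fin m₂) : ℝ) * (c * c) by positivity)
  rw [nonstiffBound]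
  linarith

/-- The general estimate gives only order √ε here. The obstruction is the product of the slow
entries of `K`, of order √ε, with the last columns of A₂, and these vanish by (A2); every other term
is of order ε. -/
theorem abs_nonstiff_fast_free_le (hK : ∀ i j, |K i j| ≤ c * weight ε i * weight ε j)
    (hA : EntriesLe A a) (hS : EntriesLe S s) (hε : 0 < ε) (hε1 : ε ≤ 1) (hc : 0 ≤ c)
    (ha : 0 ≤ a) (hs : 0 ≤ s) (hA0 : ∀ i r, A (Sum.inl i) (freeIdx r) = 0)
    (p : Fin m₁) (r : Fin m₂) :
    |nonstiff ε A S K (fastIdx p) (freeIdx r)| ≤ 2 * nonstiffBound n m₁ m₂ a c s * ε := by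
  have hsq : √ε ≤ 1 := Real.sqrt_le_one.2 hε1
  have h1 : |(K * A) (fastIdx p) (freeIdx r)| ≤ Fintype.card (Idx n m₁ m₂) * (c * a) * ε := by
    rw [Matrix.mul_apply]
    refine (abs_sum_le_card_mul (x := c * ε * a) fun q => ?_).trans (le_of_eq (by ring))
    rw [abs_mul]
    rcases q with q | q | q
    · rw [hA0, abs_zero, mul_zero]
      positivity
    · refine mul_le_mul ((hK _ _).trans (le_of_eq ?_)) (hA _ _) (abs_nonneg _) (by positivity)
      simp [weight, mul_assoc, Real.mul_self_sqrt hε.le]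
    · refine mul_le_mul ((hK _ _).trans ?_) (hA _ _) (abs_nonneg _) (by positivity)
      simp only [weight, Sum.elim_inr, Sum.elim_inl]
      exact mul_le_mul_of_nonneg_right (mul_le_of_le_one_right hc hsq) hε.le
  have h2 := abs_mul_left_le hK hA hε.le hε1 hc (fastIdx p) (freeIdx r)
  have h3 := abs_mul_mul_le hK hS hε.le hε1 hc hs (fastIdx p) (freeIdx r)
  have h4 := abs_free_sum_le hK hε hc (fastIdx p) (freeIdx r)
  have hw : weight ε (freeIdx r : Idx n m₁ m₂) = ε := rfl
  have h5 : weight ε (fastIdx p : Idx n m₁ m₂) * weight ε (freeIdx r : Idx n m₁ m₂) ≤ ε :=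
    mul_le_of_le_one_left hε.le hsq
  have h6 : |nonstiff ε A S K (fastIdx p) (freeIdx r)| ≤ |(K * A) (fastIdx p) (freeIdx r)| +
      |(Aᵀ * K) (fastIdx p) (freeIdx r)| + |(K * S * K) (fastIdx p) (freeIdx r)| +
      |(ε ^ 2)⁻¹ * ∑ q, K (fastIdx p) (freeIdx q) * K (freeIdx q) (freeIdx r)| := by
    simp only [nonstiff, Matrix.sub_apply, Matrix.add_apply, Matrix.smul_apply, Matrix.of_apply,
      smul_eq_mul]
    exact (abs_sub _ _).trans (by
      gcongr; exact (abs_add_le _ _).trans (by gcongr; exact abs_add_le _ _))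
  have h7 := mul_le_mul_of_nonneg_left h5 (show 0 ≤ (Fintype.card (Idx n m₁ m₂) : ℝ) *
      (Fintype.card (Idx n m₁ m₂) * (c * s) * c) by positivity)
  have h8 := mul_le_mul_of_nonneg_left h5
    (show 0 ≤ (Fintype.card (Fin m₂) : ℝ) * (c * c) by positivity)
  have h9 : 0 ≤ (Fintype.card (Idx n m₁ m₂) : ℝ) *
      (Fintype.card (Idx n m₁ m₂) * (c * s) * c) * ε := by positivity
  have h10 : 0 ≤ (Fintype.card (Fin m₂) : ℝ) * (c * c) * ε := by positivity
  rw [hw] at h2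
  rw [nonstiffBound]
  linarith

end Bounds

end CheapGame

/-! ### Uniform bounds for the scaled blocks. -/

namespace CheapGame

variable {n m₁ m₂ l : ℕ}

/-- The rescaled block of `K` on the weighted fast coordinates. -/
def fastBlock (ε : ℝ) (K : Matrix (Idx n m₁ m₂) (Idx n m₁ m₂) ℝ) : Matrix (Fin m₁) (Fin m₁) ℝ :=
  ε⁻¹ • K.submatrix fastIdx fastIdx

variable {g : CheapGame n m₁ m₂ l} {ε : ℝ}
  {K : ℝ → Matrix (Idx n m₁ m₂) (Idx n m₁ m₂) ℝ}

theorem SolvesRiccati.hasDerivWithinAt_apply (hK : g.SolvesRiccati ε K) {t : ℝ}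
    (ht : t ∈ Icc 0 g.tf) (i j : Idx n m₁ m₂) :
    HasDerivWithinAt (fun r => K r i j)
      (-nonstiff ε (g.A t) (g.Sv t) (K t) i j - g.D t i j +
        (ε ^ 2)⁻¹ * ∑ q, K t i (fastIdx q) * K t (fastIdx q) j) (Icc 0 g.tf) t := by
  rw [← riccati_apply]
  exact hK.2 t ht i j

theorem SolvesRiccati.matHasDerivWithinAt_fastBlock (hK : g.SolvesRiccati ε K)
    {t : ℝ} (ht : t ∈ Icc 0 g.tf) :
    MatHasDerivWithinAt (fun t => fastBlock ε (K t))
      (ε⁻¹ • (fastBlock ε (K t) * fastBlock ε (K t) -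
        (nonstiff ε (g.A t) (g.Sv t) (K t) + g.D t).submatrix fastIdx fastIdx))
      (Icc 0 g.tf) t := by
  intro p q
  refine ((hK.hasDerivWithinAt_apply ht (fastIdx p) (fastIdx q)).const_mul ε⁻¹).congr_deriv ?_
  simp only [fastBlock, Matrix.smul_apply, Matrix.sub_apply, Matrix.smul_mul, Matrix.mul_smul,
    Matrix.mul_apply, Matrix.submatrix_apply, Matrix.add_apply, smul_eq_mul]
  ring

/-- For a fixed column the stiff quadratic term is `fastBlock` applied to that column. Regarding
`fastBlock` as known makes the equation linear. The factor `s` will be ε⁻¹ for K₂ and ε⁻² for K₅. -/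
theorem SolvesRiccati.hasDerivWithinAt_fast_column (hK : g.SolvesRiccati ε K) (hε : ε ≠ 0)
    (s : ℝ) (j : Idx n m₁ m₂) {t : ℝ} (ht : t ∈ Icc 0 g.tf) :
    HasDerivWithinAt (fun t p => s * K t (fastIdx p) j)
      (ε⁻¹ • (fastBlock ε (K t) *ᵥ (fun p => s * K t (fastIdx p) j) -
        fun p => ε * s * (nonstiff ε (g.A t) (g.Sv t) (K t) + g.D t) (fastIdx p) j))
      (Icc 0 g.tf) t := by
  rw [hasDerivWithinAt_pi]
  intro p
  refine ((hK.hasDerivWithinAt_apply ht (fastIdx p) j).const_mul s).congr_deriv ?_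
  simp only [fastBlock, Matrix.smul_mulVec, Matrix.mulVec, dotProduct, Pi.smul_apply, Pi.sub_apply,
    Matrix.submatrix_apply, Matrix.add_apply, smul_eq_mul, mul_left_comm _ s, ← Finset.mul_sum]
  field_simp
  ring

/-- The stiff linear estimate applies because the weighted fast rows of `F` vanish. The constant (m₁
+ 1)q is a crude bound for the Euclidean norm of the forcing, at most √m₁ q. -/
theorem SolvesRiccati.abs_fast_column_le (hK : g.SolvesRiccati ε K) (hε : 0 < ε) {μ q : ℝ}
    (hμ : 0 < μ) (hq : 0 ≤ q)
    (hP : ∀ t ∈ Icc 0 g.tf, ∀ w, μ * Real.sinh (μ * (g.tf - t) / ε) * (w ⬝ᵥ w) ≤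
      Real.cosh (μ * (g.tf - t) / ε) * (w ⬝ᵥ (fastBlock ε (K t) *ᵥ w)))
    (s : ℝ) (j : Idx n m₁ m₂)
    (hh : ∀ t ∈ Icc 0 g.tf, ∀ p,
      |ε * s * (nonstiff ε (g.A t) (g.Sv t) (K t) + g.D t) (fastIdx p) j| ≤ q) :
    ∀ t ∈ Icc 0 g.tf, ∀ p, |s * K t (fastIdx p) j| ≤ 1 + (m₁ + 1) * q / μ := by
  refine abs_le_of_stiff_linear hε hμ (by positivity) hP
    (fun t ht => hK.hasDerivWithinAt_fast_column hε.ne' s j ht) (fun t ht => ?_) ?_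
  · calc _ ≤ ∑ _p : Fin m₁, q ^ 2 := Finset.sum_le_sum fun p _ => by
          rw [← sq]
          exact sq_le_sq' (abs_le.1 (hh t ht p)).1 (abs_le.1 (hh t ht p)).2
      _ = m₁ * q ^ 2 := by simp
      _ ≤ _ := by
        have : (0 : ℝ) ≤ m₁ := Nat.cast_nonneg _
        rw [mul_pow]
        exact mul_le_mul_of_nonneg_right (by nlinarith) (sq_nonneg q)
  · funext p
    rw [hK.1]
    rcases j with j | j <;> simp [F]

/-- The blocks of a matrix after removal of the powers of `ε`. -/
theorem hasScaledBlockForm_of_abs_le (hε : 0 < ε) {M : ℝ}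
    (hs : ∀ t ∈ Icc 0 g.tf, (K t).IsSymm)
    (h1 : ∀ t ∈ Icc 0 g.tf, ∀ i j, |K t (Sum.inl i) (Sum.inl j)| ≤ M)
    (h2 : ∀ t ∈ Icc 0 g.tf, ∀ i p, |ε⁻¹ * K t (fastIdx p) (Sum.inl i)| ≤ M)
    (h3 : ∀ t ∈ Icc 0 g.tf, ∀ i r, |ε⁻¹ * K t (Sum.inl i) (freeIdx r)| ≤ M)
    (h4 : ∀ t ∈ Icc 0 g.tf, ∀ p q, |ε⁻¹ * K t (fastIdx p) (fastIdx q)| ≤ M)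
    (h5 : ∀ t ∈ Icc 0 g.tf, ∀ p r, |(ε ^ 2)⁻¹ * K t (fastIdx p) (freeIdx r)| ≤ M)
    (h6 : ∀ t ∈ Icc 0 g.tf, ∀ r q, |(ε ^ 2)⁻¹ * K t (freeIdx r) (freeIdx q)| ≤ M) :
    g.HasScaledBlockForm ε M K := by
  refine ⟨fun t => (K t).submatrix Sum.inl Sum.inl,
    fun t => ε⁻¹ • (K t).submatrix Sum.inl fastIdx,
    fun t => ε⁻¹ • (K t).submatrix Sum.inl freeIdx,
    fun t => ε⁻¹ • (K t).submatrix fastIdx fastIdx,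
    fun t => (ε ^ 2)⁻¹ • (K t).submatrix fastIdx freeIdx,
    fun t => (ε ^ 2)⁻¹ • (K t).submatrix freeIdx freeIdx, fun t ht => ?_⟩
  have hs' := fun i j => (hs t ht).apply i j
  refine ⟨?_, ?_, ?_, ?_, h1 t ht, fun i p => ?_, h3 t ht, h4 t ht, h5 t ht, h6 t ht⟩
  · ext i j
    have hε' := hε.ne'
    rcases i with i | i | i <;> rcases j with j | j | j <;>
      simp [scaledBlocks, hε', hs' (Sum.inl _) (Sum.inr _), hs' (fastIdx _) (freeIdx _)]
  · exact Matrix.IsSymm.ext fun i j => hs' _ _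
  · exact Matrix.IsSymm.ext fun i j => by simp [hs' (fastIdx j)]
  · exact Matrix.IsSymm.ext fun i j => by simp [hs' (freeIdx j)]
  · have := h2 t ht i p
    rw [hs'] at this
    exact this

theorem Standing.exists_lam_lower_bound (hg : g.Standing) :
    ∃ ℓ > 0, ∀ t ∈ Icc 0 g.tf, ∀ p : Fin m₁, ℓ ≤ g.lam t (Sum.inl p) := by
  have hc : ∀ p : Fin m₁, ContinuousOn (fun t => g.lam t (Sum.inl p)) (Icc 0 g.tf) := fun p => by
    simpa [D₂] using hg.cont_D₂ (Sum.inl p) (Sum.inl p)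
  have h : ∀ p : Fin m₁, ∃ ℓ > 0, ∀ t ∈ Icc 0 g.tf, ℓ ≤ g.lam t (Sum.inl p) := fun p => by
    obtain ⟨t, ht, hmin⟩ := isCompact_Icc.exists_isMinOn (nonempty_Icc.2 hg.tf_pos.le) (hc p)
    exact ⟨_, hg.lam_pos t ht p, fun s hs => hmin hs⟩
  choose ℓ hℓ hle using h
  rcases isEmpty_or_nonempty (Fin m₁) with _ | _
  · exact ⟨1, one_pos, fun t _ p => isEmptyElim p⟩
  · obtain ⟨p, hp⟩ := Finite.exists_min ℓ
    exact ⟨ℓ p, hℓ p, fun t ht q => (hp q).trans (hle q t ht)⟩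

/-- K₁, K₃, K₄ and K₆ are bounded by the weighted estimate directly; K₂ and K₅ need the damping of
the fast block. -/
theorem exists_solution_scaledBlockForm (hg : g.Standing)
    (hA2 : g.AssumptionA2) (hA3 : g.AssumptionA3) (hA4 : g.AssumptionA4) :
    ∃ ε₀ M : ℝ, 0 < ε₀ ∧ ∀ ε ∈ Ioc 0 ε₀, ∃ K, g.IsSymmSolution ε K ∧
      g.HasScaledBlockForm ε M K := by
  obtain ⟨ε₁, c, hε₁, hc, h⟩ := exists_solution_weighted_bound hg hA2 hA3 hA4
  obtain ⟨a, ha, hA⟩ := hg.cont_A.exists_entriesLe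
  obtain ⟨s, hs, hS⟩ := hg.cont_Sv.exists_entriesLe
  obtain ⟨ℓ, hℓ, hlam⟩ := hg.exists_lam_lower_bound
  set b := nonstiffBound n m₁ m₂ a c s with hb
  have hb0 : 0 ≤ b := by
    rw [hb, nonstiffBound]
    positivity
  -- Half of the lower bound ℓ of the λ's is spent on the non-stiff perturbation, so that L ≥ ℓ/2 =
  -- μ².
  set μ := √(ℓ / 2) with hμ
  have hμ0 : 0 < μ := Real.sqrt_pos.2 (by positivity)
  have hμ2 : μ ^ 2 = ℓ / 2 := Real.sq_sqrt (by positivity)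
  -- For √ε ≤ d the perturbation, with entries at most 2b√ε, changes the form by at most 2m₁bd ≤ ℓ/2
  -- times |w|². The summand 4 keeps the denominator positive when b m₁ = 0.
  set d : ℝ := ℓ / (4 * b * m₁ + 4) with hd
  have hd0 : 0 < d := by positivity
  refine ⟨min ε₁ (min 1 (d ^ 2)), c + (1 + (m₁ + 1) * (2 * b) / μ), by positivity,
    fun ε hε => ?_⟩
  obtain ⟨hε0, hε⟩ := hε
  have hεd : √ε ≤ d := Real.sqrt_le_iff.2 ⟨hd0.le, hε.trans ((min_le_right _ _).trans
    (min_le_right _ _))⟩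
  have hε1 : ε ≤ 1 := hε.trans ((min_le_right _ _).trans (min_le_left _ _))
  obtain ⟨K, hK, hKc⟩ := h ε ⟨hε0, hε.trans (min_le_left _ _)⟩
  have hN : ∀ t ∈ Icc 0 g.tf, ∀ i j, |nonstiff ε (g.A t) (g.Sv t) (K t) i j| ≤
      b * (weight ε i + weight ε j) := fun t ht =>
    abs_nonstiff_le (hKc t ht) (hA t ht) (hS t ht) hε0 hε1 hc hs
  have hL : ∀ t ∈ Icc 0 g.tf, ∀ w, μ ^ 2 * (w ⬝ᵥ w) ≤
      w ⬝ᵥ ((nonstiff ε (g.A t) (g.Sv t) (K t) + g.D t).submatrix fastIdx fastIdx *ᵥ w) := by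
    intro t ht w
    have hE : EntriesLe ((nonstiff ε (g.A t) (g.Sv t) (K t)).submatrix fastIdx fastIdx :
        Matrix (Fin m₁) (Fin m₁) ℝ) (b * (√ε + √ε)) := fun p q => hN t ht _ _
    have h1 := quadForm_ge_of_entriesLe hE w
    have h2 : (g.D t).submatrix fastIdx fastIdx =
        Matrix.diagonal fun p : Fin m₁ => g.lam t (Sum.inl p) := by
      ext p q
      simp [D, D₂, Matrix.diagonal_apply]
    have h3 : ℓ * (w ⬝ᵥ w) ≤
        w ⬝ᵥ (Matrix.diagonal (fun p : Fin m₁ => g.lam t (Sum.inl p)) *ᵥ w) := by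
      simp only [dotProduct, Matrix.mulVec_diagonal, Finset.mul_sum]
      refine Finset.sum_le_sum fun p _ => ?_
      nlinarith [hlam t ht p, mul_self_nonneg (w p)]
    have h4 : m₁ * (b * (√ε + √ε)) ≤ ℓ / 2 := by
      calc m₁ * (b * (√ε + √ε)) ≤ m₁ * (b * (d + d)) := by gcongr
        _ = ℓ * ((2 * b * m₁) / (4 * b * m₁ + 4)) := by rw [hd]; ring
        _ ≤ ℓ * (1 / 2) := by
          refine mul_le_mul_of_nonneg_left ?_ hℓ.le
          rw [div_le_div_iff₀ (by positivity) two_pos]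
          linarith
        _ = ℓ / 2 := by ring
    have h5 : 0 ≤ w ⬝ᵥ w := by simpa using dotProduct_star_self_nonneg w
    have h6 := mul_le_mul_of_nonneg_right h4 h5
    rw [Matrix.submatrix_add, Pi.add_apply, Pi.add_apply, h2, Matrix.add_mulVec, dotProduct_add,
      hμ2]
    rw [Fintype.card_fin] at h1
    linarith
  have hP := layer_le_of_riccati hε0 (fun t ht => hK.1.matHasDerivWithinAt_fastBlock ht)
    (fun t ht => Matrix.IsSymm.ext fun i j => by
      simp [fastBlock, (hK.2 t ht).apply (fastIdx j)])
    (by ext p q; simp [fastBlock, hK.1.1, F]) hL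
  have hq : (0 : ℝ) ≤ 1 + (m₁ + 1) * (2 * b) / μ := by positivity
  have hsq : √ε ≤ 1 := Real.sqrt_le_one.2 hε1
  refine ⟨K, hK, hasScaledBlockForm_of_abs_le hε0 hK.2 ?_ ?_ ?_ ?_ ?_ ?_⟩
  · intro t ht i j
    have := hKc t ht (Sum.inl i) (Sum.inl j)
    simp only [weight, Sum.elim_inl, mul_one] at this
    linarith
  · intro t ht i p
    refine (hK.1.abs_fast_column_le (q := 2 * b) hε0 hμ0 (by positivity) hP ε⁻¹ (Sum.inl i)
      (fun t ht p => ?_) t ht p).trans (by linarith)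
    have h1 : g.D t (fastIdx p) (Sum.inl i) = 0 := by simp [D]
    rw [mul_inv_cancel₀ hε0.ne', one_mul, Matrix.add_apply, h1, add_zero]
    refine (hN t ht _ _).trans ?_
    simp only [weight, Sum.elim_inr, Sum.elim_inl]
    nlinarith
  · intro t ht i r
    have := hKc t ht (Sum.inl i) (freeIdx r)
    simp only [weight, Sum.elim_inl, Sum.elim_inr, mul_one] at this
    rw [abs_mul, abs_of_pos (inv_pos.2 hε0), inv_mul_le_iff₀ hε0]
    nlinarith
  · intro t ht p q
    have := hKc t ht (fastIdx p) (fastIdx q)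
    simp only [weight, Sum.elim_inl, Sum.elim_inr, mul_assoc, Real.mul_self_sqrt hε0.le] at this
    rw [abs_mul, abs_of_pos (inv_pos.2 hε0), inv_mul_le_iff₀ hε0]
    nlinarith
  · intro t ht p r
    -- With s = ε⁻² the forcing is ε⁻¹ times the non-stiff terms, so their order ε, due to (A2), is
    -- needed.
    refine (hK.1.abs_fast_column_le (q := 2 * b) hε0 hμ0 (by positivity) hP (ε ^ 2)⁻¹ (freeIdx r)
      (fun t ht p => ?_) t ht p).trans (by linarith)
    have h1 : g.D t (fastIdx p) (freeIdx r) = 0 := by simp [D, D₂]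
    rw [Matrix.add_apply, h1, add_zero, show ε * (ε ^ 2)⁻¹ = ε⁻¹ by field_simp, abs_mul,
      abs_of_pos (inv_pos.2 hε0), inv_mul_le_iff₀ hε0]
    refine (abs_nonstiff_fast_free_le (hKc t ht) (hA t ht) (hS t ht) hε0 hε1 hc ha hs
      (fun i r => ?_) p r).trans (le_of_eq (by ring))
    exact congrFun (congrFun (hA2 t ht) i) r
  · intro t ht r q
    have := hKc t ht (freeIdx r) (freeIdx q)
    simp only [weight, Sum.elim_inr, mul_assoc] at this
    rw [abs_mul, abs_of_pos (inv_pos.2 (pow_pos hε0 2)), inv_mul_le_iff₀ (pow_pos hε0 2)]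
    nlinarith [mul_pos hε0 hε0]

end CheapGame

/-! ### Absolutely continuous functions and trajectories. -/

section AbsolutelyContinuous

variable {ι κ : Type*} [Fintype ι] [Fintype κ] {a b : ℝ}

theorem AbsolutelyContinuousOnInterval.component {f : ℝ → ι → ℝ}
    (hf : AbsolutelyContinuousOnInterval f a b) (i : ι) :
    AbsolutelyContinuousOnInterval (fun t => f t i) a b :=
  squeeze_zero (fun _ => Finset.sum_nonneg fun _ _ => dist_nonneg)
    (fun _ => Finset.sum_le_sum fun _ _ => dist_le_pi_dist _ _ i) hf

theorem AbsolutelyContinuousOnInterval.fun_sum {f : ι → ℝ → ℝ}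
    (hf : ∀ i, AbsolutelyContinuousOnInterval (f i) a b) :
    AbsolutelyContinuousOnInterval (fun t => ∑ i, f i t) a b := by
  classical
  have h : ∀ s : Finset ι, AbsolutelyContinuousOnInterval (fun t => ∑ i ∈ s, f i t) a b := by
    intro s
    induction s using Finset.induction_on with
    | empty =>
      simpa using ((LipschitzWith.const (0 : ℝ)).lipschitzOnWith
        (s := uIcc a b)).absolutelyContinuousOnInterval
    | insert i s hi ih =>
      simp only [Finset.sum_insert hi]
      exact (hf i).fun_add ih
  exact h Finset.univ

theorem AbsolutelyContinuousOnInterval.dotProduct {x y : ℝ → ι → ℝ}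
    (hx : AbsolutelyContinuousOnInterval x a b) (hy : AbsolutelyContinuousOnInterval y a b) :
    AbsolutelyContinuousOnInterval (fun t => x t ⬝ᵥ y t) a b :=
  AbsolutelyContinuousOnInterval.fun_sum fun i => (hx.component i).fun_mul (hy.component i)

theorem AbsolutelyContinuousOnInterval.dotProduct_mulVec {x : ℝ → ι → ℝ} {y : ℝ → κ → ℝ}
    {M : ℝ → Matrix ι κ ℝ} (hx : AbsolutelyContinuousOnInterval x a b)
    (hM : ∀ i j, AbsolutelyContinuousOnInterval (fun t => M t i j) a b)
    (hy : AbsolutelyContinuousOnInterval y a b) :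
    AbsolutelyContinuousOnInterval (fun t => x t ⬝ᵥ (M t *ᵥ y t)) a b :=
  AbsolutelyContinuousOnInterval.fun_sum fun i => (hx.component i).fun_mul <|
    AbsolutelyContinuousOnInterval.fun_sum fun j => (hM i j).fun_mul (hy.component j)

theorem absolutelyContinuousOnInterval_of_hasDerivWithinAt {E : Type*} [NormedAddCommGroup E]
    [NormedSpace ℝ E] {f f' : ℝ → E} (hab : a ≤ b)
    (hf : ∀ t ∈ Icc a b, HasDerivWithinAt f (f' t) (Icc a b) t)
    (hf' : ContinuousOn f' (Icc a b)) : AbsolutelyContinuousOnInterval f a b := by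
  obtain ⟨c, hc⟩ := isCompact_Icc.exists_bound_of_continuousOn hf'
  refine LipschitzOnWith.absolutelyContinuousOnInterval (K := c.toNNReal) ?_
  rw [uIcc_of_le hab]
  exact (convex_Icc a b).lipschitzOnWith_of_nnnorm_hasDerivWithin_le hf fun t ht =>
    NNReal.le_toNNReal_of_coe_le (hc t ht)

theorem AbsolutelyContinuousOnInterval.le_of_ae_deriv_nonpos {f : ℝ → ℝ} (hab : a ≤ b)
    (hf : AbsolutelyContinuousOnInterval f a b)
    (h : ∀ᵐ t ∂(volume.restrict (Icc a b)), deriv f t ≤ 0) : f b ≤ f a := by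
  have h1 : 0 ≤ ∫ t in a..b, -deriv f t :=
    intervalIntegral.integral_nonneg_of_ae_restrict hab
      (h.mono fun t ht => by simpa using ht)
  rw [intervalIntegral.integral_neg, hf.integral_deriv_eq_sub] at h1
  linarith

theorem ae_restrict_Icc_of_forall_Ioo {p : ℝ → Prop} (h : ∀ t ∈ Ioo a b, p t) :
    ∀ᵐ t ∂(volume.restrict (Icc a b)), p t := by
  rw [← restrict_Ioo_eq_restrict_Icc]
  exact (ae_restrict_iff' measurableSet_Ioo).2 (Filter.Eventually.of_forall h)

end AbsolutelyContinuous

namespace CheapGame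

/-- Uniqueness must cover solutions satisfying the equation only almost everywhere. With k bounding
twice the quadratic form of `M`, the absolutely continuous function e^{-ks}|w|² has nonpositive
derivative almost everywhere, hence does not increase from its initial value 0. -/
theorem eq_zero_of_ae_linear {ι : Type*} [Fintype ι] {M : ℝ → Matrix ι ι ℝ} {a b : ℝ}
    (hM : MatContOn M (Icc a b)) {w : ℝ → ι → ℝ} (hw : AbsolutelyContinuousOnInterval w a b)
    (hw' : ∀ᵐ t ∂(volume.restrict (Icc a b)), HasDerivAt w (M t *ᵥ w t) t) (h0 : w a = 0) :
    ∀ t ∈ Icc a b, w t = 0 := by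
  obtain ⟨c, -, hc⟩ := hM.exists_entriesLe
  set k : ℝ := 2 * (Fintype.card ι * c) with hk
  intro t ht
  have hsub : Icc a t ⊆ Icc a b := Icc_subset_Icc_right ht.2
  have hexp : AbsolutelyContinuousOnInterval (fun s => Real.exp (-k * s)) a t :=
    ContDiffOn.absolutelyContinuousOnInterval (by fun_prop)
  have hwt : AbsolutelyContinuousOnInterval w a t :=
    hw.mono (by rwa [uIcc_of_le ht.1, uIcc_of_le (ht.1.trans ht.2)])
  have h1 := (hexp.fun_mul (hwt.dotProduct hwt)).le_of_ae_deriv_nonpos ht.1 ?_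
  · rw [h0, zero_dotProduct, mul_zero] at h1
    refine dotProduct_self_eq_zero.1 (le_antisymm ?_ ?_)
    · exact nonpos_of_mul_nonpos_right h1 (Real.exp_pos _)
    · simpa using dotProduct_star_self_nonneg (w t)
  · filter_upwards [ae_restrict_of_ae_restrict_of_subset hsub hw',
      ae_restrict_mem measurableSet_Icc] with s hs hsI
    have h2 : HasDerivAt (fun r => w r ⬝ᵥ w r) (2 * (w s ⬝ᵥ (M s *ᵥ w s))) s := by
      have h3 := hs.hasDerivWithinAt (s := univ)
      refine (hasDerivWithinAt_univ.1 (h3.dotProduct h3)).congr_deriv ?_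
      rw [dotProduct_comm (M s *ᵥ w s)]
      ring
    have h4 : HasDerivAt (fun r => Real.exp (-k * r)) (Real.exp (-k * s) * -k) s := by
      simpa using ((hasDerivAt_id s).const_mul (-k)).exp
    rw [(h4.fun_mul h2).deriv]
    have h5 := quadForm_ge_of_entriesLe (hc s (hsub hsI)).neg (w s)
    rw [Matrix.neg_mulVec, dotProduct_neg] at h5
    have h6 := mul_le_mul_of_nonneg_left (show 2 * (w s ⬝ᵥ (M s *ᵥ w s)) ≤ k * (w s ⬝ᵥ w s) by
      rw [hk]; linarith) (Real.exp_pos (-k * s)).le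
    linarith

variable {n m₁ m₂ l : ℕ} {g : CheapGame n m₁ m₂ l}

theorem rhs_eq (g : CheapGame n m₁ m₂ l) (t : ℝ) (z : State n m₁ m₂) (u : UCtrl m₁ m₂)
    (v : VCtrl l) : g.rhs t z u v = g.A t *ᵥ z + B n m₁ m₂ *ᵥ u + g.C t *ᵥ v := by
  rw [A, B, C, Matrix.fromBlocks_mulVec, Matrix.fromRows_mulVec, Matrix.fromRows_mulVec,
    Matrix.zero_mulVec, Matrix.one_mulVec]
  ext i
  rcases i with i | i <;> simp [rhs]

theorem isFeedback_mulVec {κ : Type} [Fintype κ] {N : ℝ → Matrix κ (Idx n m₁ m₂) ℝ}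
    (hN : MatContOn N (Icc 0 g.tf)) : g.IsFeedback fun z t => N t *ᵥ z := by
  refine ⟨fun z => (hN.mulVec continuousOn_const).aemeasurable measurableSet_Icc, fun z => ?_⟩
  obtain ⟨c, hc, hNc⟩ := hN.exists_entriesLe
  refine ⟨(Fintype.card (Idx n m₁ m₂) * c).toNNReal, univ, Filter.univ_mem, fun t ht =>
    LipschitzOnWith.of_dist_le_mul fun x _ y _ => ?_⟩
  rw [Real.coe_toNNReal _ (by positivity), dist_eq_norm, dist_eq_norm, ← Matrix.mulVec_sub]
  exact (hNc t ht).norm_mulVec_le hc _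

theorem memLp_restrict_Icc_of_continuousOn {E : Type*} [NormedAddCommGroup E]
    [SecondCountableTopology E] {f : ℝ → E} {a b : ℝ} (hf : ContinuousOn f (Icc a b)) :
    MemLp f 2 (volume.restrict (Icc a b)) := by
  obtain ⟨c, hc⟩ := isCompact_Icc.exists_bound_of_continuousOn hf
  exact MemLp.of_bound (hf.aestronglyMeasurable measurableSet_Icc) c
    ((ae_restrict_iff' measurableSet_Icc).2 (Filter.Eventually.of_forall hc))

theorem mem_UV_of_linear (hg : g.Standing) {N₁ : ℝ → Matrix (Fin m₁ ⊕ Fin m₂) (Idx n m₁ m₂) ℝ}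
    {N₂ : ℝ → Matrix (Fin l) (Idx n m₁ m₂) ℝ} (h₁ : MatContOn N₁ (Icc 0 g.tf))
    (h₂ : MatContOn N₂ (Icc 0 g.tf)) :
    ((fun z t => N₁ t *ᵥ z, fun z t => N₂ t *ᵥ z) :
      (State n m₁ m₂ → ℝ → UCtrl m₁ m₂) × (State n m₁ m₂ → ℝ → VCtrl l)) ∈ g.UV := by
  refine ⟨isFeedback_mulVec h₁, isFeedback_mulVec h₂, fun z₀ => ?_⟩
  set M : ℝ → Matrix (Idx n m₁ m₂) (Idx n m₁ m₂) ℝ :=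
    fun t => g.A t + B n m₁ m₂ * N₁ t + g.C t * N₂ t with hMdef
  have hM : MatContOn M (Icc 0 g.tf) :=
    (hg.cont_A.add ((MatContOn.const _).mul h₁)).add (hg.cont_C.mul h₂)
  have hr : ∀ t z, g.rhs t z (N₁ t *ᵥ z) (N₂ t *ᵥ z) = M t *ᵥ z := fun t z => by
    simp only [rhs_eq, hMdef, Matrix.add_mulVec, Matrix.mulVec_mulVec]
  obtain ⟨z, hz0, hz⟩ := exists_linear_solution hg.tf_pos.le hM z₀
  have hzc : ContinuousOn z (Icc 0 g.tf) := fun t ht => (hz t ht).continuousWithinAt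
  have htraj : g.IsTrajectory (fun z t => N₁ t *ᵥ z) (fun z t => N₂ t *ᵥ z) z₀ z := by
    refine ⟨hz0, absolutelyContinuousOnInterval_of_hasDerivWithinAt hg.tf_pos.le hz
      (hM.mulVec hzc), ae_restrict_Icc_of_forall_Ioo fun t ht => ?_⟩
    rw [hr]
    exact (hz t (Ioo_subset_Icc_self ht)).hasDerivAt (Icc_mem_nhds ht.1 ht.2)
  refine ⟨z, htraj, fun z' hz' t ht => ?_, memLp_restrict_Icc_of_continuousOn (h₁.mulVec hzc),
    memLp_restrict_Icc_of_continuousOn (h₂.mulVec hzc)⟩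
  refine sub_eq_zero.1 (eq_zero_of_ae_linear hM (hz'.2.1.fun_sub htraj.2.1) ?_ ?_ t ht)
  · filter_upwards [hz'.2.2, htraj.2.2] with s h1 h2
    rw [hr] at h1 h2
    rw [Matrix.mulVec_sub]
    exact h1.fun_sub h2
  · rw [hz'.1, htraj.1, sub_self]

end CheapGame

/-! ### Completion of squares and the saddle point. -/

namespace CheapGame

variable {n m₁ m₂ l : ℕ} {g : CheapGame n m₁ m₂ l} {ε : ℝ}
  {K : ℝ → Matrix (Idx n m₁ m₂) (Idx n m₁ m₂) ℝ}

/-- The running cost at time `t`, state `z` and control values `a`, `b`. -/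
def runningCost (g : CheapGame n m₁ m₂ l) (ε t : ℝ) (z : State n m₁ m₂) (a : UCtrl m₁ m₂)
    (b : VCtrl l) : ℝ :=
  z ⬝ᵥ (g.D t *ᵥ z) + ε ^ 2 * (a ⬝ᵥ a) - b ⬝ᵥ (g.G t *ᵥ b)

/-- The minimizer's loss minus the maximizer's loss, per unit of time, against the optimal
feedbacks. -/
def gap (g : CheapGame n m₁ m₂ l) (ε : ℝ) (K : ℝ → Matrix (Idx n m₁ m₂) (Idx n m₁ m₂) ℝ) (t : ℝ)
    (z : State n m₁ m₂) (a : UCtrl m₁ m₂) (b : VCtrl l) : ℝ :=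
  ε ^ 2 * ((a - uStar ε K z t) ⬝ᵥ (a - uStar ε K z t)) -
    (b - g.vStar K z t) ⬝ᵥ (g.G t *ᵥ (b - g.vStar K z t))

theorem costAlong_eq (g : CheapGame n m₁ m₂ l) (ε : ℝ) (u : State n m₁ m₂ → ℝ → UCtrl m₁ m₂)
    (v : State n m₁ m₂ → ℝ → VCtrl l) (z : ℝ → State n m₁ m₂) :
    g.costAlong ε u v z = z g.tf ⬝ᵥ (g.F *ᵥ z g.tf) +
      ∫ t in (0 : ℝ)..g.tf, g.runningCost ε t (z t) (u (z t) t) (v (z t) t) := by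
  simp only [costAlong, runningCost, F, D, Matrix.fromBlocks_mulVec, Matrix.zero_mulVec, add_zero,
    zero_add, dotProduct, Fintype.sum_sum_type, Sum.elim_inl, Sum.elim_inr, Function.comp_apply,
    Pi.zero_apply, mul_zero, Finset.sum_const_zero]

/-- The left side is the derivative of zᵀKz for arbitrary control values. The Riccati equation
supplies exactly the quadratic terms in Kz which complete the squares in both controls. -/
theorem quadForm_completion (hg : g.Standing) (hε : ε ≠ 0) {t : ℝ} (ht : t ∈ Icc 0 g.tf)
    (hs : (K t).IsSymm) (z : State n m₁ m₂) (a : UCtrl m₁ m₂) (b : VCtrl l) :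
    g.rhs t z a b ⬝ᵥ (K t *ᵥ z) + z ⬝ᵥ ((riccati (g.A t) (Su n m₁ m₂ ε - g.Sv t) (g.D t) (K t)) *ᵥ z
      + K t *ᵥ g.rhs t z a b) = g.gap ε K t z a b - g.runningCost ε t z a b := by
  set p := K t *ᵥ z with hp
  set q := (B n m₁ m₂)ᵀ *ᵥ p with hq
  set r := (g.C t)ᵀ *ᵥ p with hr
  set r' := (g.G t)⁻¹ *ᵥ r with hr'
  have hK : ∀ x, z ⬝ᵥ (K t *ᵥ x) = p ⬝ᵥ x := fun x => by
    rw [Matrix.dotProduct_mulVec, ← Matrix.mulVec_transpose, hs.eq]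
  have hGr : g.G t *ᵥ r' = r := by
    rw [hr', Matrix.mulVec_mulVec, Matrix.mul_nonsing_inv _
      (isUnit_iff_ne_zero.2 (hg.G_pd t ht).det_pos.ne'), Matrix.one_mulVec]
  have hGs : ∀ x, r' ⬝ᵥ (g.G t *ᵥ x) = r ⬝ᵥ x := fun x => by
    rw [Matrix.dotProduct_mulVec, ← Matrix.mulVec_transpose, (hg.G_isSymm ht).eq, hGr]
  have hB : ∀ x, p ⬝ᵥ (B n m₁ m₂ *ᵥ x) = q ⬝ᵥ x := fun x => by
    rw [Matrix.dotProduct_mulVec, ← Matrix.mulVec_transpose]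
  have hC : ∀ x, p ⬝ᵥ (g.C t *ᵥ x) = r ⬝ᵥ x := fun x => by
    rw [Matrix.dotProduct_mulVec, ← Matrix.mulVec_transpose]
  have hSu : p ⬝ᵥ (Su n m₁ m₂ ε *ᵥ p) = (ε ^ 2)⁻¹ * (q ⬝ᵥ q) := by
    rw [Su, Matrix.smul_mulVec, dotProduct_smul, ← Matrix.mulVec_mulVec, hB, smul_eq_mul]
  have hSv : p ⬝ᵥ (g.Sv t *ᵥ p) = r ⬝ᵥ r' := by
    rw [Sv, ← Matrix.mulVec_mulVec, ← Matrix.mulVec_mulVec, hC]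
  have hA : z ⬝ᵥ ((g.A t)ᵀ *ᵥ p) = p ⬝ᵥ (g.A t *ᵥ z) := by
    rw [Matrix.dotProduct_mulVec, Matrix.vecMul_transpose, dotProduct_comm]
  have hR : z ⬝ᵥ (riccati (g.A t) (Su n m₁ m₂ ε - g.Sv t) (g.D t) (K t) *ᵥ z) =
      -(2 * (p ⬝ᵥ (g.A t *ᵥ z))) + (ε ^ 2)⁻¹ * (q ⬝ᵥ q) - r ⬝ᵥ r' - z ⬝ᵥ (g.D t *ᵥ z) := by
    simp only [riccati, Matrix.sub_mulVec, Matrix.add_mulVec, Matrix.neg_mulVec,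
      ← Matrix.mulVec_mulVec, dotProduct_sub, dotProduct_add, dotProduct_neg, hK, ← hp, hA, hSu,
      hSv]
    ring
  rw [dotProduct_add, hR, hK, dotProduct_comm _ p, rhs_eq, dotProduct_add, dotProduct_add, hB, hC]
  have hu : uStar ε K z t = -((ε ^ 2)⁻¹ • q) := rfl
  have hv : g.vStar K z t = r' := rfl
  simp only [gap, runningCost, hu, hv, Matrix.mulVec_sub, sub_neg_eq_add, dotProduct_sub,
    sub_dotProduct, dotProduct_add, add_dotProduct, dotProduct_smul, smul_dotProduct, hGs, hGr,
    smul_eq_mul, dotProduct_comm a q, dotProduct_comm b r, dotProduct_comm r' r]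
  field_simp
  ring

theorem intervalIntegrable_runningCost (hg : g.Standing) {z : ℝ → State n m₁ m₂}
    {a : ℝ → UCtrl m₁ m₂} {b : ℝ → VCtrl l} (hz : ContinuousOn z (Icc 0 g.tf))
    (ha : MemLp a 2 (volume.restrict (Icc 0 g.tf)))
    (hb : MemLp b 2 (volume.restrict (Icc 0 g.tf))) :
    IntervalIntegrable (fun t => g.runningCost ε t (z t) (a t) (b t)) volume 0 g.tf := by
  rw [intervalIntegrable_iff_integrableOn_Icc_of_le hg.tf_pos.le]
  have hz' := continuousOn_pi.1 hz
  refine Integrable.sub (Integrable.add ?_ ?_) ?_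
  · refine ContinuousOn.integrableOn_Icc ?_
    exact continuousOn_finsetSum _ fun i _ =>
      (hz' i).mul (continuousOn_pi.1 (hg.cont_D.mulVec hz) i)
  · exact (integrable_finsetSum _ fun i _ => (ha.eval i).integrable_mul (ha.eval i)).const_mul _
  · simp only [dotProduct, Matrix.mulVec, Finset.mul_sum]
    refine integrable_finsetSum _ fun i _ => integrable_finsetSum _ fun j _ => ?_
    have h : IntegrableOn (fun t => b t i * b t j) (Icc 0 g.tf) :=
      (hb.eval i).integrable_mul (hb.eval j)
    refine (h.continuousOn_mul (hg.cont_G i j) isCompact_Icc).congr ?_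
    exact Filter.Eventually.of_forall fun t => by simp only; ring

theorem SolvesRiccati.matHasDerivWithinAt (hK : g.SolvesRiccati ε K) {t : ℝ}
    (ht : t ∈ Icc 0 g.tf) :
    MatHasDerivWithinAt K (riccati (g.A t) (Su n m₁ m₂ ε - g.Sv t) (g.D t) (K t)) (Icc 0 g.tf) t :=
  hK.2 t ht

theorem IsSymmSolution.matContOn (hK : g.IsSymmSolution ε K) : MatContOn K (Icc 0 g.tf) :=
  matContOn_of_hasDerivWithinAt hK.1.2

theorem IsSymmSolution.absolutelyContinuousOnInterval_apply (hg : g.Standing)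
    (hK : g.IsSymmSolution ε K) (i j : Idx n m₁ m₂) :
    AbsolutelyContinuousOnInterval (fun t => K t i j) 0 g.tf := by
  have hK' : MatContOn (fun t => riccati (g.A t) (Su n m₁ m₂ ε - g.Sv t) (g.D t) (K t))
      (Icc 0 g.tf) :=
    hg.cont_A.riccati ((MatContOn.const _).sub hg.cont_Sv) hg.cont_D hK.matContOn
  exact absolutelyContinuousOnInterval_of_hasDerivWithinAt hg.tf_pos.le
    (fun t ht => hK.1.matHasDerivWithinAt ht i j) (hK' i j)

theorem IsSymmSolution.hasDerivAt_quadForm (hg : g.Standing) (hε : ε ≠ 0)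
    (hK : g.IsSymmSolution ε K) {z : ℝ → State n m₁ m₂} {t : ℝ} (ht : t ∈ Ioo 0 g.tf)
    {a : UCtrl m₁ m₂} {b : VCtrl l} (hz : HasDerivAt z (g.rhs t (z t) a b) t) :
    HasDerivAt (fun t => z t ⬝ᵥ (K t *ᵥ z t))
      (g.gap ε K t (z t) a b - g.runningCost ε t (z t) a b) t := by
  have ht' := Ioo_subset_Icc_self ht
  have h4 : MatHasDerivWithinAt K
      (riccati (g.A t) (Su n m₁ m₂ ε - g.Sv t) (g.D t) (K t)) univ t := fun i j =>
    ((hK.1.matHasDerivWithinAt ht' i j).hasDerivAt (Icc_mem_nhds ht.1 ht.2)).hasDerivWithinAt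
  have h5 := hz.hasDerivWithinAt (s := univ)
  rw [← quadForm_completion hg hε ht' (hK.2 t ht')]
  exact hasDerivWithinAt_univ.1 (h5.dotProduct (h4.hasDerivWithinAt_mulVec h5))

/-- The derivative of zᵀKz is integrated over [0, t_f]: the end value cancels the terminal cost
because K(t_f) = F. Square integrability of the controls makes the running cost integrable. -/
theorem IsTrajectory.costAlong_eq_add_integral_gap (hg : g.Standing) (hε : ε ≠ 0)
    (hK : g.IsSymmSolution ε K) {u : State n m₁ m₂ → ℝ → UCtrl m₁ m₂}
    {v : State n m₁ m₂ → ℝ → VCtrl l} {z₀ : State n m₁ m₂} {z : ℝ → State n m₁ m₂}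
    (hz : g.IsTrajectory u v z₀ z)
    (hu : MemLp (fun t => u (z t) t) 2 (volume.restrict (Icc 0 g.tf)))
    (hv : MemLp (fun t => v (z t) t) 2 (volume.restrict (Icc 0 g.tf))) :
    g.costAlong ε u v z = z₀ ⬝ᵥ (K 0 *ᵥ z₀) +
      ∫ t in (0 : ℝ)..g.tf, g.gap ε K t (z t) (u (z t) t) (v (z t) t) := by
  obtain ⟨hz0, hac, hd⟩ := hz
  have htf := hg.tf_pos.le
  have hV := hac.dotProduct_mulVec (hK.absolutelyContinuousOnInterval_apply hg) hac
  have hzc : ContinuousOn z (Icc 0 g.tf) := by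
    simpa only [uIcc_of_le htf] using hac.continuousOn
  have hV' : ∀ᵐ t ∂(volume.restrict (Icc 0 g.tf)),
      g.runningCost ε t (z t) (u (z t) t) (v (z t) t) + deriv (fun t => z t ⬝ᵥ (K t *ᵥ z t)) t =
        g.gap ε K t (z t) (u (z t) t) (v (z t) t) := by
    filter_upwards [hd, ae_restrict_Icc_of_forall_Ioo fun t ht => ht] with t h1 h2
    rw [(hK.hasDerivAt_quadForm hg hε h2 h1).deriv, add_sub_cancel]
  have hint := intervalIntegral.integral_add
    (intervalIntegrable_runningCost (ε := ε) hg hzc hu hv) hV.intervalIntegrable_deriv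
  rw [hV.integral_deriv_eq_sub, hK.1.1, hz0] at hint
  rw [costAlong_eq, add_comm, ← sub_eq_iff_eq_add', add_sub_assoc, ← hint,
    intervalIntegral.integral_of_le htf, intervalIntegral.integral_of_le htf]
  exact integral_congr_ae (ae_restrict_of_ae_restrict_of_subset Ioc_subset_Icc_self hV')

theorem J_eq_add_integral_gap (hg : g.Standing) (hε : ε ≠ 0) (hK : g.IsSymmSolution ε K)
    {u : State n m₁ m₂ → ℝ → UCtrl m₁ m₂} {v : State n m₁ m₂ → ℝ → VCtrl l} (huv : (u, v) ∈ g.UV)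
    (z₀ : State n m₁ m₂) : ∃ z : ℝ → State n m₁ m₂, g.J ε u v z₀ = z₀ ⬝ᵥ (K 0 *ᵥ z₀) +
      ∫ t in (0 : ℝ)..g.tf, g.gap ε K t (z t) (u (z t) t) (v (z t) t) := by
  obtain ⟨z, hz, huniq, hu, hv⟩ := huv.2.2 z₀
  -- The trajectory chosen in `J` need not be the one provided by admissibility, but they agree on
  -- [0, t_f], which transfers square integrability.
  set y := Classical.epsilon (g.IsTrajectory u v z₀) with hy
  have hyt : g.IsTrajectory u v z₀ y := Classical.epsilon_spec ⟨z, hz⟩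
  have hyz : ∀ᵐ t ∂(volume.restrict (Icc 0 g.tf)), z t = y t :=
    (ae_restrict_mem measurableSet_Icc).mono fun t ht => (huniq y hyt ht).symm
  refine ⟨y, hyt.costAlong_eq_add_integral_gap hg hε hK
    ((memLp_congr_ae ?_).1 hu) ((memLp_congr_ae ?_).1 hv)⟩
  · exact hyz.mono fun t ht => by simp only [ht]
  · exact hyz.mono fun t ht => by simp only [ht]

/-- Against u* the minimizer's square vanishes, and `gap` is minus a nonnegative form in v - v*. -/
theorem J_uStar_le (hg : g.Standing) (hε : ε ≠ 0) (hK : g.IsSymmSolution ε K)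
    {v : State n m₁ m₂ → ℝ → VCtrl l} (hv : v ∈ g.Ev (uStar ε K)) (z₀ : State n m₁ m₂) :
    g.J ε (uStar ε K) v z₀ ≤ z₀ ⬝ᵥ (K 0 *ᵥ z₀) := by
  obtain ⟨z, hz⟩ := J_eq_add_integral_gap hg hε hK hv z₀
  have h : 0 ≤ ∫ t in (0 : ℝ)..g.tf, -g.gap ε K t (z t) (uStar ε K (z t) t) (v (z t) t) := by
    refine intervalIntegral.integral_nonneg hg.tf_pos.le fun t ht => ?_
    simp only [gap, sub_self, zero_dotProduct, mul_zero, zero_sub, neg_neg]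
    exact quadNonneg_of_posSemidef (hg.G_pd t ht).posSemidef _
  rw [intervalIntegral.integral_neg] at h
  linarith

theorem le_J_vStar (hg : g.Standing) (hε : ε ≠ 0) (hK : g.IsSymmSolution ε K)
    {u : State n m₁ m₂ → ℝ → UCtrl m₁ m₂} (hu : u ∈ g.Eu (g.vStar K)) (z₀ : State n m₁ m₂) :
    z₀ ⬝ᵥ (K 0 *ᵥ z₀) ≤ g.J ε u (g.vStar K) z₀ := by
  obtain ⟨z, hz⟩ := J_eq_add_integral_gap hg hε hK hu z₀
  have h : 0 ≤ ∫ t in (0 : ℝ)..g.tf, g.gap ε K t (z t) (u (z t) t) (g.vStar K (z t) t) := by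
    refine intervalIntegral.integral_nonneg hg.tf_pos.le fun t _ => ?_
    have := dotProduct_star_self_nonneg (u (z t) t - uStar ε K (z t) t)
    rw [star_trivial] at this
    simp only [gap, sub_self, zero_dotProduct, sub_zero]
    positivity
  linarith

theorem uStar_vStar_mem_UV (hg : g.Standing) (hK : g.IsSymmSolution ε K) :
    (uStar ε K, g.vStar K) ∈ g.UV := by
  have hKc := hK.matContOn
  have h := mem_UV_of_linear hg
    ((MatContOn.smul (continuousOn_const (c := (ε ^ 2)⁻¹))
      ((MatContOn.const (B n m₁ m₂)ᵀ).mul hKc)).neg)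
    (hg.cont_G_inv.mul (hg.cont_C.transpose.mul hKc))
  convert h using 2
  · funext z t
    simp only [uStar, Matrix.neg_mulVec, Matrix.smul_mulVec, Matrix.mulVec_mulVec]
  · funext z t
    simp only [vStar, Matrix.mulVec_mulVec]

/-- The one-sided inequalities bound the supremum and the infimum, and both bounds are attained at
the pair itself. -/
theorem isValue_uStar_vStar (hg : g.Standing) (hε : ε ≠ 0) (hK : g.IsSymmSolution ε K) :
    g.IsValue ε (uStar ε K) (g.vStar K) fun z₀ => z₀ ⬝ᵥ (K 0 *ᵥ z₀) := by
  have hmem := uStar_vStar_mem_UV hg hK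
  have hJ : ∀ z₀, g.J ε (uStar ε K) (g.vStar K) z₀ = z₀ ⬝ᵥ (K 0 *ᵥ z₀) := fun z₀ =>
    le_antisymm (J_uStar_le hg hε hK hmem z₀) (le_J_vStar hg hε hK hmem z₀)
  refine fun z₀ => ⟨le_antisymm ?_ ?_, le_antisymm ?_ ?_⟩
  · exact iSup₂_le fun v hv => EReal.coe_le_coe_iff.2 (J_uStar_le hg hε hK hv z₀)
  · refine (congrArg _ (hJ z₀)).symm.trans_le ?_
    exact le_iSup₂ (f := fun v (_ : v ∈ g.Ev (uStar ε K)) => (g.J ε (uStar ε K) v z₀ : EReal))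
      _ hmem
  · refine le_of_le_of_eq ?_ (congrArg _ (hJ z₀))
    exact iInf₂_le (f := fun u (_ : u ∈ g.Eu (g.vStar K)) => (g.J ε u (g.vStar K) z₀ : EReal))
      _ hmem
  · exact le_iInf₂ fun u hu => EReal.coe_le_coe_iff.2 (le_J_vStar hg hε hK hu z₀)

end CheapGame

end

theorem corollary1 {n m₁ m₂ l : ℕ} (hm₁ : 0 < m₁) (hm₂ : 0 < m₂)
    (g : CheapGame n m₁ m₂ l) (hg : g.Standing)
    (hA2 : g.AssumptionA2) (hA3 : g.AssumptionA3) (hA4 : g.AssumptionA4) :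
    ∃ ε₀ : ℝ, 0 < ε₀ ∧ ∃ M : ℝ, ∀ ε ∈ Set.Ioc 0 ε₀,
      g.AssumptionA1 ε ∧
      ∃ K : ℝ → Matrix (CheapGame.Idx n m₁ m₂) (CheapGame.Idx n m₁ m₂) ℝ,
        g.IsSymmSolution ε K ∧
        (∀ K', g.SolvesRiccati ε K' → Set.EqOn K' K (Set.Icc 0 g.tf)) ∧
        g.HasScaledBlockForm ε M K ∧
        (CheapGame.uStar ε K, g.vStar K) ∈ g.UV ∧
        g.IsSaddlePoint ε (CheapGame.uStar ε K) (g.vStar K) ∧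
        g.IsValue ε (CheapGame.uStar ε K) (g.vStar K) (fun z₀ => z₀ ⬝ᵥ (K 0 *ᵥ z₀)) ∧
        (∀ z₀, g.J ε (CheapGame.uStar ε K) (g.vStar K) z₀ = z₀ ⬝ᵥ (K 0 *ᵥ z₀)) ∧
        (∀ z₀, ∀ u ∈ g.Eu (g.vStar K), ∀ v ∈ g.Ev (CheapGame.uStar ε K),
          g.J ε (CheapGame.uStar ε K) v z₀ ≤ z₀ ⬝ᵥ (K 0 *ᵥ z₀) ∧
          z₀ ⬝ᵥ (K 0 *ᵥ z₀) ≤ g.J ε u (g.vStar K) z₀) := by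
  obtain ⟨ε₀, M, hε₀, h⟩ := CheapGame.exists_solution_scaledBlockForm hg hA2 hA3 hA4
  refine ⟨ε₀, hε₀, M, fun ε hε => ?_⟩
  obtain ⟨K, hK, hblock⟩ := h ε hε
  have hε' : ε ≠ 0 := hε.1.ne'
  have hmem := CheapGame.uStar_vStar_mem_UV hg hK
  have hval := CheapGame.isValue_uStar_vStar hg hε' hK
  refine ⟨⟨K, hK⟩, K, hK, fun K' hK' => ?_, hblock, hmem, ?_, hval, fun z₀ => ?_,
    fun z₀ u hu v hv => ⟨CheapGame.J_uStar_le hg hε' hK hv z₀,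
      CheapGame.le_J_vStar hg hε' hK hu z₀⟩⟩
  -- Uniqueness holds among all solutions, symmetric or not.
  · exact CheapGame.riccati_solution_unique hg.cont_A
      ((MatContOn.const _).sub hg.cont_Sv) hK'.2 hK.1.2 (hK'.1.trans hK.1.1.symm)
  · exact ⟨⟨hmem.1, _, hmem⟩, ⟨hmem.2.1, _, hmem⟩, fun z₀ => (hval z₀).1.trans (hval z₀).2.symm⟩
  · exact le_antisymm (CheapGame.J_uStar_le hg hε' hK hmem z₀)
      (CheapGame.le_J_vStar hg hε' hK hmem z₀)
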